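/- The following is a theorem of $\mathsf{ZF}$ (Zermelo–Fraenkel set theory without the axiom of choice); equivalently, by Gödel's completeness theorem, it holds in every model $(M,\in)$ of first-order $\mathsf{ZF}$, all notions being interpreted in the model. Call a set $y$ *Dedekind infinite* if there is an injection from $\omega$ into $y$, and *Dedekind finite* otherwise; call $y$ *power Dedekind finite* if its power set $\wp(y)$ is Dedekind finite. A map is *finite-to-one* (*Dedekind-finite-to-one*) if the preimage of every point of its range is finite (Dedekind finite). For a set $x$ let $\mathcal{S}(x)$ be the set of all permutations of $x$, let $\mathcal{S}_{\mathrm{pdf}}(x)$ be the set of those $f\in\mathcal{S}(x)$ for which $\{z\in x: f(z)\neq z\}$ is power Dedekind finite, and let $\mathcal{S}_{\mathrm{fin}}(x)$ be the set of those $f\in\mathcal{S}(x)$ for which $\{z\in x: f(z)\neq z\}$ is finite. For a cardinal $\mathfrak{a}=|x|$ put $\mathfrak{a}!=|\mathcal{S}(x)|$, $\mathcal{S}_{\mathrm{pdf}}(\mathfrak{a})=|\mathcal{S}_{\mathrm{pdf}}(x)|$ and $\mathcal{S}_{\mathrm{fin}}(\mathfrak{a})=|\mathcal{S}_{\mathrm{fin}}(x)|$.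 For cardinals, $\mathfrak{b}\leqslant\mathfrak{c}$ ($\mathfrak{b}\leqslant_{\mathrm{dfto}}\mathfrak{c}$) means that there is an injection (a Dedekind-finite-to-one map) from some set of cardinality $\mathfrak{b}$ into some set of cardinality $\mathfrak{c}$, and $\mathfrak{b}<\mathfrak{c}$ means $\mathfrak{b}\leqslant\mathfrak{c}$ and $\mathfrak{c}\nleqslant\mathfrak{b}$. **Theorem.** Let $x$ be a set and $\mathfrak{a}=|x|$, and suppose that $\mathfrak{a}!$ is Dedekind infinite, that is, $\mathcal{S}(x)$ is Dedekind infinite. Then there is no Dedekind-finite-to-one map from $\mathcal{S}(x)$ into $\mathcal{S}_{\mathrm{pdf}}(x)$; that is, $\mathfrak{a}!\nleqslant_{\mathrm{dfto}}\mathcal{S}_{\mathrm{pdf}}(\mathfrak{a})$. Hence $\mathcal{S}_{\mathrm{pdf}}(\mathfrak{a})<\mathfrak{a}!$. In particular, there is no Dedekind-finite-to-one map, and hence no finite-to-one map, from $\mathcal{S}(x)$ into $\mathcal{S}_{\mathrm{fin}}(x)$; that is, $\mathfrak{a}!\nleqslant_{\mathrm{dfto}}\mathcal{S}_{\mathrm{fin}}(\mathfrak{a})$,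 and $\mathcal{S}_{\mathrm{fin}}(\mathfrak{a})<\mathfrak{a}!$. -/

import Mathlib

namespace InZF

/-! ### The first-order language of set theory and models of Zermelo-Fraenkel set theory -/

/-- The relation symbols of the language of set theory: one binary symbol. -/
inductive SetRel : ℕ → Type
  | mem : SetRel 2

/-- The first-order language of set theory. -/
def setLang : FirstOrder.Language.{0, 0} := ⟨fun _ => Empty, SetRel⟩

/-- A type with a binary relation `∈` is a structure for the language of set theory. -/
instance setStructure (M : Type*) [Membership M M] : setLang.Structure M where
  funMap := fun f => Empty.elim f
  RelMap := fun r v => match r, v with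
    | SetRel.mem, v => v 0 ∈ v 1

/-- `(M, ∈)` is a model of first-order Zermelo-Fraenkel set theory, without the axiom of choice.
In the two schemes, "definable" means definable in `(M, ∈)` by a first-order formula of the language
of set theory with parameters from `M`. -/
structure IsModelOfZF (M : Type*) [Membership M M] : Prop where
  extensionality : ∀ x y : M, (∀ z : M, z ∈ x ↔ z ∈ y) → x = y
  foundation : ∀ x : M, (∃ y : M, y ∈ x) → ∃ y ∈ x, ∀ z ∈ y, z ∉ x
  pairing : ∀ x y : M, ∃ p : M, ∀ z : M, z ∈ p ↔ z = x ∨ z = y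
  union : ∀ x : M, ∃ u : M, ∀ z : M, z ∈ u ↔ ∃ y ∈ x, z ∈ y
  powerset : ∀ x : M, ∃ p : M, ∀ z : M, z ∈ p ↔ ∀ w ∈ z, w ∈ x
  infinity : ∃ w : M, (∃ e ∈ w, ∀ z : M, z ∉ e) ∧
    ∀ n ∈ w, ∃ s ∈ w, ∀ z : M, z ∈ s ↔ z ∈ n ∨ z = n
  separation : ∀ A : M → Prop, (Set.univ : Set M).Definable₁ setLang {x : M | A x} →
    ∀ x : M, ∃ y : M, ∀ z : M, z ∈ y ↔ z ∈ x ∧ A z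
  replacement : ∀ R : M → M → Prop, (Set.univ : Set M).Definable₂ setLang {q : M × M | R q.1 q.2} →
    ∀ x : M, (∀ a ∈ x, ∀ b c : M, R a b → R a c → b = c) →
      ∃ y : M, ∀ b : M, b ∈ y ↔ ∃ a ∈ x, R a b

/-! ### Set-theoretic notions, interpreted inside `(M, ∈)`

All quantifiers below range over `M`, and functions, permutations and so on are elements of `M`. -/

section Notions

variable {M : Type*} [Membership M M]

/-- `u = {a, b}`. -/
def IsPair (u a b : M) : Prop := ∀ z : M, z ∈ u ↔ z = a ∨ z = b

/-- `p` is the Kuratowski ordered pair `(a, b) = {{a}, {a, b}}`. -/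
def IsOrderedPair (p a b : M) : Prop := ∀ z : M, z ∈ p ↔ IsPair z a a ∨ IsPair z a b

/-- `(a, b) ∈ f`. -/
def PairMem (f a b : M) : Prop := ∃ p ∈ f, IsOrderedPair p a b

/-- `f` is a function from `x` into `y`. -/
def IsFunction (f x y : M) : Prop :=
  (∀ p ∈ f, ∃ a ∈ x, ∃ b ∈ y, IsOrderedPair p a b) ∧ ∀ a ∈ x, ∃! b : M, PairMem f a b

/-- `f` is an injection from `x` into `y`. -/
def IsInjection (f x y : M) : Prop :=
  IsFunction f x y ∧ ∀ a b c : M, PairMem f a c → PairMem f b c → a = b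

/-- `f` is a bijection from `x` onto `y`. -/
def IsBijection (f x y : M) : Prop :=
  IsInjection f x y ∧ ∀ b ∈ y, ∃ a : M, PairMem f a b

/-- `x` and `y` have the same cardinal. -/
def Equinumerous (x y : M) : Prop := ∃ f : M, IsBijection f x y

/-- `x ≼ y`: there is an injection from `x` into `y`. -/
def Injects (x y : M) : Prop := ∃ f : M, IsInjection f x y

/-- `w` contains `∅` and is closed under `n ↦ n ∪ {n}`. -/
def IsInductive (w : M) : Prop :=
  (∃ e ∈ w, ∀ z : M, z ∉ e) ∧ ∀ n ∈ w, ∃ s ∈ w, ∀ z : M, z ∈ s ↔ z ∈ n ∨ z = n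

/-- `w = ω`, the least inductive set (as computed in `M`). -/
def IsOmega (w : M) : Prop := IsInductive w ∧ ∀ v : M, IsInductive v → ∀ n ∈ w, n ∈ v

/-- `x` is finite: it is equinumerous to some `n ∈ ω`. -/
def IsFinite (x : M) : Prop := ∃ w : M, IsOmega w ∧ ∃ n ∈ w, Equinumerous x n

/-- `x` is Dedekind infinite: `ω ≼ x`. -/
def DedekindInfinite (x : M) : Prop := ∃ w : M, IsOmega w ∧ Injects w x

/-- `x` is Dedekind finite. -/
def DedekindFinite (x : M) : Prop := ¬ DedekindInfinite x

/-- `p` is the power set of `x`. -/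
def IsPowerSet (p x : M) : Prop := ∀ z : M, z ∈ p ↔ ∀ w ∈ z, w ∈ x

/-- `x` is power Dedekind infinite: its power set is Dedekind infinite. -/
def PowerDedekindInfinite (x : M) : Prop := ∃ p : M, IsPowerSet p x ∧ DedekindInfinite p

/-- `x` is power Dedekind finite. -/
def PowerDedekindFinite (x : M) : Prop := ¬ PowerDedekindInfinite x

/-- `t` is the fibre `f⁻¹[{z}]`. -/
def IsFibre (t f z : M) : Prop := ∀ a : M, a ∈ t ↔ PairMem f a z

/-- `f` is a finite-to-one map from `x` into `y`:
the fibre over every point of the range of `f` is finite. -/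
def IsFiniteToOne (f x y : M) : Prop :=
  IsFunction f x y ∧ ∀ z : M, (∃ a : M, PairMem f a z) → ∃ t : M, IsFibre t f z ∧ IsFinite t

/-- `f` is a Dedekind-finite-to-one map from `x` into `y`:
the fibre over every point of the range of `f` is Dedekind finite. -/
def IsDedekindFiniteToOne (f x y : M) : Prop :=
  IsFunction f x y ∧
    ∀ z : M, (∃ a : M, PairMem f a z) → ∃ t : M, IsFibre t f z ∧ DedekindFinite t

/-- There is a Dedekind-finite-to-one map from `x` into `y`. -/
def DftoMaps (x y : M) : Prop := ∃ f : M, IsDedekindFiniteToOne f x y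

/-- There is a finite-to-one map from `x` into `y`. -/
def FtoMaps (x y : M) : Prop := ∃ f : M, IsFiniteToOne f x y

/-- `|x| ≤ |y|`: some set of cardinality `|x|` injects into some set of cardinality `|y|`. -/
def CardLE (x y : M) : Prop :=
  ∃ x' y' : M, Equinumerous x' x ∧ Equinumerous y' y ∧ Injects x' y'

/-- `|x| < |y|`: `|x| ≤ |y|` but not `|y| ≤ |x|`. -/
def CardLT (x y : M) : Prop := CardLE x y ∧ ¬ CardLE y x

/-- There is a Dedekind-finite-to-one map from some set of cardinality `|x|`
into some set of cardinality `|y|`. -/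
def CardLEDfto (x y : M) : Prop :=
  ∃ x' y' : M, Equinumerous x' x ∧ Equinumerous y' y ∧ DftoMaps x' y'

/-- `f` is a permutation of `x`. -/
def IsPermutation (f x : M) : Prop := IsBijection f x x

/-- `m` is the set of the elements moved by the function `f`. -/
def IsMoved (m f : M) : Prop := ∀ z : M, z ∈ m ↔ ∃ v : M, PairMem f z v ∧ v ≠ z

/-- `s = 𝒮(x)`, the set of all permutations of `x`. -/
def IsSym (s x : M) : Prop := ∀ f : M, f ∈ s ↔ IsPermutation f x

/-- `s = 𝒮_pdf(x)`, the set of all permutations of `x` that move only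
power Dedekind finitely many elements. -/
def IsSymPdf (s x : M) : Prop :=
  ∀ f : M, f ∈ s ↔ IsPermutation f x ∧ ∃ m : M, IsMoved m f ∧ PowerDedekindFinite m

/-- `s = 𝒮_fin(x)`, the set of all permutations of `x` that move only finitely many elements. -/
def IsSymFin (s x : M) : Prop :=
  ∀ f : M, f ∈ s ↔ IsPermutation f x ∧ ∃ m : M, IsMoved m f ∧ IsFinite m

end Notions

end InZF

/-!
The argument takes place inside `M`. Separation and replacement are available for definable classes
only, so every set operation comes with a proof that it is definable, found by instance search for
the class `Dfn`; this is what makes it possible to argue in `M` almost as one does in informal set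
theory.

Suppose that `u` maps `𝒮(x)` into `𝒮_pdf(x)` with Dedekind finite fibres and that `𝒮(x)` contains an
`ω`-sequence. The sequence is prolonged along all ordinals to an injection of the ordinals into
`𝒮(x)`, which contradicts replacement (`not_dedekindInfinite_sym`). What has to be defined, without
choice, is a permutation outside a given injective sequence `a` of permutations whose length is an
infinite ordinal (`newPerm`). If the sequence is not closed under quotients or under `u`, there is a
first counterexample. Otherwise the members of the sequence that lie in `𝒮_pdf(x)` form a
well-ordered group `G`, infinite because `u` maps the whole sequence into it with finite fibres. A
permutation outside the sequence is then obtained by diagonalization, as follows.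

* The basic tool is a pigeonhole principle: a map from an infinite set of ordinals to a Dedekind
  finite set has an infinite fibre (`exists_fibre_not_oFin`). It is mostly applied to maps into the
  power set of a power Dedekind finite set. One consequence is that only finitely many members of
  `G` move no point outside a given power Dedekind finite set (`PermFamily.oFin_of_moved_subset`).

* The finite subsets of an infinite set `I` of ordinals can be coded by elements of `I`, uniformly
  in `I` (`isCoding_enc`). That an injection exists is standard; what matters is that one is
  definable from `I`.

* Call two points equivalent if they are moved by the same members of `G`. The classes, called
  blocks, can be labelled by ordinals, because a finite subset of the index set of `G` determines
  the block (`PermFamily.lab_eq_iff`). The group permutes the blocks. Each orbit of blocks yields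
  pairwise disjoint permutations, each of which acts on one block, or exchanges two blocks, by means
  of a member of `G` that is chosen as the first suitable one: a single permutation if the orbit is
  finite, and one for each block of the orbit if the orbit is infinite. This gives disjoint
  nontrivial permutations `q b` indexed by a set `J` of labels (`PermFamily.pieces`).

* Assign to the `j`-th member of the sequence the set of those indices in `J` whose orbits, or
  blocks, are met by the points moved by `u (a j)`. This is a finite subset of `J`, and every finite
  subset is assigned to finitely many `j` only (`PermFamily.oFin_of_repSet_subset`). It follows that
  `J` is infinite. Coding finite subsets and pairs by elements of `J`, the products of the
  permutations `q b` over suitable subsets of `J` contain one that differs from all members of the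
  sequence (`Pieces.diagPerm_spec`).
-/

-- Proving definability of a compound set operation can take a long instance search.
set_option synthInstance.maxSize 10000
set_option synthInstance.maxHeartbeats 400000
-- Several lemmas on finite sets hold without the axioms, but are used in models only.
set_option linter.unusedSectionVars false

namespace InZF

/-! ### Definable maps -/

section Definability

variable {M : Type*} [Membership M M]

/-- Drop the first value of a valuation. In formulas the value at `0` plays the part of the variable
bound by the outermost quantifier. -/
def vtail (v : ℕ → M) : ℕ → M := fun n => v (n + 1)

/-- A predicate of valuations `ℕ → M` is definable in `(M, ∈)` with parameters. A formula mentions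
only finitely many variables, so `ℕ` serves as a common supply of variables. -/
def DefPred (P : (ℕ → M) → Prop) : Prop :=
  (Set.univ : Set M).Definable setLang {v : ℕ → M | P v}

namespace DefPred

variable {P Q : (ℕ → M) → Prop}

theorem not (h : DefPred P) : DefPred fun v => ¬ P v := h.compl
theorem and (h : DefPred P) (h' : DefPred Q) : DefPred fun v => P v ∧ Q v := h.inter h'
theorem or (h : DefPred P) (h' : DefPred Q) : DefPred fun v => P v ∨ Q v := h.union h'

theorem imp (h : DefPred P) (h' : DefPred Q) : DefPred fun v => P v → Q v := by
  simpa only [imp_iff_not_or] using h.not.or h'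

/-- Renaming, and possibly identifying, variables. -/
theorem rename (h : DefPred P) (ρ : ℕ → ℕ) : DefPred fun v => P fun n => v (ρ n) :=
  h.preimage_comp ρ

theorem ex {P : M → (ℕ → M) → Prop} (h : DefPred fun v => P (v 0) (vtail v)) :
    DefPred fun v => ∃ y, P y v := by
  have h1 := h.preimage_comp
    (fun n => Nat.casesOn n (Sum.inr 0) Sum.inl : ℕ → ℕ ⊕ Fin 1)
  have h2 := Set.Definable.exists_of_finite h1
  unfold DefPred
  convert h2 using 1
  ext v
  simp only [Set.mem_ofPred_eq]
  constructor
  · rintro ⟨y, hy⟩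
    exact ⟨fun _ => y, hy⟩
  · rintro ⟨y, hy⟩
    exact ⟨y 0, hy⟩

theorem all {P : M → (ℕ → M) → Prop} (h : DefPred fun v => P (v 0) (vtail v)) :
    DefPred fun v => ∀ y, P y v := by
  simpa only [not_exists_not] using (ex (P := fun y v => ¬ P y v) h.not).not

theorem eq_var (i j : ℕ) : DefPred fun v : ℕ → M => v i = v j :=
  ⟨(FirstOrder.Language.var i).equal (FirstOrder.Language.var j), by
    ext v; simp [FirstOrder.Language.Formula.realize_equal]⟩

theorem eq_const (i : ℕ) (c : M) : DefPred fun v : ℕ → M => v i = c :=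
  ⟨(FirstOrder.Language.var i).equal
    (FirstOrder.Language.Constants.term (setLang.con (⟨c, trivial⟩ : (Set.univ : Set M)))), by
    ext v; simp [FirstOrder.Language.Formula.realize_equal]⟩

theorem mem_var (i j : ℕ) : DefPred fun v : ℕ → M => v i ∈ v j := by
  have h : (∅ : Set M).Definable setLang {v : ℕ → M | v i ∈ v j} := by
    rw [Set.empty_definable_iff]
    let m : setLang.Relations 2 := SetRel.mem
    refine ⟨m.formula ![FirstOrder.Language.var i, FirstOrder.Language.var j], ?_⟩
    ext v
    rw [Set.mem_ofPred_eq, Set.mem_ofPred_eq, FirstOrder.Language.Formula.realize_rel]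
    exact Iff.rfl
  exact h.mono (Set.empty_subset _)

end DefPred

/-- A type `α` together with a notion of definable map from valuations into `α`, its *plots*, stable
under renaming of variables. The types in use are `M`, `Prop` and their finite products; they allow
definability to be stated for operations with any number of arguments without choosing names for the
variables. -/
class DefSpace (M : Type*) [Membership M M] (α : Type*) where
  /-- The definable maps from valuations into `α`. -/
  Plot : ((ℕ → M) → α) → Prop
  /-- Plots are stable under renaming of variables. -/
  rename : ∀ {r : (ℕ → M) → α}, Plot r → ∀ ρ : ℕ → ℕ, Plot fun v => r fun n => v (ρ n)

/-- A map into `M` is a plot when its graph is definable. -/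
instance : DefSpace M M where
  Plot t := DefPred fun v => v 0 = t (vtail v)
  rename h ρ := h.rename fun n => Nat.casesOn n 0 fun k => ρ k + 1

instance : DefSpace M Prop where
  Plot P := DefPred P
  rename h ρ := h.rename ρ

instance {α β : Type*} [DefSpace M α] [DefSpace M β] : DefSpace M (α × β) where
  Plot r := DefSpace.Plot (fun v => (r v).1) ∧ DefSpace.Plot (fun v => (r v).2)
  rename h ρ := ⟨DefSpace.rename h.1 ρ, DefSpace.rename h.2 ρ⟩

/-- `f` is definable in `(M, ∈)` with parameters: it carries plots to plots. For maps between finite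
powers of `M` this is definability of the graph, and for predicates it is definability of the
extension.

Being a class, it is proved by instance search, which follows the syntax of the map: there is an
instance for each logical connective, and one for each set operation defined below. Every such
instance takes the arguments of the operation as arbitrary definable maps on a context `Γ`. The
conclusions are marked `no_index` because a goal like `Dfn M fun γ => app f γ` is eta-reduced to
`Dfn M (app f)` when it is looked up, and would then miss an instance filed under a lambda. -/
class Dfn (M : Type*) [Membership M M] {α β : Type*} [DefSpace M α] [DefSpace M β]
    (f : α → β) : Prop where
  plot : ∀ {r : (ℕ → M) → α}, DefSpace.Plot r → DefSpace.Plot fun v => f (r v)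

theorem plot_zero {M : Type*} [i : Membership M M] : @DefSpace.Plot M i M _ fun v => v 0 :=
  DefPred.eq_var 0 1

/-- Passing to a quantified variable: `γ` is read after dropping the new variable. -/
theorem plot_push {Γ : Type*} [DefSpace M Γ] {r : (ℕ → M) → Γ} (hr : DefSpace.Plot r) :
    DefSpace.Plot (M := M) (α := Γ × M) fun v => (r (vtail v), v 0) :=
  ⟨DefSpace.rename hr (· + 1), plot_zero⟩

section Rules

variable {Γ α β : Type*} [DefSpace M Γ] [DefSpace M α] [DefSpace M β]

instance (priority := 2000) : Dfn M (no_index fun γ : Γ => γ) := ⟨fun h => h⟩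
instance (priority := 2000) (c : M) : Dfn M (no_index fun _ : Γ => c) :=
  ⟨fun _ => DefPred.eq_const 0 c⟩
instance (priority := 2000) (c : Prop) : Dfn M (no_index fun _ : Γ => c) := ⟨fun _ => by
  by_cases h : c
  · simp [h, DefSpace.Plot, DefPred]
  · simp [h, DefSpace.Plot, DefPred]⟩
instance (priority := 1900) (t : Γ → α × β) [h : Dfn M t] : Dfn M (no_index fun γ => (t γ).1) :=
  ⟨fun hr => (h.plot hr).1⟩
instance (priority := 1900) (t : Γ → α × β) [h : Dfn M t] : Dfn M (no_index fun γ => (t γ).2) :=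
  ⟨fun hr => (h.plot hr).2⟩

/-- Composition with a definable map. This rule and the next two apply to maps that are variables;
their low priority keeps them from taking compound expressions apart in the wrong place. -/
instance (priority := 90) Dfn.comp (f : α → β) (g : Γ → α) [hf : Dfn M f] [hg : Dfn M g] :
    Dfn M (no_index fun γ => f (g γ)) :=
  ⟨fun hr => hf.plot (hg.plot hr)⟩

/-- Composition with a definable map of two variables. -/
instance (priority := 80) Dfn.comp₂ {δ : Type*} [DefSpace M δ] (f : α → β → δ) (g : Γ → α)
    (g' : Γ → β) [hf : Dfn M (fun p : α × β => f p.1 p.2)] [hg : Dfn M g] [hg' : Dfn M g'] :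
    Dfn M (no_index fun γ => f (g γ) (g' γ)) :=
  ⟨fun {r} hr => hf.plot (r := fun v => (g (r v), g' (r v))) ⟨hg.plot hr, hg'.plot hr⟩⟩

/-- Composition with a definable map of three variables. -/
instance (priority := 70) Dfn.comp₃ {δ ε : Type*} [DefSpace M δ] [DefSpace M ε]
    (f : α → β → δ → ε) (g : Γ → α) (g' : Γ → β) (g'' : Γ → δ)
    [hf : Dfn M (fun p : (α × β) × δ => f p.1.1 p.1.2 p.2)] [hg : Dfn M g] [hg' : Dfn M g']
    [hg'' : Dfn M g''] : Dfn M (no_index fun γ => f (g γ) (g' γ) (g'' γ)) :=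
  ⟨fun {r} hr => hf.plot (r := fun v => ((g (r v), g' (r v)), g'' (r v)))
    ⟨⟨hg.plot hr, hg'.plot hr⟩, hg''.plot hr⟩⟩

variable (P Q : Γ → Prop) (t s : Γ → M)

instance (priority := 1500) [h : Dfn M P] [h' : Dfn M Q] : Dfn M (no_index fun γ => P γ ∧ Q γ) :=
  ⟨fun hr => (h.plot hr).and (h'.plot hr)⟩
instance (priority := 1500) [h : Dfn M P] [h' : Dfn M Q] : Dfn M (no_index fun γ => P γ ∨ Q γ) :=
  ⟨fun hr => (h.plot hr).or (h'.plot hr)⟩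
-- This instance covers negations as well.
instance (priority := 1500) dfn_imp [h : Dfn M P] [h' : Dfn M Q] :
    Dfn M (no_index fun γ => P γ → Q γ) :=
  ⟨fun hr => (h.plot hr).imp (h'.plot hr)⟩
instance (priority := 1500) [h : Dfn M P] [h' : Dfn M Q] : Dfn M (no_index fun γ => P γ ↔ Q γ) := by
  simp only [iff_iff_implies_and_implies]; infer_instance
instance (priority := 1500) (P : Γ → M → Prop) [h : Dfn M (fun p : Γ × M => P p.1 p.2)] :
    Dfn M (no_index fun γ => ∃ y, P γ y) :=
  ⟨fun {r} hr => DefPred.ex (P := fun y v => P (r v) y) (h.plot (plot_push hr))⟩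
instance (priority := 1500) dfn_all (P : Γ → M → Prop) [h : Dfn M (fun p : Γ × M => P p.1 p.2)] :
    Dfn M (no_index fun γ => ∀ y, P γ y) :=
  ⟨fun {r} hr => DefPred.all (P := fun y v => P (r v) y) (h.plot (plot_push hr))⟩
instance (priority := 1500) [h : Dfn M t] [h' : Dfn M s] :
    Dfn M (no_index fun γ => t γ = s γ) := ⟨fun {r} hr => by
  have h1 : DefPred fun v => ∃ y, y = t (r v) ∧ y = s (r v) :=
    DefPred.ex (P := fun y v => y = t (r v) ∧ y = s (r v)) ((h.plot hr).and (h'.plot hr))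
  simpa [DefSpace.Plot] using h1⟩
instance (priority := 1500) [h : Dfn M t] [h' : Dfn M s] : Dfn M (no_index fun γ => t γ ≠ s γ) := by
  unfold Ne; infer_instance
instance (priority := 1500) [h : Dfn M t] [h' : Dfn M s] :
    Dfn M (no_index fun γ => t γ ∈ s γ) := ⟨fun {r} hr => by
  have h1 : DefPred fun v => ∃ y, y = t (r v) ∧ ∃ z, z = s (r v) ∧ y ∈ z := by
    refine DefPred.ex (P := fun y v => y = t (r v) ∧ ∃ z, z = s (r v) ∧ y ∈ z)
      ((h.plot hr).and (DefPred.ex (P := fun z v => z = s (r (vtail v)) ∧ v 0 ∈ z) ?_))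
    exact (DefSpace.rename (h'.plot hr) (· + 1)).and (DefPred.mem_var 1 0)
  simpa [DefSpace.Plot] using h1⟩
instance (priority := 1500) (P : Γ → M → Prop) [h : Dfn M (fun p : Γ × M => P p.1 p.2)] :
    Dfn M (no_index fun γ => ∃! y, P γ y) := by
  have : Dfn M (fun p : (Γ × M) × M => P p.1.1 p.2) :=
    ⟨fun {r} hr => h.plot (r := fun v => ((r v).1.1, (r v).2)) ⟨hr.1.1, hr.2⟩⟩
  unfold ExistsUnique; beta_reduce; infer_instance

/-- A map into `M` is definable when its graph is. -/
theorem Dfn.of_graph [h : Dfn M (fun p : Γ × M => p.2 = t p.1)] : Dfn M t :=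
  ⟨fun hr => h.plot (plot_push hr)⟩

instance (priority := 1500) (P : Γ → Prop) [∀ γ, Decidable (P γ)] [h : Dfn M t] [h' : Dfn M s]
    [Dfn M P] :
    Dfn M (no_index fun γ => if P γ then t γ else s γ) := by
  have : Dfn M (fun p : Γ × M => p.2 = if P p.1 then t p.1 else s p.1) := by
    have : ∀ p : Γ × M, (p.2 = if P p.1 then t p.1 else s p.1) =
        ((P p.1 → p.2 = t p.1) ∧ (¬ P p.1 → p.2 = s p.1)) := by
      intro p; split_ifs with h <;> simp [h]
    simp only [this]; infer_instance
  exact Dfn.of_graph _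

end Rules
end Definability

/-! ### Set operations in a model of ZF -/

/-- `(M, ∈)` is a model of ZF, as a class. -/
class ZF (M : Type*) [Membership M M] : Prop where
  isModel : IsModelOfZF M

section Sets

variable {M : Type*} [Membership M M] [ZF M]

theorem ext {x y : M} (h : ∀ z, z ∈ x ↔ z ∈ y) : x = y := ZF.isModel.extensionality x y h

theorem exists_sep (x : M) (P : M → Prop) [h : Dfn M P] :
    ∃ y : M, ∀ z : M, z ∈ y ↔ z ∈ x ∧ P z :=
  ZF.isModel.separation P ((h.plot plot_zero).preimage_comp (fun _ => (0 : Fin 1))) x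

theorem exists_image (x : M) (F : M → M) [h : Dfn M F] :
    ∃ y : M, ∀ z : M, z ∈ y ↔ ∃ a ∈ x, z = F a := by
  have h2 : Dfn M (fun p : M × M => p.2 = F p.1) := inferInstance
  have h3 : DefSpace.Plot (M := M) (α := M × M) fun v => (v 0, v 1) :=
    ⟨plot_zero, DefPred.eq_var 0 2⟩
  have h4 : (Set.univ : Set M).Definable₂ setLang {q : M × M | q.2 = F q.1} :=
    Set.Definable.preimage_comp (fun n : ℕ => if n = 0 then (0 : Fin 2) else 1) (h2.plot h3)
  refine ZF.isModel.replacement (fun a b => b = F a) h4 x ?_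
  rintro a - b c rfl rfl; rfl

theorem exists_empty : ∃ e : M, ∀ z, z ∉ e := by
  obtain ⟨w, ⟨e, -, he⟩, -⟩ := (ZF.isModel (M := M)).infinity
  exact ⟨e, he⟩

/-- The empty set. -/
noncomputable def emp (M : Type*) [Membership M M] [ZF M] : M := exists_empty.choose

@[simp] theorem notMem_emp (z : M) : z ∉ emp M := exists_empty.choose_spec z

theorem eq_emp_iff {x : M} : x = emp M ↔ ∀ z, z ∉ x :=
  ⟨fun h => h ▸ notMem_emp, fun h => ext fun z => by simp [h z]⟩

theorem ne_emp_iff {x : M} : x ≠ emp M ↔ ∃ z, z ∈ x := by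
  simp [eq_emp_iff]

open Classical in
/-- The unique set with a property, and `∅` if there is no such set. -/
noncomputable def the (P : M → Prop) : M :=
  if h : ∃ y, P y ∧ ∀ z, P z → z = y then h.choose else emp M

theorem the_spec {P : M → Prop} {y : M} (hy : P y) (h : ∀ z, P z → z = y) : P (the P) := by
  have hex : ∃ y, P y ∧ ∀ z, P z → z = y := ⟨y, hy, h⟩
  rw [the, dif_pos hex]; exact hex.choose_spec.1

theorem the_eq {P : M → Prop} {y : M} (hy : P y) (h : ∀ z, P z → z = y) : the P = y :=
  h _ (the_spec hy h)

instance dfn_the {Γ : Type*} [DefSpace M Γ] (P : Γ → M → Prop)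
    [h : Dfn M (fun p : Γ × M => P p.1 p.2)] : Dfn M (no_index fun γ => the (P γ)) := by
  have : Dfn M (fun p : Γ × M => p.2 = the (P p.1)) := by
    have : ∀ p : Γ × M, (p.2 = the (P p.1)) = ((P p.1 p.2 ∧ ∀ z, P p.1 z → z = p.2) ∨
        (¬ (∃ y, P p.1 y ∧ ∀ z, P p.1 z → z = y) ∧ p.2 = emp M)) := by
      rintro ⟨γ, y⟩
      apply propext
      by_cases hex : ∃ y, P γ y ∧ ∀ z, P γ z → z = y
      · obtain ⟨y', h1, h2⟩ := hex
        simp only [the_eq h1 h2]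
        constructor
        · rintro rfl; exact Or.inl ⟨h1, h2⟩
        · rintro (⟨h3, -⟩ | ⟨h3, -⟩)
          · exact h2 _ h3
          · exact absurd ⟨y', h1, h2⟩ h3
      · rw [the, dif_neg hex]
        constructor
        · exact fun h => Or.inr ⟨hex, h⟩
        · rintro (h3 | ⟨-, h3⟩)
          · exact absurd ⟨_, h3⟩ hex
          · exact h3
    simp only [this]; infer_instance
  exact Dfn.of_graph _

/-- The set of all elements with a property, and `∅` if they do not form a set. -/
noncomputable def coll (P : M → Prop) : M := the fun y => ∀ z, z ∈ y ↔ P z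

instance dfn_coll {Γ : Type*} [DefSpace M Γ] (P : Γ → M → Prop)
    [h : Dfn M (fun p : Γ × M => P p.1 p.2)] : Dfn M (no_index fun γ => coll (P γ)) := by
  have : Dfn M (fun p : (Γ × M) × M => P p.1.1 p.2) :=
    Dfn.comp₂ P (fun p : (Γ × M) × M => p.1.1) (fun p => p.2)
  unfold coll; infer_instance

theorem mem_coll' {P : M → Prop} {y : M} (h : ∀ z, z ∈ y ↔ P z) (z : M) : z ∈ coll P ↔ P z :=
  the_spec (P := fun y => ∀ z, z ∈ y ↔ P z) h (fun _ h' => ext fun z => (h' z).trans (h z).symm) z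

theorem mem_coll {P : M → Prop} [Dfn M P] (b : M) (h : ∀ z, P z → z ∈ b) (z : M) :
    z ∈ coll P ↔ P z := by
  obtain ⟨y, hy⟩ := exists_sep b P
  exact mem_coll' (y := y) (fun z => (hy z).trans ⟨And.right, fun hz => ⟨h z hz, hz⟩⟩) z

/-- `{z ∈ x | P z}` -/
noncomputable def sep (x : M) (P : M → Prop) : M := coll fun z => z ∈ x ∧ P z
/-- `{F a | a ∈ x}` -/
noncomputable def image (x : M) (F : M → M) : M := coll fun z => ∃ a ∈ x, z = F a
/-- `{a, b}` -/
noncomputable def upair (a b : M) : M := coll fun z => z = a ∨ z = b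
/-- `a ∪ b` -/
noncomputable def union (a b : M) : M := coll fun z => z ∈ a ∨ z ∈ b
/-- `⋃ x` -/
noncomputable def sUnion (x : M) : M := coll fun z => ∃ y ∈ x, z ∈ y
/-- `℘(x)` -/
noncomputable def pow (x : M) : M := coll fun z => ∀ w ∈ z, w ∈ x
/-- `n ∪ {n}` -/
noncomputable def succ (n : M) : M := coll fun z => z ∈ n ∨ z = n
/-- `(a, b)` -/
noncomputable def opair (a b : M) : M := upair (upair a a) (upair a b)
/-- The function `a ↦ F a` on `x`. -/
noncomputable def lam (x : M) (F : M → M) : M := image x fun a => opair a (F a)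
/-- The value of the function `f` at `a`. -/
noncomputable def app (f a : M) : M := the fun b => opair a b ∈ f
/-- The domain of the function `f`. -/
noncomputable def dom (f : M) : M := coll fun a => ∃ b, opair a b ∈ f

section
variable {Γ : Type*} [DefSpace M Γ] (t s : Γ → M) [Dfn M t] [Dfn M s]

instance dfn_sep (P : Γ → M → Prop) [h : Dfn M (fun p : Γ × M => P p.1 p.2)] :
    Dfn M (no_index fun γ => sep (t γ) (P γ)) := by unfold sep; infer_instance
instance dfn_image (F : Γ → M → M) [h : Dfn M (fun p : Γ × M => F p.1 p.2)] :
    Dfn M (no_index fun γ => image (t γ) (F γ)) := by unfold image; infer_instance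
instance dfn_upair : Dfn M (no_index fun γ => upair (t γ) (s γ)) := by unfold upair; infer_instance
instance dfn_sUnion : Dfn M (no_index fun γ => sUnion (t γ)) := by unfold sUnion; infer_instance
instance dfn_pow : Dfn M (no_index fun γ => pow (t γ)) := by unfold pow; infer_instance
instance dfn_succ : Dfn M (no_index fun γ => succ (t γ)) := by unfold succ; infer_instance
instance dfn_opair : Dfn M (no_index fun γ => opair (t γ) (s γ)) := by unfold opair; infer_instance
instance dfn_lam (F : Γ → M → M) [h : Dfn M (fun p : Γ × M => F p.1 p.2)] :
    Dfn M (no_index fun γ => lam (t γ) (F γ)) := by unfold lam; infer_instance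
instance dfn_app : Dfn M (no_index fun γ => app (t γ) (s γ)) := by unfold app; infer_instance
instance dfn_dom : Dfn M (no_index fun γ => dom (t γ)) := by unfold dom; infer_instance
end

@[simp] theorem mem_sep (x : M) (P : M → Prop) [Dfn M P] (z : M) : z ∈ sep x P ↔ z ∈ x ∧ P z :=
  mem_coll x (fun _ h => h.1) z

@[simp] theorem mem_image (x : M) (F : M → M) [Dfn M F] (z : M) :
    z ∈ image x F ↔ ∃ a ∈ x, z = F a :=
  let ⟨_, h⟩ := exists_image x F; mem_coll' h z

@[simp] theorem mem_upair (a b z : M) : z ∈ upair a b ↔ z = a ∨ z = b :=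
  let ⟨_, h⟩ := ZF.isModel.pairing a b; mem_coll' h z

@[simp] theorem mem_sUnion (x z : M) : z ∈ sUnion x ↔ ∃ y ∈ x, z ∈ y :=
  let ⟨_, h⟩ := ZF.isModel.union x; mem_coll' h z

@[simp] theorem mem_pow (x z : M) : z ∈ pow x ↔ ∀ w ∈ z, w ∈ x :=
  let ⟨_, h⟩ := ZF.isModel.powerset x; mem_coll' h z

@[simp] theorem mem_union (a b z : M) : z ∈ union a b ↔ z ∈ a ∨ z ∈ b :=
  mem_coll (sUnion (upair a b)) (fun z h => by simpa using h) z

@[simp] theorem mem_succ (n z : M) : z ∈ succ n ↔ z ∈ n ∨ z = n :=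
  mem_coll (union n (upair n n)) (fun z h => by simpa using h) z

theorem upair_self_inj {a b : M} (h : upair a a = upair b b) : a = b := by
  have : a ∈ upair b b := h ▸ (mem_upair a a a).2 (Or.inl rfl)
  simpa using this

@[simp] theorem opair_inj {a b c d : M} : opair a b = opair c d ↔ a = c ∧ b = d := by
  constructor
  · intro h
    have hm : ∀ z, z ∈ opair a b ↔ z ∈ opair c d := fun z => by rw [h]
    simp only [opair, mem_upair] at hm
    have hac : a = c := by
      rcases (hm (upair a a)).1 (Or.inl rfl) with h1 | h1
      · exact upair_self_inj h1
      · have : c ∈ upair a a := h1 ▸ (mem_upair c d c).2 (Or.inl rfl)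
        exact ((by simpa using this) : c = a).symm
    subst hac
    refine ⟨rfl, ?_⟩
    have key : ∀ {b d : M}, (upair a b = upair a a ∨ upair a b = upair a d) → b = a ∨ b = d := by
      intro b d h
      have hb : b ∈ upair a b := (mem_upair a b b).2 (Or.inr rfl)
      rcases h with h | h <;> rw [h] at hb <;> simp at hb <;> tauto
    rcases key ((hm (upair a b)).1 (Or.inr rfl)) with h1 | h1
    · rcases key ((hm (upair a d)).2 (Or.inr rfl)) with h2 | h2
      · rw [h1, h2]
      · exact h2.symm
    · exact h1
  · rintro ⟨rfl, rfl⟩; rfl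

@[simp] theorem mem_dom (f a : M) : a ∈ dom f ↔ ∃ b, opair a b ∈ f := by
  refine mem_coll (sUnion (sUnion f)) (fun z ⟨b, h⟩ => ?_) a
  simp only [mem_sUnion]
  exact ⟨upair z z, ⟨_, h, by simp [opair]⟩, by simp⟩

theorem app_eq {f a b : M} (h : opair a b ∈ f) (h' : ∀ c, opair a c ∈ f → c = b) : app f a = b :=
  the_eq (P := fun b => opair a b ∈ f) h h'

@[simp] theorem opair_mem_lam {x : M} {F : M → M} [Dfn M F] {a b : M} :
    opair a b ∈ lam x F ↔ a ∈ x ∧ b = F a := by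
  simp only [lam, mem_image, opair_inj]
  constructor
  · rintro ⟨c, hc, rfl, rfl⟩; exact ⟨hc, rfl⟩
  · rintro ⟨h, rfl⟩; exact ⟨a, h, rfl, rfl⟩

@[simp] theorem app_lam {x : M} (F : M → M) [Dfn M F] {a : M} (h : a ∈ x) : app (lam x F) a = F a :=
  app_eq (opair_mem_lam.2 ⟨h, rfl⟩) fun _ hc => (opair_mem_lam.1 hc).2

@[simp] theorem dom_lam (x : M) (F : M → M) [Dfn M F] : dom (lam x F) = x :=
  ext fun z => by simp

theorem lam_congr {x : M} {F G : M → M} [Dfn M F] [Dfn M G] (h : ∀ a ∈ x, F a = G a) :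
    lam x F = lam x G := by
  refine ext fun z => ?_
  simp only [lam, mem_image]
  constructor <;> rintro ⟨a, ha, rfl⟩ <;> exact ⟨a, ha, by rw [h a ha]⟩

/-! ### Pairs and functions inside the model -/

theorem isPair_iff {u a b : M} : IsPair u a b ↔ u = upair a b :=
  ⟨fun h => ext fun z => (h z).trans (mem_upair a b z).symm, fun h z => h ▸ mem_upair a b z⟩

theorem isOrderedPair_iff {p a b : M} : IsOrderedPair p a b ↔ p = opair a b := by
  simp only [IsOrderedPair, isPair_iff]
  exact ⟨fun h => ext fun z => (h z).trans (mem_upair _ _ z).symm, fun h z => h ▸ mem_upair _ _ z⟩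

theorem pairMem_iff {f a b : M} : PairMem f a b ↔ opair a b ∈ f := by
  simp [PairMem, isOrderedPair_iff]

theorem isPowerSet_iff {p x : M} : IsPowerSet p x ↔ p = pow x :=
  ⟨fun h => ext fun z => (h z).trans (mem_pow x z).symm, fun h z => h ▸ mem_pow x z⟩

/-- A function from `x` into `y` is the graph over `x` of its own evaluation map. This turns all
statements about functions in the model into statements about `app`. -/
theorem isFunction_iff {f x y : M} :
    IsFunction f x y ↔ f = lam x (app f) ∧ ∀ a ∈ x, app f a ∈ y := by
  simp only [IsFunction, pairMem_iff, isOrderedPair_iff]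
  constructor
  · rintro ⟨h1, h2⟩
    have h3 : ∀ a ∈ x, opair a (app f a) ∈ f ∧ ∀ c, opair a c ∈ f → c = app f a := by
      intro a ha
      obtain ⟨b, hb, hb'⟩ := h2 a ha
      rw [app_eq hb hb']; exact ⟨hb, hb'⟩
    have h4 : ∀ a b, opair a b ∈ f → a ∈ x ∧ b ∈ y := by
      intro a b h
      obtain ⟨a', ha', b', hb', h'⟩ := h1 _ h
      obtain ⟨rfl, rfl⟩ := opair_inj.1 h'
      exact ⟨ha', hb'⟩
    refine ⟨ext fun p => ?_, fun a ha => (h4 _ _ (h3 a ha).1).2⟩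
    simp only [lam, mem_image]
    constructor
    · intro hp
      obtain ⟨a, ha, b, hb, rfl⟩ := h1 p hp
      exact ⟨a, ha, by rw [(h3 a ha).2 b hp]⟩
    · rintro ⟨a, ha, rfl⟩; exact (h3 a ha).1
  · rintro ⟨h1, h2⟩
    constructor
    · intro p hp
      rw [h1] at hp
      simp only [lam, mem_image] at hp
      obtain ⟨a, ha, rfl⟩ := hp
      exact ⟨a, ha, _, h2 a ha, rfl⟩
    · intro a ha
      refine ⟨app f a, ?_, fun c hc => ?_⟩
      · show opair a (app f a) ∈ f
        rw [h1]; simp [ha]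
      · have hc : opair a c ∈ f := hc
        rw [h1] at hc; exact (opair_mem_lam.1 hc).2

theorem isFunction_lam {x y : M} {F : M → M} [Dfn M F] (h : ∀ a ∈ x, F a ∈ y) :
    IsFunction (lam x F) x y :=
  isFunction_iff.2 ⟨lam_congr fun a ha => (app_lam F ha).symm, fun a ha => by
    rw [app_lam F ha]; exact h a ha⟩

theorem IsFunction.app_mem {f x y a : M} (h : IsFunction f x y) (ha : a ∈ x) : app f a ∈ y :=
  (isFunction_iff.1 h).2 a ha

theorem IsFunction.pairMem {f x y a b : M} (h : IsFunction f x y) :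
    PairMem f a b ↔ a ∈ x ∧ b = app f a := by
  rw [pairMem_iff]
  conv_lhs => rw [(isFunction_iff.1 h).1]
  exact opair_mem_lam

theorem IsFunction.ext {f g x y y' : M} (hf : IsFunction f x y) (hg : IsFunction g x y')
    (h : ∀ a ∈ x, app f a = app g a) : f = g := by
  rw [(isFunction_iff.1 hf).1, (isFunction_iff.1 hg).1]; exact lam_congr h

theorem isInjection_iff {f x y : M} : IsInjection f x y ↔
    IsFunction f x y ∧ ∀ a ∈ x, ∀ b ∈ x, app f a = app f b → a = b := by
  refine and_congr_right fun h => ?_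
  simp only [h.pairMem]
  constructor
  · exact fun h a ha b hb e => h a b _ ⟨ha, rfl⟩ ⟨hb, e⟩
  · rintro h a b c ⟨ha, rfl⟩ ⟨hb, e⟩; exact h a ha b hb e

/-- A definable injective map gives an injection in the model. -/
theorem injects_of {x y : M} (F : M → M) [Dfn M F] (h : ∀ a ∈ x, F a ∈ y)
    (h' : ∀ a ∈ x, ∀ b ∈ x, F a = F b → a = b) : Injects x y :=
  ⟨lam x F, isInjection_iff.2 ⟨isFunction_lam h, fun a ha b hb e => h' a ha b hb (by
    rwa [app_lam F ha, app_lam F hb] at e)⟩⟩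

theorem isBijection_iff {f x y : M} : IsBijection f x y ↔
    IsInjection f x y ∧ ∀ b ∈ y, ∃ a ∈ x, b = app f a := by
  refine and_congr_right fun h => ?_
  simp only [h.1.pairMem]

theorem IsBijection.inverse {f x y : M} (h : IsBijection f x y) :
    ∃ g, IsBijection g y x ∧ (∀ a ∈ x, app g (app f a) = a) ∧ ∀ b ∈ y, app f (app g b) = b := by
  obtain ⟨h1, h2⟩ := isBijection_iff.1 h
  obtain ⟨h0, h1⟩ := isInjection_iff.1 h1
  have key : ∀ b ∈ y, (the fun a => a ∈ x ∧ b = app f a) ∈ x ∧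
      b = app f (the fun a => a ∈ x ∧ b = app f a) := by
    intro b hb
    obtain ⟨a, ha, e⟩ := h2 b hb
    exact the_spec (P := fun a => a ∈ x ∧ b = app f a) ⟨ha, e⟩
      fun z hz => h1 z hz.1 a ha (hz.2.symm.trans e)
  refine ⟨lam y fun b => the fun a => a ∈ x ∧ b = app f a, isBijection_iff.2
    ⟨isInjection_iff.2 ⟨isFunction_lam fun b hb => (key b hb).1, ?_⟩, ?_⟩, ?_, ?_⟩
  · intro b hb c hc e
    rw [app_lam _ hb, app_lam _ hc] at e
    rw [(key b hb).2, (key c hc).2, e]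
  · intro a ha
    refine ⟨app f a, h0.app_mem ha, ?_⟩
    rw [app_lam _ (h0.app_mem ha)]
    exact h1 _ ha _ (key _ (h0.app_mem ha)).1 (key _ (h0.app_mem ha)).2
  · intro a ha
    rw [app_lam _ (h0.app_mem ha)]
    exact h1 _ (key _ (h0.app_mem ha)).1 _ ha (key _ (h0.app_mem ha)).2.symm
  · intro b hb
    rw [app_lam _ hb]
    exact (key b hb).2.symm

end Sets

/-! ### Ordinals -/

section Ordinals
variable {M : Type*} [Membership M M] [ZF M]

theorem mem_irrefl (x : M) : x ∉ x := fun h => by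
  obtain ⟨y, hy, h'⟩ := ZF.isModel.foundation (upair x x) ⟨x, by simp⟩
  obtain rfl : y = x := by simpa using hy
  exact h' y h (by simp)

theorem mem_asymm {x y : M} (h : x ∈ y) : y ∉ x := fun h1 => by
  obtain ⟨z, hz, h'⟩ := ZF.isModel.foundation (upair x y) ⟨x, by simp⟩
  rcases (mem_upair _ _ _).1 hz with rfl | rfl
  · exact h' y h1 (by simp)
  · exact h' x h (by simp)

/-- `x` is an ordinal: a transitive set of transitive sets, which suffices by foundation. The order
is `∈`. -/
def Ord (x : M) : Prop :=
  (∀ y ∈ x, ∀ z ∈ y, z ∈ x) ∧ ∀ y ∈ x, ∀ z ∈ y, ∀ w ∈ z, w ∈ y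

section
variable {Γ : Type*} [DefSpace M Γ] (t : Γ → M) [Dfn M t]
instance dfn_ord : Dfn M (no_index fun γ => Ord (t γ)) := by unfold Ord; infer_instance
end

namespace Ord

theorem mem {a b : M} (h : Ord a) (hb : b ∈ a) : Ord b :=
  ⟨h.2 b hb, fun y hy => h.2 y (h.1 b hb y hy)⟩

theorem trans {a b c : M} (h : Ord a) (hb : b ∈ a) (hc : c ∈ b) : c ∈ a := h.1 b hb c hc

theorem succ {a : M} (h : Ord a) : Ord (succ a) := by
  constructor
  · intro y hy z hz
    rcases (mem_succ _ _).1 hy with hy | rfl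
    · exact (mem_succ _ _).2 (Or.inl (h.trans hy hz))
    · exact (mem_succ _ _).2 (Or.inl hz)
  · intro y hy
    rcases (mem_succ _ _).1 hy with hy | rfl
    · exact h.2 y hy
    · exact h.1

theorem induction {P : M → Prop} [Dfn M P] (h : ∀ a, Ord a → (∀ b ∈ a, P b) → P a) (a : M)
    (ha : Ord a) : P a := by
  by_contra hP
  obtain ⟨y, hy, hmin⟩ := ZF.isModel.foundation (sep (InZF.succ a) fun b => ¬ P b) ⟨a, by simp [hP]⟩
  simp only [mem_sep] at hy hmin
  refine hy.2 (h y (ha.succ.mem hy.1) fun z hz => ?_)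
  by_contra hz'
  exact hmin z hz ⟨ha.succ.trans hy.1 hz, hz'⟩

theorem trichotomy {a b : M} (ha : Ord a) (hb : Ord b) : a ∈ b ∨ a = b ∨ b ∈ a := by
  revert hb; revert b
  refine @fun b => induction (P := fun a => ∀ b, Ord b → a ∈ b ∨ a = b ∨ b ∈ a)
    (fun a ha iha b hb => ?_) a ha b
  refine induction (P := fun b => a ∈ b ∨ a = b ∨ b ∈ a) (fun b hb ihb => ?_) b hb
  by_cases h1 : ∀ z ∈ a, z ∈ b
  · by_cases h2 : ∀ z ∈ b, z ∈ a
    · exact Or.inr (Or.inl (ext fun z => ⟨h1 z, h2 z⟩))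
    · push Not at h2
      obtain ⟨z, hz, hz'⟩ := h2
      rcases ihb z hz with h | rfl | h
      · exact Or.inl (hb.trans hz h)
      · exact Or.inl hz
      · exact absurd h hz'
  · push Not at h1
    obtain ⟨z, hz, hz'⟩ := h1
    rcases iha z hz b hb with h | rfl | h
    · exact absurd h hz'
    · exact Or.inr (Or.inr hz)
    · exact Or.inr (Or.inr (ha.trans hz h))

theorem mem_of_notMem {a b : M} (ha : Ord a) (hb : Ord b) (h : a ∉ b) (hne : a ≠ b) : b ∈ a := by
  rcases ha.trichotomy hb with h1 | h1 | h1
  · exact absurd h1 h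
  · exact absurd h1 hne
  · exact h1

theorem eq_of_notMem {a b : M} (ha : Ord a) (hb : Ord b) (h : a ∉ b) (h' : b ∉ a) : a = b := by
  rcases ha.trichotomy hb with h1 | h1 | h1
  · exact absurd h1 h
  · exact h1
  · exact absurd h1 h'

theorem exists_least {P : M → Prop} [Dfn M P] {a : M} (ha : Ord a) (h : P a) :
    ∃ b, Ord b ∧ P b ∧ ∀ c ∈ b, ¬ P c := by
  by_contra hn
  push Not at hn
  refine induction (P := fun a => ¬ P a) (fun b hb ih hPb => ?_) a ha h
  obtain ⟨c, hc, hc'⟩ := hn b hb hPb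
  exact ih c hc hc'

end Ord

/-- The least ordinal with a property, and `∅` if there is none. This is the substitute for choice
in all constructions below. -/
noncomputable def leastOrd (P : M → Prop) : M := the fun b => Ord b ∧ P b ∧ ∀ c ∈ b, ¬ P c

instance dfn_leastOrd {Γ : Type*} [DefSpace M Γ] (P : Γ → M → Prop)
    [h : Dfn M (fun p : Γ × M => P p.1 p.2)] : Dfn M (no_index fun γ => leastOrd (P γ)) := by
  unfold leastOrd; infer_instance

theorem leastOrd_spec {P : M → Prop} [Dfn M P] {a : M} (ha : Ord a) (h : P a) :
    Ord (leastOrd P) ∧ P (leastOrd P) ∧ ∀ c ∈ leastOrd P, ¬ P c := by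
  obtain ⟨b, hb, hb', hb''⟩ := ha.exists_least h
  refine the_spec (P := fun b => Ord b ∧ P b ∧ ∀ c ∈ b, ¬ P c) ⟨hb, hb', hb''⟩ fun c hc => ?_
  exact hc.1.eq_of_notMem hb (fun h => hb'' c h hc.2.1) fun h => hc.2.2 b h hb'

theorem leastOrd_prop {P : M → Prop} [Dfn M P] {a : M} (ha : Ord a) (h : P a) :
    P (leastOrd P) := (leastOrd_spec ha h).2.1

theorem ord_emp : Ord (emp M) :=
  ⟨fun y hy => absurd hy (notMem_emp y), fun y hy => absurd hy (notMem_emp y)⟩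

theorem ord_sUnion {s : M} (h : ∀ a ∈ s, Ord a) : Ord (sUnion s) := by
  constructor
  · intro y hy z hz
    obtain ⟨a, ha, hya⟩ := (mem_sUnion _ _).1 hy
    exact (mem_sUnion _ _).2 ⟨a, ha, (h a ha).trans hya hz⟩
  · intro y hy
    obtain ⟨a, ha, hya⟩ := (mem_sUnion _ _).1 hy
    exact (h a ha).2 y hya

/-- The Burali-Forti paradox: no set contains all ordinals. -/
theorem exists_ord_notMem (s : M) : ∃ a, Ord a ∧ a ∉ s := by
  have h : Ord (succ (sUnion (sep s Ord))) :=
    (ord_sUnion fun a ha => ((mem_sep _ _ _).1 ha).2).succ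
  refine ⟨_, h, fun hm => ?_⟩
  have : sUnion (sep s Ord) ∈ sUnion (sep s Ord) :=
    (mem_sUnion _ _).2 ⟨_, (mem_sep _ _ _).2 ⟨hm, h⟩, (mem_succ _ _).2 (Or.inr rfl)⟩
  exact mem_irrefl _ this

/-! ### The set `ω` -/

theorem isInductive_iff {w : M} : IsInductive w ↔ emp M ∈ w ∧ ∀ n ∈ w, succ n ∈ w := by
  have h1 : ∀ e : M, (∀ z, z ∉ e) ↔ e = emp M := fun e => eq_emp_iff.symm
  have h2 : ∀ n s : M, (∀ z, z ∈ s ↔ z ∈ n ∨ z = n) ↔ s = succ n := fun n s =>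
    ⟨fun h => ext fun z => (h z).trans (mem_succ n z).symm, fun h z => h ▸ mem_succ n z⟩
  simp [IsInductive, h1, h2]

/-- `ω`, the intersection of all inductive sets. -/
noncomputable def om (M : Type*) [Membership M M] [ZF M] : M :=
  coll fun n => ∀ v : M, IsInductive v → n ∈ v

instance dfn_isInductive : Dfn M (IsInductive : M → Prop) := by
  have : (IsInductive : M → Prop) = fun w => emp M ∈ w ∧ ∀ n ∈ w, succ n ∈ w :=
    funext fun w => propext isInductive_iff
  rw [this]; infer_instance

theorem mem_om {n : M} : n ∈ om M ↔ ∀ v : M, IsInductive v → n ∈ v := by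
  obtain ⟨w, hw⟩ := (ZF.isModel (M := M)).infinity
  exact mem_coll w (fun z h => h w hw) n

theorem isInductive_om : IsInductive (om M) := by
  rw [isInductive_iff]
  simp only [mem_om, isInductive_iff]
  exact ⟨fun v hv => hv.1, fun n hn v hv => hv.2 n (hn v hv)⟩

theorem emp_mem_om : emp M ∈ om M := (isInductive_iff.1 isInductive_om).1
theorem succ_mem_om {n : M} (h : n ∈ om M) : succ n ∈ om M :=
  (isInductive_iff.1 isInductive_om).2 n h

theorem isOmega_iff {w : M} : IsOmega w ↔ w = om M := by
  constructor
  · rintro ⟨h1, h2⟩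
    exact ext fun n => ⟨h2 _ isInductive_om n, fun h => mem_om.1 h w h1⟩
  · rintro rfl
    exact ⟨isInductive_om, fun v hv n hn => mem_om.1 hn v hv⟩

theorem om_induction {P : M → Prop} [Dfn M P] (h0 : P (emp M)) (hs : ∀ n ∈ om M, P n → P (succ n))
    (n : M) (hn : n ∈ om M) : P n := by
  have : IsInductive (sep (om M) P) := by
    simp only [isInductive_iff, mem_sep]
    exact ⟨⟨emp_mem_om, h0⟩, fun n hn => ⟨succ_mem_om hn.1, hs n hn.1 hn.2⟩⟩
  exact ((mem_sep _ _ _).1 (mem_om.1 hn _ this)).2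

theorem ord_of_mem_om {n : M} (hn : n ∈ om M) : Ord n :=
  om_induction (P := Ord) ord_emp (fun _ _ h => h.succ) n hn

theorem ord_om : Ord (om M) := by
  refine ⟨om_induction (P := fun n => ∀ z ∈ n, z ∈ om M) (fun z hz => absurd hz (notMem_emp z))
    fun n hn ih z hz => ?_, fun n hn => (ord_of_mem_om hn).1⟩
  rcases (mem_succ _ _).1 hz with hz | rfl
  · exact ih z hz
  · exact hn

/-! ### Recursion along the ordinals -/

/-- Recursion along the ordinals: the value at `α` is `G` applied to `α` and to the function
`β ↦ recF G β` on `α`. It is read off from the unique partial solution `f` on `α`. -/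
noncomputable def recF (G : M → M → M) (a : M) : M :=
  the fun y => ∃ f, (f = lam a (app f) ∧ ∀ b ∈ a, app f b = G b (lam b (app f))) ∧ y = G a f

instance dfn_recF {Γ : Type*} [DefSpace M Γ] (G : Γ → M → M → M) (t : Γ → M)
    [h : Dfn M (fun p : (Γ × M) × M => G p.1.1 p.1.2 p.2)] [Dfn M t] :
    Dfn M (no_index fun γ => recF (G γ) (t γ)) := by
  unfold recF; infer_instance

theorem recF_eq (G : M → M → M) [Dfn M (fun p : M × M => G p.1 p.2)] {a : M} (ha : Ord a) :
    recF G a = G a (lam a (recF G)) := by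
  refine Ord.induction (P := fun a => recF G a = G a (lam a (recF G))) (fun a ha ih => ?_) a ha
  refine the_eq (P := fun y => ∃ f, (f = lam a (app f) ∧
    ∀ b ∈ a, app f b = G b (lam b (app f))) ∧ y = G a f) ?_ ?_
  · refine ⟨lam a (recF G), ⟨lam_congr fun b hb => (app_lam _ hb).symm, fun b hb => ?_⟩, rfl⟩
    rw [app_lam _ hb, ih b hb]
    congr 1
    exact lam_congr fun c hc => (app_lam _ (ha.trans hb hc)).symm
  · rintro y ⟨f, ⟨hf, hf'⟩, rfl⟩
    congr 1
    rw [hf]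
    refine lam_congr fun b hb => ?_
    refine Ord.induction (P := fun b => b ∈ a → app f b = recF G b) (fun b _ ihb hb => ?_) b
      (ha.mem hb) hb
    rw [hf' b hb, ih b hb]
    congr 1
    exact lam_congr fun c hc => ihb c hc (ha.trans hb hc)

end Ordinals

/-! ### Finite sets of ordinals -/

section Finiteness
variable {M : Type*} [Membership M M] [ZF M]

/-- `s` is a set of ordinals. -/
def OrdSet (s : M) : Prop := ∀ a ∈ s, Ord a

/-- Every nonempty subset of `s` has a greatest element. For a set of ordinals this says that `s` is
finite. Unlike the definition through `ω`, it is visibly inherited by subsets and does not mention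
any map; nothing below needs the equivalence of the two. -/
def OFin (s : M) : Prop :=
  ∀ t : M, (∀ z ∈ t, z ∈ s) → (∃ z, z ∈ t) → ∃ m ∈ t, ∀ k ∈ t, k ∈ m ∨ k = m

section
variable {Γ : Type*} [DefSpace M Γ] (t : Γ → M) [Dfn M t]
instance dfn_oFin : Dfn M (no_index fun γ => OFin (t γ)) := by unfold OFin; infer_instance
end

theorem OrdSet.mono {s t : M} (hs : OrdSet s) (h : ∀ z ∈ t, z ∈ s) : OrdSet t :=
  fun a ha => hs a (h a ha)

theorem Ord.ordSet {a : M} (h : Ord a) : OrdSet a := fun _ hb => h.mem hb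

theorem OrdSet.exists_bound {s : M} (hs : OrdSet s) : ∃ a : M, Ord a ∧ ∀ b ∈ s, b ∈ a := by
  refine ⟨sUnion (image s succ), ord_sUnion fun a ha => ?_, fun b hb => ?_⟩
  · obtain ⟨b, hb, rfl⟩ := (mem_image _ _ _).1 ha
    exact (hs b hb).succ
  · exact (mem_sUnion _ _).2
      ⟨succ b, (mem_image _ _ _).2 ⟨b, hb, rfl⟩, (mem_succ _ _).2 (Or.inr rfl)⟩

theorem OFin.mono {s t : M} (hs : OFin s) (h : ∀ z ∈ t, z ∈ s) : OFin t :=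
  fun r hr => hs r fun z hz => h z (hr z hz)

theorem oFin_of_subsingleton {s : M} (h : ∀ a ∈ s, ∀ b ∈ s, a = b) : OFin s := by
  rintro t ht ⟨z, hz⟩
  exact ⟨z, hz, fun k hk => Or.inr (h k (ht k hk) z (ht z hz))⟩

theorem oFin_of_subset_union {s t r : M} (hr : OrdSet r) (hs : OFin s) (ht : OFin t)
    (h : ∀ z ∈ r, z ∈ s ∨ z ∈ t) : OFin r := by
  rintro q hq ⟨z, hz⟩
  by_cases h1 : ∃ z, z ∈ sep q fun z => z ∈ s
  · by_cases h2 : ∃ z, z ∈ sep q fun z => z ∈ t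
    · obtain ⟨m, hm, hm'⟩ := hs _ (fun z hz => ((mem_sep _ _ _).1 hz).2) h1
      obtain ⟨n, hn, hn'⟩ := ht _ (fun z hz => ((mem_sep _ _ _).1 hz).2) h2
      simp only [mem_sep] at hm hm' hn hn'
      have om := hr m (hq m hm.1)
      have on := hr n (hq n hn.1)
      rcases om.trichotomy on with hmn | rfl | hmn
      · refine ⟨n, hn.1, fun k hk => ?_⟩
        rcases h k (hq k hk) with hk' | hk'
        · rcases hm' k ⟨hk, hk'⟩ with h | rfl
          · exact Or.inl (on.trans hmn h)
          · exact Or.inl hmn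
        · exact hn' k ⟨hk, hk'⟩
      · refine ⟨m, hm.1, fun k hk => ?_⟩
        rcases h k (hq k hk) with hk' | hk'
        · exact hm' k ⟨hk, hk'⟩
        · exact hn' k ⟨hk, hk'⟩
      · refine ⟨m, hm.1, fun k hk => ?_⟩
        rcases h k (hq k hk) with hk' | hk'
        · exact hm' k ⟨hk, hk'⟩
        · rcases hn' k ⟨hk, hk'⟩ with h | rfl
          · exact Or.inl (om.trans hmn h)
          · exact Or.inl hmn
    · refine hs q (fun z hz => (h z (hq z hz)).resolve_right fun hz' => h2 ⟨z, ?_⟩) ⟨z, hz⟩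
      exact (mem_sep _ _ _).2 ⟨hz, hz'⟩
  · refine ht q (fun z hz => (h z (hq z hz)).resolve_left fun hz' => h1 ⟨z, ?_⟩) ⟨z, hz⟩
    exact (mem_sep _ _ _).2 ⟨hz, hz'⟩

/-- Induction over the elements of a finite set `K` of ordinals in increasing order: the step passes
from the greatest element `m` of `K` below `j` to `j`. -/
theorem OFin.induction {K : M} (hK : OrdSet K) (hfin : OFin K) {P : M → Prop} [Dfn M P]
    (h0 : ∀ j, (∀ k ∈ K, k ∉ j) → P j)
    (hs : ∀ j m, m ∈ K → (∀ k ∈ K, k ∈ j → k ∈ m ∨ k = m) → P m → P j) :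
    ∃ j, (∀ k ∈ K, k ∈ j) ∧ P j := by
  obtain ⟨a, ha, hKa⟩ := hK.exists_bound
  refine ⟨a, hKa, Ord.induction (fun j hj ih => ?_) a ha⟩
  by_cases h : ∃ z, z ∈ sep K fun k => k ∈ j
  · obtain ⟨m, hm, hm'⟩ := hfin _ (fun z hz => ((mem_sep _ _ _).1 hz).1) h
    simp only [mem_sep] at hm hm'
    exact hs j m hm.1 (fun k hk hkj => hm' k ⟨hk, hkj⟩) (ih m hm.2)
  · exact h0 j fun k hk hkj => h ⟨k, (mem_sep _ _ _).2 ⟨hk, hkj⟩⟩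

theorem oFin_biUnion {K T : M} (hK : OrdSet K) (hfin : OFin K) (hT : OrdSet T) (S : M → M)
    [Dfn M S] (hS : ∀ k ∈ K, OFin (S k)) (h : ∀ t ∈ T, ∃ k ∈ K, t ∈ S k) : OFin T := by
  refine Exists.elim (OFin.induction hK hfin
    (P := fun j => OFin (sep T fun t => ∃ k ∈ K, k ∈ j ∧ t ∈ S k)) ?_ ?_)
    fun j ⟨hj, hj'⟩ => hj'.mono fun t ht => ?_
  · intro j hj
    refine oFin_of_subsingleton fun a ha => ?_
    obtain ⟨-, k, hk, hk', -⟩ := (mem_sep _ _ _).1 ha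
    exact absurd hk' (hj k hk)
  · intro j m hm hmax ih
    refine oFin_of_subset_union (hT.mono fun z hz => ((mem_sep _ _ _).1 hz).1) ih (hS m hm) ?_
    intro z hz
    obtain ⟨hz, k, hk, hkj, hzk⟩ := (mem_sep _ _ _).1 hz
    rcases hmax k hk hkj with h | rfl
    · exact Or.inl ((mem_sep _ _ _).2 ⟨hz, k, hk, h, hzk⟩)
    · exact Or.inr hzk
  · obtain ⟨k, hk, hk'⟩ := h t ht
    exact (mem_sep _ _ _).2 ⟨ht, k, hk, hj k hk, hk'⟩

/-! ### Dedekind finiteness and the pigeonhole principle -/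

theorem dedekindInfinite_iff {y : M} : DedekindInfinite y ↔ Injects (om M) y := by
  simp [DedekindInfinite, isOmega_iff]

theorem DedekindInfinite.map {x y : M} (h : DedekindInfinite x) (F : M → M) [Dfn M F]
    (hF : ∀ a ∈ x, F a ∈ y) (hF' : ∀ a ∈ x, ∀ b ∈ x, F a = F b → a = b) : DedekindInfinite y := by
  rw [dedekindInfinite_iff] at h ⊢
  obtain ⟨g, hg⟩ := h
  obtain ⟨hg, hg'⟩ := isInjection_iff.1 hg
  exact injects_of (fun n => F (app g n)) (fun a ha => hF _ (hg.app_mem ha)) fun a ha b hb e =>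
    hg' a ha b hb (hF' _ (hg.app_mem ha) _ (hg.app_mem hb) e)

theorem DedekindInfinite.mono {x y : M} (h : DedekindInfinite x) (hxy : ∀ a ∈ x, a ∈ y) :
    DedekindInfinite y := h.map (fun a => a) hxy fun _ _ _ _ e => e

theorem not_oFin_om : ¬ OFin (om M) := fun h => by
  obtain ⟨m, hm, hm'⟩ := h (om M) (fun _ h => h) ⟨_, emp_mem_om⟩
  have hs : m ∈ succ m := (mem_succ _ _).2 (Or.inr rfl)
  rcases hm' _ (succ_mem_om hm) with h | h
  · exact mem_asymm h hs
  · rw [h] at hs; exact mem_irrefl _ hs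

/-- A subset without greatest element contains an increasing `ω`-sequence, found by always taking
the least element above all earlier ones. -/
theorem dedekindInfinite_of_not_oFin {s : M} (hs : OrdSet s) (h : ¬ OFin s) :
    DedekindInfinite s := by
  simp only [OFin] at h
  push Not at h
  obtain ⟨t, hts, ⟨z, hz⟩, hmax⟩ := h
  have ht : OrdSet t := hs.mono hts
  let G : M → M → M := fun n f => leastOrd fun m => m ∈ t ∧ ∀ k ∈ n, app f k ∈ m
  have hG : Dfn M fun p : M × M => G p.1 p.2 := by unfold G; infer_instance
  have hg : ∀ n, Ord n → recF G n = leastOrd fun m => m ∈ t ∧ ∀ k ∈ n, recF G k ∈ m := by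
    intro n hn
    rw [recF_eq G hn]
    unfold G
    congr 1
    funext m
    refine propext (and_congr_right fun _ => forall_congr' fun k => imp_congr_right fun hk => ?_)
    rw [app_lam _ hk]
  have key : ∀ n ∈ om M, ∃ m ∈ t, ∀ k ∈ n, recF G k ∈ m := by
    refine om_induction ⟨z, hz, fun k hk => absurd hk (notMem_emp k)⟩ fun n hn ⟨m, hm, hm'⟩ => ?_
    have h1 := leastOrd_prop (P := fun m => m ∈ t ∧ ∀ k ∈ n, recF G k ∈ m) (ht m hm) ⟨hm, hm'⟩
    rw [← hg n (ord_of_mem_om hn)] at h1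
    obtain ⟨m', hm1, hm2, hm3⟩ := hmax _ h1.1
    have hlt := (ht _ hm1).mem_of_notMem (ht _ h1.1) hm2 hm3
    refine ⟨m', hm1, fun k hk => ?_⟩
    rcases (mem_succ _ _).1 hk with hk | rfl
    · exact (ht _ hm1).trans hlt (h1.2 k hk)
    · exact hlt
  have key' : ∀ n ∈ om M, recF G n ∈ t ∧ ∀ k ∈ n, recF G k ∈ recF G n := by
    intro n hn
    obtain ⟨m, hm, hm'⟩ := key n hn
    have h1 := leastOrd_prop (P := fun m => m ∈ t ∧ ∀ k ∈ n, recF G k ∈ m) (ht m hm) ⟨hm, hm'⟩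
    rwa [← hg n (ord_of_mem_om hn)] at h1
  rw [dedekindInfinite_iff]
  refine injects_of (recF G) (fun n hn => hts _ (key' n hn).1) fun a ha b hb e => ?_
  rcases (ord_of_mem_om ha).trichotomy (ord_of_mem_om hb) with h | h | h
  · exact absurd (e ▸ (key' b hb).2 a h) (mem_irrefl _)
  · exact h
  · exact absurd (e ▸ (key' a ha).2 b h) (mem_irrefl _)

/-- Pigeonhole principle: a map from an infinite set `T` of ordinals into a Dedekind finite set `Y`,
which need not be well-orderable, has an infinite fibre. The least elements of the fibres form a set
of ordinals that embeds into `Y`, so it is finite; if all fibres were finite, so would be `T`. -/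
theorem exists_fibre_not_oFin {T Y : M} (hT : OrdSet T) (hinf : ¬ OFin T) (u : M → M) [Dfn M u]
    (hu : ∀ t ∈ T, u t ∈ Y) (hY : DedekindFinite Y) :
    ∃ y ∈ Y, ¬ OFin (sep T fun t => u t = y) := by
  by_contra hn
  push Not at hn
  -- the least elements of the fibres
  have hr : OFin (sep T fun t => ∀ t' ∈ T, t' ∈ t → u t' ≠ u t) := by
    by_contra h
    refine hY ((dedekindInfinite_of_not_oFin (hT.mono fun z hz => ((mem_sep _ _ _).1 hz).1) h).map u
      (fun a ha => hu a ((mem_sep _ _ _).1 ha).1) fun a ha b hb e => ?_)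
    simp only [mem_sep] at ha hb
    exact (hT a ha.1).eq_of_notMem (hT b hb.1) (fun h => hb.2 a ha.1 h e)
      fun h => ha.2 b hb.1 h e.symm
  refine hinf (oFin_biUnion (hT.mono fun z hz => ((mem_sep _ _ _).1 hz).1) hr hT
    (fun k => sep T fun t => u t = u k) (fun k hk => hn _ (hu k ((mem_sep _ _ _).1 hk).1)) ?_)
  intro t ht
  obtain ⟨ho, h1, h2⟩ := leastOrd_spec (P := fun k => k ∈ T ∧ u t = u k) (hT t ht) ⟨ht, rfl⟩
  refine ⟨_, (mem_sep _ _ _).2 ⟨h1.1, fun t' ht' hlt e => h2 t' hlt ⟨ht', ?_⟩⟩,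
    (mem_sep _ _ _).2 ⟨ht, h1.2⟩⟩
  rw [e]; exact h1.2

theorem oFin_of_injOn {T Y : M} (hT : OrdSet T) (u : M → M) [Dfn M u]
    (hu : ∀ t ∈ T, u t ∈ Y) (hu' : ∀ a ∈ T, ∀ b ∈ T, u a = u b → a = b)
    (hY : DedekindFinite Y) : OFin T := by
  by_contra h
  obtain ⟨y, -, hy⟩ := exists_fibre_not_oFin hT h u hu hY
  refine hy (oFin_of_subsingleton fun a ha b hb => ?_)
  simp only [mem_sep] at ha hb
  exact hu' a ha.1 b hb.1 (ha.2.trans hb.2.symm)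

/-! ### Power Dedekind finite sets -/

theorem powerDedekindFinite_iff {y : M} : PowerDedekindFinite y ↔ DedekindFinite (pow y) := by
  simp [PowerDedekindFinite, PowerDedekindInfinite, isPowerSet_iff, DedekindFinite]

theorem PowerDedekindFinite.mono {x y : M} (h : PowerDedekindFinite y) (hxy : ∀ a ∈ x, a ∈ y) :
    PowerDedekindFinite x := by
  rw [powerDedekindFinite_iff] at h ⊢
  exact fun hx => h (hx.mono fun a ha => by
    rw [mem_pow] at ha ⊢; exact fun w hw => hxy w (ha w hw))

theorem PowerDedekindFinite.dedekindFinite {y : M} (h : PowerDedekindFinite y) :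
    DedekindFinite y := by
  rw [powerDedekindFinite_iff] at h
  exact fun hy => h (hy.map (fun a => upair a a) (fun a ha => by simp [ha])
    fun a _ b _ e => upair_self_inj e)

/-- Given an injective sequence of subsets of `y`, the pigeonhole principle makes first the traces
on `A` and then the traces on `B` constant on infinitely many terms. -/
theorem PowerDedekindFinite.union {y A B : M} (hA : PowerDedekindFinite A)
    (hB : PowerDedekindFinite B) (h : ∀ z ∈ y, z ∈ A ∨ z ∈ B) : PowerDedekindFinite y := by
  rw [powerDedekindFinite_iff] at hA hB ⊢
  intro hy
  rw [dedekindInfinite_iff] at hy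
  obtain ⟨g, hg⟩ := hy
  obtain ⟨hg, hg'⟩ := isInjection_iff.1 hg
  obtain ⟨C, -, hC⟩ := exists_fibre_not_oFin ord_om.ordSet not_oFin_om
    (fun n => sep A fun z => z ∈ app g n) (fun n hn => by simp +contextual) hA
  obtain ⟨D, -, hD⟩ := exists_fibre_not_oFin
    (ord_om.ordSet.mono fun z hz => ((mem_sep _ _ _).1 hz).1) hC
    (fun n => sep B fun z => z ∈ app g n) (fun n hn => by simp +contextual) hB
  refine hD (oFin_of_subsingleton fun a ha b hb => ?_)
  obtain ⟨ha, haB⟩ := (mem_sep _ _ _).1 ha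
  obtain ⟨hb, hbB⟩ := (mem_sep _ _ _).1 hb
  obtain ⟨ha, haA⟩ := (mem_sep _ _ _).1 ha
  obtain ⟨hb, hbA⟩ := (mem_sep _ _ _).1 hb
  refine hg' a ha b hb (ext fun z => ?_)
  have hsub : ∀ n ∈ om M, z ∈ app g n → z ∈ y := fun n hn => (mem_pow _ _).1 (hg.app_mem hn) z
  have key : z ∈ y → (z ∈ app g a ↔ z ∈ app g b) := fun hz => by
    rcases h z hz with hzA | hzB
    · have h1 : z ∈ sep A (fun z => z ∈ app g a) ↔ z ∈ sep A (fun z => z ∈ app g b) := by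
        rw [haA, hbA]
      simpa [hzA] using h1
    · have h1 : z ∈ sep B (fun z => z ∈ app g a) ↔ z ∈ sep B (fun z => z ∈ app g b) := by
        rw [haB, hbB]
      simpa [hzB] using h1
  exact ⟨fun hz => (key (hsub a ha hz)).1 hz, fun hz => (key (hsub b hb hz)).2 hz⟩

theorem powerDedekindFinite_of_empty {y : M} (h : ∀ z, z ∉ y) : PowerDedekindFinite y := by
  rw [powerDedekindFinite_iff]
  intro hy
  rw [dedekindInfinite_iff] at hy
  obtain ⟨g, hg⟩ := hy
  obtain ⟨hg, hg'⟩ := isInjection_iff.1 hg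
  refine not_oFin_om (oFin_of_subsingleton fun a ha b hb => hg' a ha b hb (ext fun z => ?_))
  exact ⟨fun hz => absurd ((mem_pow _ _).1 (hg.app_mem ha) z hz) (h z),
    fun hz => absurd ((mem_pow _ _).1 (hg.app_mem hb) z hz) (h z)⟩

theorem powerDedekindFinite_singleton (a : M) : PowerDedekindFinite (upair a a) := by
  rw [powerDedekindFinite_iff]
  intro hy
  rw [dedekindInfinite_iff] at hy
  obtain ⟨g, hg⟩ := hy
  obtain ⟨hg, hg'⟩ := isInjection_iff.1 hg
  have hsub : ∀ n ∈ om M, ∀ z ∈ app g n, z = a := fun n hn z hz => by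
    simpa using (mem_pow _ _).1 (hg.app_mem hn) z hz
  refine not_oFin_om (oFin_of_subset_union (s := sep (om M) fun n => a ∈ app g n)
    (t := sep (om M) fun n => a ∉ app g n) ord_om.ordSet ?_ ?_ fun z hz => by simp [hz, em]) <;>
  · refine oFin_of_subsingleton fun n hn m hm => ?_
    simp only [mem_sep] at hn hm
    refine hg' n hn.1 m hm.1 (ext fun z => ⟨fun hz => ?_, fun hz => ?_⟩)
    · have := hsub n hn.1 z hz; subst this; tauto
    · have := hsub m hm.1 z hz; subst this; tauto

-- Going through a closed map keeps the search away from the unfolded definition.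
theorem dfn_powerDedekindFinite_aux : Dfn M (PowerDedekindFinite : M → Prop) := by
  unfold PowerDedekindFinite PowerDedekindInfinite DedekindInfinite IsPowerSet IsOmega Injects
    IsInjection IsFunction PairMem IsOrderedPair IsPair
  infer_instance

instance dfn_powerDedekindFinite {Γ : Type*} [DefSpace M Γ] (t : Γ → M) [Dfn M t] :
    Dfn M (no_index fun γ => PowerDedekindFinite (t γ)) :=
  have := dfn_powerDedekindFinite_aux (M := M)
  Dfn.comp PowerDedekindFinite t

theorem powerDedekindFinite_biUnion {K A : M} (hK : OrdSet K) (hfin : OFin K) (S : M → M)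
    [Dfn M S] (hS : ∀ k ∈ K, PowerDedekindFinite (S k)) (h : ∀ t ∈ A, ∃ k ∈ K, t ∈ S k) :
    PowerDedekindFinite A := by
  refine Exists.elim (OFin.induction hK hfin
    (P := fun j => PowerDedekindFinite (sep A fun t => ∃ k ∈ K, k ∈ j ∧ t ∈ S k)) ?_ ?_)
    fun j ⟨hj, hj'⟩ => hj'.mono fun t ht => ?_
  · intro j hj
    refine powerDedekindFinite_of_empty fun a ha => ?_
    obtain ⟨-, k, hk, hk', -⟩ := (mem_sep _ _ _).1 ha
    exact absurd hk' (hj k hk)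
  · intro j m hm hmax ih
    refine ih.union (hS m hm) fun z hz => ?_
    obtain ⟨hz, k, hk, hkj, hzk⟩ := (mem_sep _ _ _).1 hz
    rcases hmax k hk hkj with h | rfl
    · exact Or.inl ((mem_sep _ _ _).2 ⟨hz, k, hk, h, hzk⟩)
    · exact Or.inr hzk
  · obtain ⟨k, hk, hk'⟩ := h t ht
    exact (mem_sep _ _ _).2 ⟨ht, k, hk, hj k hk, hk'⟩

theorem OFin.powerDedekindFinite {s : M} (hs : OrdSet s) (h : OFin s) : PowerDedekindFinite s :=
  powerDedekindFinite_biUnion hs h (fun k => upair k k)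
    (fun k _ => powerDedekindFinite_singleton k) fun t ht => ⟨t, ht, by simp⟩

theorem OFin.dedekindFinite {s : M} (hs : OrdSet s) (h : OFin s) : DedekindFinite s :=
  (h.powerDedekindFinite hs).dedekindFinite

theorem oFin_image {s : M} (hs : OrdSet s) (h : OFin s) (u : M → M) [Dfn M u]
    (hu : ∀ a ∈ s, Ord (u a)) : OFin (image s u) := by
  have key : ∀ v ∈ image s u, leastOrd (fun a => a ∈ s ∧ v = u a) ∈ s ∧
      v = u (leastOrd fun a => a ∈ s ∧ v = u a) := by
    intro v hv
    obtain ⟨a, ha, e⟩ := (mem_image _ _ _).1 hv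
    exact leastOrd_prop (P := fun a => a ∈ s ∧ v = u a) (hs a ha) ⟨ha, e⟩
  refine oFin_of_injOn (Y := s) (fun v hv => ?_) (fun v => leastOrd fun a => a ∈ s ∧ v = u a)
    (fun v hv => (key v hv).1) (fun v hv w hw e => ?_) (h.dedekindFinite hs)
  · obtain ⟨a, ha, rfl⟩ := (mem_image _ _ _).1 hv
    exact hu a ha
  · rw [(key v hv).2, e]; exact (key w hw).2.symm

theorem IsFinite.powerDedekindFinite {y : M} (h : IsFinite y) : PowerDedekindFinite y := by
  obtain ⟨w, hw, n, hn, f, hf⟩ := h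
  rw [isOmega_iff] at hw
  subst hw
  have hfin : OFin n := by
    refine om_induction (P := OFin) (oFin_of_subsingleton fun a ha => absurd ha (notMem_emp a))
      ?_ n hn
    intro n hn ih
    exact oFin_of_subset_union (t := upair n n) (ord_of_mem_om hn).succ.ordSet ih
      (oFin_of_subsingleton (by simp)) (by simp)
  have hp := hfin.powerDedekindFinite (ord_of_mem_om hn).ordSet
  rw [powerDedekindFinite_iff] at hp ⊢
  obtain ⟨hf, hf'⟩ := isInjection_iff.1 hf.1
  refine fun hy => hp (hy.map (fun A => image A (app f)) (fun A hA => ?_) fun A hA B hB e => ?_)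
  · rw [mem_pow] at hA ⊢
    intro b hb
    obtain ⟨a, ha, rfl⟩ := (mem_image _ _ _).1 hb
    exact hf.app_mem (hA a ha)
  · rw [mem_pow] at hA hB
    have key : ∀ A B : M, (∀ w ∈ A, w ∈ y) → (∀ w ∈ B, w ∈ y) →
        image A (app f) = image B (app f) → ∀ z ∈ A, z ∈ B := by
      intro A B hA hB e z hz
      have : app f z ∈ image B (app f) := e ▸ (mem_image _ _ _).2 ⟨z, hz, rfl⟩
      obtain ⟨b, hb, e'⟩ := (mem_image _ _ _).1 this
      rwa [hf' z (hA z hz) b (hB b hb) e']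
    exact ext fun z => ⟨key A B hA hB e z, key B A hB hA e.symm z⟩

end Finiteness

/-! ### The colexicographic order on finite sets of ordinals -/

section Coding
variable {M : Type*} [Membership M M] [ZF M]

/-- `s` precedes `t` colexicographically: the greatest element in which the two differ belongs to
`t`. -/
def Colex (s t : M) : Prop := ∃ m ∈ t, m ∉ s ∧ ∀ k, m ∈ k → (k ∈ s ↔ k ∈ t)

/-- The colexicographically least element of `C`. It exists for every nonempty set `C` of finite
sets of ordinals. -/
noncomputable def colexMin (C : M) : M := the fun s => s ∈ C ∧ ∀ t ∈ C, t ≠ s → Colex s t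

/-- The set of all finite subsets of a set `I` of ordinals. -/
noncomputable def finSub (I : M) : M := sep (pow I) OFin

/-- The elements of `I` below `b`. -/
noncomputable def below (I b : M) : M := sep I fun z => z ∈ b

section
variable {Γ : Type*} [DefSpace M Γ] (t s : Γ → M) [Dfn M t] [Dfn M s]
instance dfn_colex : Dfn M (no_index fun γ => Colex (t γ) (s γ)) := by unfold Colex; infer_instance
instance dfn_colexMin : Dfn M (no_index fun γ => colexMin (t γ)) := by
  unfold colexMin; infer_instance
instance dfn_finSub : Dfn M (no_index fun γ => finSub (t γ)) := by unfold finSub; infer_instance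
instance dfn_below : Dfn M (no_index fun γ => below (t γ) (s γ)) := by unfold below; infer_instance
end

theorem mem_finSub {I t : M} : t ∈ finSub I ↔ (∀ z ∈ t, z ∈ I) ∧ OFin t := by simp [finSub]

@[simp] theorem mem_below {I b z : M} : z ∈ below I b ↔ z ∈ I ∧ z ∈ b := by simp [below]

theorem Colex.asymm {s t : M} (hs : OrdSet s) (ht : OrdSet t) (h : Colex s t) : ¬ Colex t s := by
  rintro ⟨m', hm', hm't, h'⟩
  obtain ⟨m, hm, hms, h⟩ := h
  rcases (ht m hm).trichotomy (hs m' hm') with h1 | rfl | h1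
  · exact hm't ((h m' h1).1 hm')
  · exact hms hm'
  · exact hms ((h' m h1).1 hm)

/-- What precedes a subset of the ordinal `b` is itself a subset of `b`. -/
theorem Colex.subset {s t b : M} (hb : Ord b) (hs : OrdSet s) (h : Colex s t)
    (ht : ∀ z ∈ t, z ∈ b) : ∀ z ∈ s, z ∈ b := by
  obtain ⟨m, hm, hms, h⟩ := h
  intro k hk
  by_contra hkb
  have hmk : m ∈ k := by
    rcases hb.trichotomy (hs k hk) with h1 | rfl | h1
    · exact (hs k hk).trans h1 (ht m hm)
    · exact ht m hm
    · exact absurd h1 hkb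
  exact hkb (ht k ((h k hmk).1 hk))

/-- By induction on a bound for the elements of `C`: unless `∅ ∈ C`, take the least possible
greatest element `m` and minimize, among the sets with that greatest element, the part below `m`. -/
theorem exists_colexMin {C : M} (hC : ∀ s ∈ C, OrdSet s ∧ OFin s) (hne : ∃ s, s ∈ C) :
    ∃ s ∈ C, ∀ t ∈ C, t ≠ s → Colex s t := by
  have key : ∀ b : M, Ord b → ∀ C : M, (∀ s ∈ C, (∀ z ∈ s, z ∈ b) ∧ OFin s) → (∃ s, s ∈ C) →
      ∃ s ∈ C, ∀ t ∈ C, t ≠ s → Colex s t := by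
    refine Ord.induction fun b hb ih C hC hne => ?_
    by_cases h0 : emp M ∈ C
    · refine ⟨_, h0, fun t ht hne => ?_⟩
      obtain ⟨m, hm, hmax⟩ := (hC t ht).2 t (fun _ h => h) (ne_emp_iff.1 hne)
      refine ⟨m, hm, notMem_emp _, fun k hk => ⟨fun h => absurd h (notMem_emp _), fun h => ?_⟩⟩
      rcases hmax k h with h | rfl
      · exact absurd h (mem_asymm hk)
      · exact absurd hk (mem_irrefl _)
    -- all elements of `C` have a greatest element; the least of these is `m`
    let IsMax : M → M → Prop := fun m s => m ∈ s ∧ ∀ k ∈ s, k ∈ m ∨ k = m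
    have hIsMax : Dfn M fun p : M × M => IsMax p.1 p.2 := by unfold IsMax; infer_instance
    have hmax : ∀ s ∈ C, ∃ m, IsMax m s := fun s hs => by
      obtain ⟨m, hm, h⟩ := (hC s hs).2 s (fun _ h => h) (ne_emp_iff.1 fun h => h0 (h ▸ hs))
      exact ⟨m, hm, h⟩
    obtain ⟨s0, hs0⟩ := hne
    obtain ⟨m0, hm0⟩ := hmax s0 hs0
    obtain ⟨hm, ⟨s1, hs1, hs1m⟩, hleast⟩ := leastOrd_spec (P := fun m => ∃ s ∈ C, IsMax m s)
      (hb.mem ((hC s0 hs0).1 m0 hm0.1)) ⟨s0, hs0, hm0⟩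
    generalize leastOrd (fun m => ∃ s ∈ C, IsMax m s) = m at hm hs1m hleast
    have hmb : m ∈ b := (hC s1 hs1).1 m hs1m.1
    obtain ⟨r, hr, hr'⟩ := ih m hmb (image (sep C (IsMax m)) fun s => below s m) (by
      intro r hr
      obtain ⟨s, hs, rfl⟩ := (mem_image _ _ _).1 hr
      exact ⟨fun z hz => (mem_below.1 hz).2,
        (hC s ((mem_sep _ _ _).1 hs).1).2.mono fun z hz => (mem_below.1 hz).1⟩)
      ⟨_, (mem_image _ _ _).2 ⟨s1, (mem_sep _ _ _).2 ⟨hs1, hs1m⟩, rfl⟩⟩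
    obtain ⟨s, hs, rfl⟩ := (mem_image _ _ _).1 hr
    obtain ⟨hs, hsm⟩ := (mem_sep _ _ _).1 hs
    refine ⟨s, hs, fun t ht hts => ?_⟩
    have hord : ∀ u ∈ C, OrdSet u := fun u hu z hz => hb.mem ((hC u hu).1 z hz)
    obtain ⟨n, hn⟩ := hmax t ht
    rcases hm.trichotomy (hord t ht n hn.1) with h | rfl | h
    · refine ⟨n, hn.1, fun hns => ?_, fun k hk => ⟨fun hks => ?_, fun hkt => ?_⟩⟩
      · rcases hsm.2 n hns with h1 | rfl
        · exact mem_asymm h h1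
        · exact mem_irrefl _ h
      · rcases hsm.2 k hks with h1 | rfl
        · exact absurd (hm.trans h1 hk) (mem_asymm h)
        · exact absurd h (mem_asymm hk)
      · rcases hn.2 k hkt with h1 | rfl
        · exact absurd h1 (mem_asymm hk)
        · exact absurd hk (mem_irrefl _)
    · have hne : below t m ≠ below s m := fun e => hts (ext fun z => by
        have e' : z ∈ below t m ↔ z ∈ below s m := by rw [e]
        simp only [mem_below] at e'
        constructor
        · intro hz
          rcases hn.2 z hz with h | rfl
          · exact (e'.1 ⟨hz, h⟩).1
          · exact hsm.1
        · intro hz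
          rcases hsm.2 z hz with h | rfl
          · exact (e'.2 ⟨hz, h⟩).1
          · exact hn.1)
      obtain ⟨p, hp, hps, hpk⟩ :=
        hr' _ ((mem_image _ _ _).2 ⟨t, (mem_sep _ _ _).2 ⟨ht, hn⟩, rfl⟩) hne
      simp only [mem_below] at hp hps hpk
      refine ⟨p, hp.1, fun h => hps ⟨h, hp.2⟩, fun k hk => ⟨fun hks => ?_, fun hkt => ?_⟩⟩
      · rcases hsm.2 k hks with h | rfl
        · exact ((hpk k hk).1 ⟨hks, h⟩).1
        · exact hn.1
      · rcases hn.2 k hkt with h | rfl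
        · exact ((hpk k hk).2 ⟨hkt, h⟩).1
        · exact hsm.1
    · exact absurd ⟨t, ht, hn⟩ (hleast n h)
  obtain ⟨b, hb, hb'⟩ := OrdSet.exists_bound (s := sUnion C) fun z hz => by
    obtain ⟨s, hs, hz⟩ := (mem_sUnion _ _).1 hz
    exact (hC s hs).1 z hz
  exact key b hb C
    (fun s hs => ⟨fun z hz => hb' z ((mem_sUnion _ _).2 ⟨s, hs, hz⟩), (hC s hs).2⟩) hne

theorem colexMin_spec {C : M} (hC : ∀ s ∈ C, OrdSet s ∧ OFin s) (hne : ∃ s, s ∈ C) :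
    colexMin C ∈ C ∧ ∀ t ∈ C, t ≠ colexMin C → Colex (colexMin C) t := by
  obtain ⟨s, hs, hs'⟩ := exists_colexMin hC hne
  refine the_spec (P := fun s => s ∈ C ∧ ∀ t ∈ C, t ≠ s → Colex s t) ⟨hs, hs'⟩ fun t ht => ?_
  by_contra hne
  exact (hs' t ht.1 hne).asymm (hC s hs).1 (hC t ht.1).1 (ht.2 s hs (Ne.symm hne))

/-! ### Enumerating finite sets of ordinals -/

/-- An enumeration of finite subsets of `I` along `I` itself: the value at `b` is the
colexicographically least finite subset of `I` that is not a value at some `c ∈ I` below `b`. -/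
noncomputable def finEnum (I : M) : M → M :=
  recF fun b f => colexMin (sep (finSub I) fun t => ∀ c ∈ b, c ∈ I → app f c ≠ t)

instance dfn_finEnum {Γ : Type*} [DefSpace M Γ] (t s : Γ → M) [Dfn M t] [Dfn M s] :
    Dfn M (no_index fun γ => finEnum (t γ) (s γ)) := by unfold finEnum; infer_instance

theorem finEnum_eq (I : M) {b : M} (hb : Ord b) :
    finEnum I b = colexMin (sep (finSub I) fun t => ∀ c ∈ b, c ∈ I → finEnum I c ≠ t) := by
  conv_lhs => rw [finEnum, recF_eq _ hb]
  congr 2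
  funext t
  refine propext (forall_congr' fun c => imp_congr_right fun hc => ?_)
  rw [app_lam _ hc]; rfl

theorem finEnum_spec {I b t : M} (hI : OrdSet I) (hb : Ord b) (ht : t ∈ finSub I)
    (h : ∀ c ∈ b, c ∈ I → finEnum I c ≠ t) :
    finEnum I b ∈ finSub I ∧ (∀ c ∈ b, c ∈ I → finEnum I c ≠ finEnum I b) ∧
      (t ≠ finEnum I b → Colex (finEnum I b) t) := by
  have h1 := colexMin_spec (C := sep (finSub I) fun t => ∀ c ∈ b, c ∈ I → finEnum I c ≠ t)
    (fun s hs => by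
      obtain ⟨h1, h2⟩ := mem_finSub.1 ((mem_sep _ _ _).1 hs).1
      exact ⟨hI.mono h1, h2⟩) ⟨t, (mem_sep _ _ _).2 ⟨ht, h⟩⟩
  rw [← finEnum_eq I hb] at h1
  obtain ⟨h1, h2⟩ := h1
  obtain ⟨h3, h4⟩ := (mem_sep _ _ _).1 h1
  exact ⟨h3, h4, h2 t ((mem_sep _ _ _).2 ⟨ht, h⟩)⟩

/-- If the finite set `t` is not enumerated before `b`, then up to `b` the enumeration is injective
and stays colexicographically below `t`. -/
theorem finEnum_below {I b t : M} (hI : OrdSet I) (hb : Ord b) (ht : t ∈ finSub I)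
    (h : ∀ c ∈ b, c ∈ I → finEnum I c ≠ t) :
    (∀ c ∈ below I b, finEnum I c ∈ finSub I ∧ Colex (finEnum I c) t) ∧
      ∀ c ∈ below I b, ∀ d ∈ below I b, finEnum I c = finEnum I d → c = d := by
  have h1 : ∀ c ∈ below I b, finEnum I c ∈ finSub I ∧
      (∀ d ∈ c, d ∈ I → finEnum I d ≠ finEnum I c) ∧ Colex (finEnum I c) t := by
    intro c hc
    obtain ⟨hcI, hcb⟩ := mem_below.1 hc
    obtain ⟨h1, h2, h3⟩ := finEnum_spec hI (hb.mem hcb) ht fun d hd => h d (hb.trans hcb hd)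
    exact ⟨h1, h2, h3 (h c hcb hcI).symm⟩
  refine ⟨fun c hc => ⟨(h1 c hc).1, (h1 c hc).2.2⟩, fun c hc d hd e => ?_⟩
  have hc' := mem_below.1 hc
  have hd' := mem_below.1 hd
  exact (hb.mem hc'.2).eq_of_notMem (hb.mem hd'.2) (fun h => (h1 d hd).2.1 c h hc'.1 e)
    fun h => (h1 c hc).2.1 d h hd'.1 e.symm

/-! ### Coding the finite subsets of a set of ordinals -/

/-- A coding `e` of the finite subsets of `K` by elements of `K`, together with a map `j` from a set
`L` to the finite subsets of `K`, codes a finite `t ⊆ L`: encode each `j c` with `c ∈ t`, then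
encode the finite set of these codes. -/
noncomputable def compress (e : M) (j : M → M) (t : M) : M := app e (image t fun c => app e (j c))

/-- The function `e` restricts to an injection from the finite subsets of `K` into `K`. -/
def IsCoding (e K : M) : Prop := (∀ t ∈ finSub K, app e t ∈ K) ∧
  ∀ t ∈ finSub K, ∀ t' ∈ finSub K, app e t = app e t' → t = t'

open Classical in
/-- The recursion step for `coding`: a coding of the finite subsets of `I ∩ b`, where `f` lists the
codings for smaller ordinals. If the enumeration `finEnum` exhausts the finite subsets, a set is
coded by its index. If `I ∩ b` has a greatest element `m`, the coding at `m` is reused along the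
injection `m ↦ ∅`, `c ↦ {c}` otherwise. In the remaining case `finEnum I b` is bounded by some
`d < b`, so the enumeration injects `I ∩ b` into the finite subsets of `I ∩ d`, and the coding at
`d` is reused. -/
noncomputable def codingStep (I b f : M) : M :=
  lam (finSub (below I b)) fun t =>
    if ∀ t ∈ finSub (below I b), ∃ c ∈ below I b, finEnum I c = t then
      leastOrd fun c => c ∈ below I b ∧ finEnum I c = t
    else if ∃ m ∈ below I b, ∀ k ∈ below I b, k ∈ m ∨ k = m then
      compress (app f (the fun m => m ∈ below I b ∧ ∀ k ∈ below I b, k ∈ m ∨ k = m))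
        (fun c => if ∀ k ∈ below I b, k ∈ c ∨ k = c then emp M else upair c c) t
    else compress (app f (leastOrd fun d => d ∈ b ∧ ∀ z ∈ finEnum I b, z ∈ d)) (finEnum I) t

instance dfn_compress {Γ : Type*} [DefSpace M Γ] (t s : Γ → M) (j : Γ → M → M) [Dfn M t] [Dfn M s]
    [Dfn M fun p : Γ × M => j p.1 p.2] :
    Dfn M (no_index fun γ => compress (t γ) (j γ) (s γ)) := by unfold compress; infer_instance

instance dfn_isCoding {Γ : Type*} [DefSpace M Γ] (t s : Γ → M) [Dfn M t] [Dfn M s] :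
    Dfn M (no_index fun γ => IsCoding (t γ) (s γ)) := by unfold IsCoding; infer_instance

instance dfn_codingStep {Γ : Type*} [DefSpace M Γ] (t s r : Γ → M) [Dfn M t] [Dfn M s] [Dfn M r] :
    Dfn M (no_index fun γ => codingStep (t γ) (s γ) (r γ)) := by unfold codingStep; infer_instance

/-- A coding of the finite subsets of `I ∩ b` by elements of `I ∩ b`, uniformly definable from `I`
and `b`. It is meaningful when `I ∩ b` is infinite. -/
noncomputable def coding (I : M) : M → M := recF (codingStep I)

instance dfn_coding {Γ : Type*} [DefSpace M Γ] (t s : Γ → M) [Dfn M t] [Dfn M s] :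
    Dfn M (no_index fun γ => coding (t γ) (s γ)) := by unfold coding; infer_instance

theorem image_subset {s K : M} (j : M → M) [Dfn M j] (h : ∀ c ∈ s, j c ∈ K) :
    ∀ z ∈ image s j, z ∈ K := by
  intro z hz
  obtain ⟨a, ha, rfl⟩ := (mem_image _ _ _).1 hz
  exact h a ha

theorem image_injOn {K s t : M} (j : M → M) [Dfn M j] (hj : ∀ c ∈ K, ∀ d ∈ K, j c = j d → c = d)
    (hs : ∀ z ∈ s, z ∈ K) (ht : ∀ z ∈ t, z ∈ K) (h : image s j = image t j) : s = t := by
  have key : ∀ s t : M, (∀ z ∈ s, z ∈ K) → (∀ z ∈ t, z ∈ K) → image s j = image t j →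
      ∀ z ∈ s, z ∈ t := by
    intro s t hs ht h z hz
    have : j z ∈ image t j := h ▸ (mem_image _ _ _).2 ⟨z, hz, rfl⟩
    obtain ⟨w, hw, e⟩ := (mem_image _ _ _).1 this
    rwa [hj z (hs z hz) w (ht w hw) e]
  exact ext fun z => ⟨key s t hs ht h z, key t s ht hs h.symm z⟩

theorem IsCoding.compress {e K L : M} (he : IsCoding e K) (hK : OrdSet K) (hL : OrdSet L)
    (j : M → M) [Dfn M j] (hj : ∀ c ∈ L, j c ∈ finSub K)
    (hj' : ∀ c ∈ L, ∀ d ∈ L, j c = j d → c = d) :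
    (∀ t ∈ finSub L, compress e j t ∈ K) ∧
      ∀ t ∈ finSub L, ∀ t' ∈ finSub L, compress e j t = compress e j t' → t = t' := by
  have h1 : ∀ t ∈ finSub L, image t (fun c => app e (j c)) ∈ finSub K := by
    intro t ht
    obtain ⟨ht, ht'⟩ := mem_finSub.1 ht
    refine mem_finSub.2 ⟨image_subset _ fun c hc => he.1 _ (hj c (ht c hc)), ?_⟩
    exact oFin_image (hL.mono ht) ht' _ fun c hc => hK _ (he.1 _ (hj c (ht c hc)))
  refine ⟨fun t ht => he.1 _ (h1 t ht), fun t ht t' ht' h => ?_⟩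
  exact image_injOn (K := L) _ (fun c hc d hd h => hj' c hc d hd (he.2 _ (hj c hc) _ (hj d hd) h))
    (mem_finSub.1 ht).1 (mem_finSub.1 ht').1 (he.2 _ (h1 t ht) _ (h1 t' ht') h)

/-- The three cases of `codingStep` each yield a coding. Uniformity matters: the coding of an
infinite set of ordinals has to be definable from the set alone. -/
theorem isCoding_coding {I : M} (hI : OrdSet I) (b : M) (hb : Ord b) :
    ¬ OFin (below I b) → IsCoding (coding I b) (below I b) := by
  refine Ord.induction (P := fun b => ¬ OFin (below I b) → IsCoding (coding I b) (below I b))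
    (fun b hb ih hinf => ?_) b hb
  have hK : OrdSet (below I b) := hI.mono fun z hz => (mem_below.1 hz).1
  have hsub : ∀ d ∈ b, ∀ z ∈ below I d, z ∈ below I b := fun d hd z hz => by
    obtain ⟨h1, h2⟩ := mem_below.1 hz
    exact mem_below.2 ⟨h1, hb.trans hd h2⟩
  -- it suffices to describe the values
  suffices H : ∃ g : M → M, (∀ t ∈ finSub (below I b), app (coding I b) t = g t) ∧
      (∀ t ∈ finSub (below I b), g t ∈ below I b) ∧
      ∀ t ∈ finSub (below I b), ∀ t' ∈ finSub (below I b), g t = g t' → t = t' by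
    obtain ⟨g, h1, h2, h3⟩ := H
    refine ⟨fun t ht => by rw [h1 t ht]; exact h2 t ht, fun t ht t' ht' h => ?_⟩
    rw [h1 t ht, h1 t' ht'] at h
    exact h3 t ht t' ht' h
  have heq : coding I b = codingStep I b (lam b (coding I)) := recF_eq (codingStep I) hb
  -- all finite subsets are enumerated
  by_cases hA : ∀ t ∈ finSub (below I b), ∃ c ∈ below I b, finEnum I c = t
  · have hg : ∀ t ∈ finSub (below I b),
        leastOrd (fun c => c ∈ below I b ∧ finEnum I c = t) ∈ below I b ∧
        finEnum I (leastOrd fun c => c ∈ below I b ∧ finEnum I c = t) = t := by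
      intro t ht
      obtain ⟨c, hc, hc'⟩ := hA t ht
      exact leastOrd_prop (P := fun c => c ∈ below I b ∧ finEnum I c = t) (hK c hc) ⟨hc, hc'⟩
    refine ⟨fun t => leastOrd fun c => c ∈ below I b ∧ finEnum I c = t, fun t ht => ?_,
      fun t ht => (hg t ht).1, fun t ht t' ht' h => ?_⟩
    · rw [heq, codingStep, app_lam _ ht, if_pos hA]
    · have h : leastOrd (fun c => c ∈ below I b ∧ finEnum I c = t) =
        leastOrd (fun c => c ∈ below I b ∧ finEnum I c = t') := h
      rw [← (hg t ht).2, h]; exact (hg t' ht').2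
  -- `I ∩ b` has a greatest element
  by_cases hB : ∃ m ∈ below I b, ∀ k ∈ below I b, k ∈ m ∨ k = m
  · obtain ⟨m, hm, hmax⟩ := hB
    obtain ⟨hmI, hmb⟩ := mem_below.1 hm
    have hthe : (the fun m => m ∈ below I b ∧ ∀ k ∈ below I b, k ∈ m ∨ k = m) = m := by
      refine the_eq (P := fun m => m ∈ below I b ∧ ∀ k ∈ below I b, k ∈ m ∨ k = m) ⟨hm, hmax⟩ ?_
      rintro n ⟨hn, hn'⟩
      rcases hmax n hn with h | h
      · rcases hn' m hm with h1 | h1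
        · exact absurd h (mem_asymm h1)
        · exact h1.symm
      · exact h
    have hmin : ¬ OFin (below I m) := fun h => by
      refine hinf (oFin_of_subset_union hK h (t := upair m m) (oFin_of_subsingleton (by simp)) ?_)
      intro z hz
      rcases hmax z hz with h | rfl
      · exact Or.inl (mem_below.2 ⟨(mem_below.1 hz).1, h⟩)
      · exact Or.inr (by simp)
    have hmx : ∀ c ∈ below I b, (∀ k ∈ below I b, k ∈ c ∨ k = c) ↔ c = m := by
      intro c hc
      constructor
      · intro h
        rcases h m hm with h | h
        · rcases hmax c hc with h' | h'
          · exact absurd h (mem_asymm h')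
          · exact h'
        · exact h.symm
      · rintro rfl; exact hmax
    classical
    obtain ⟨h1, h2⟩ := (ih m hmb hmin).compress (L := below I b)
      (hI.mono fun z hz => (mem_below.1 hz).1) hK
      (fun c => if ∀ k ∈ below I b, k ∈ c ∨ k = c then emp M else upair c c) (by
        intro c hc
        simp only [hmx c hc]
        split_ifs with h
        · exact mem_finSub.2 ⟨fun z hz => absurd hz (notMem_emp _),
            oFin_of_subsingleton fun z hz => absurd hz (notMem_emp _)⟩
        · refine mem_finSub.2 ⟨fun z hz => ?_, oFin_of_subsingleton (by simp)⟩
          obtain rfl : z = c := by simpa using hz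
          exact mem_below.2 ⟨(mem_below.1 hc).1, (hmax z hc).resolve_right h⟩)
      (by
        intro c hc d hd
        simp only [hmx c hc, hmx d hd]
        have hne : ∀ c : M, upair c c ≠ emp M := fun c => ne_emp_iff.2 ⟨c, by simp⟩
        split_ifs with h h' h'
        · intro _; rw [h, h']
        · exact fun e => absurd e.symm (hne d)
        · exact fun e => absurd e (hne c)
        · exact upair_self_inj)
    refine ⟨_, fun t ht => ?_, fun t ht => hsub m hmb _ (h1 t ht), h2⟩
    rw [heq, codingStep, app_lam _ ht, if_neg hA, if_pos ⟨m, hm, hmax⟩, hthe, app_lam _ hmb]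
  · -- some finite subset is never enumerated, and `I ∩ b` has no greatest element
    have hA' := hA
    push Not at hA'
    obtain ⟨t, ht, ht'⟩ := hA'
    have hfs : ∀ s ∈ finSub (below I b), s ∈ finSub I := fun s hs =>
      mem_finSub.2 ⟨fun z hz => (mem_below.1 ((mem_finSub.1 hs).1 z hz)).1, (mem_finSub.1 hs).2⟩
    have hs := finEnum_spec hI hb (hfs t ht) fun c hc hcI => ht' c (mem_below.2 ⟨hcI, hc⟩)
    have hsb : ∀ z ∈ finEnum I b, z ∈ b := by
      by_cases h : t = finEnum I b
      · rw [← h]; exact fun z hz => (mem_below.1 ((mem_finSub.1 ht).1 z hz)).2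
      · exact (hs.2.2 h).subset hb (hI.mono (mem_finSub.1 hs.1).1)
          fun z hz => (mem_below.1 ((mem_finSub.1 ht).1 z hz)).2
    have hex : ∃ d ∈ b, ∀ z ∈ finEnum I b, z ∈ d := by
      push Not at hB
      by_cases hne : ∃ z, z ∈ finEnum I b
      · obtain ⟨m, hm, hmax⟩ := (mem_finSub.1 hs.1).2 _ (fun _ h => h) hne
        have hmK : m ∈ below I b := mem_below.2 ⟨(mem_finSub.1 hs.1).1 m hm, hsb m hm⟩
        obtain ⟨k, hk, hk1, hk2⟩ := hB m hmK
        have hmk := (hK k hk).mem_of_notMem (hK m hmK) hk1 hk2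
        refine ⟨k, (mem_below.1 hk).2, fun z hz => ?_⟩
        rcases hmax z hz with h | rfl
        · exact (hK k hk).trans hmk h
        · exact hmk
      · by_contra hd
        push Not at hd hne
        refine hinf (oFin_of_subsingleton fun a ha => ?_)
        obtain ⟨z, hz, -⟩ := hd a (mem_below.1 ha).2
        exact absurd hz (hne z)
    obtain ⟨d, hd, hd'⟩ := hex
    obtain ⟨hdo, ⟨hdb, hsd⟩, -⟩ := leastOrd_spec (P := fun d => d ∈ b ∧ ∀ z ∈ finEnum I b, z ∈ d)
      (hb.mem hd) ⟨hd, hd'⟩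
    generalize hdd : leastOrd (fun d => d ∈ b ∧ ∀ z ∈ finEnum I b, z ∈ d) = d at hdo hdb hsd
    obtain ⟨h1, h2⟩ := finEnum_below hI hb hs.1 hs.2.1
    have h1' : ∀ c ∈ below I b, finEnum I c ∈ finSub (below I d) := by
      intro c hc
      obtain ⟨h3, h4⟩ := h1 c hc
      obtain ⟨h5, h6⟩ := mem_finSub.1 h3
      exact mem_finSub.2
        ⟨fun z hz => mem_below.2 ⟨h5 z hz, h4.subset hdo (hI.mono h5) hsd z hz⟩, h6⟩
    have hOd : OrdSet (below I d) := hI.mono fun z hz => (mem_below.1 hz).1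
    -- `I ∩ b` embeds into the power set of `I ∩ d`
    have hdinf : ¬ OFin (below I d) := fun h => by
      refine hinf (oFin_of_injOn hK (finEnum I) (Y := pow (below I d)) (fun c hc => ?_) h2
        (powerDedekindFinite_iff.1 (h.powerDedekindFinite hOd)))
      exact (mem_pow _ _).2 (mem_finSub.1 (h1' c hc)).1
    obtain ⟨h3, h4⟩ := (ih d hdb hdinf).compress (L := below I b) hOd hK (finEnum I) h1' h2
    refine ⟨_, fun t ht => ?_, fun t ht => hsub d hdb _ (h3 t ht), h4⟩
    rw [heq, codingStep, app_lam _ ht, if_neg hA, if_neg hB, hdd, app_lam _ hdb]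

/-- The code in `I` of a finite subset `t` of an infinite set `I` of ordinals. The union of the
successors of the elements of `I` bounds `I`. -/
noncomputable def enc (I t : M) : M := app (coding I (sUnion (image I succ))) t

instance dfn_enc {Γ : Type*} [DefSpace M Γ] (t s : Γ → M) [Dfn M t] [Dfn M s] :
    Dfn M (no_index fun γ => enc (t γ) (s γ)) := by unfold enc; infer_instance

theorem isCoding_enc {I : M} (hI : OrdSet I) (hinf : ¬ OFin I) :
    (∀ t ∈ finSub I, enc I t ∈ I) ∧
      ∀ t ∈ finSub I, ∀ t' ∈ finSub I, enc I t = enc I t' → t = t' := by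
  have hb : Ord (sUnion (image I succ)) := ord_sUnion fun a ha => by
    obtain ⟨b, hb, rfl⟩ := (mem_image _ _ _).1 ha
    exact (hI b hb).succ
  have heq : below I (sUnion (image I succ)) = I := ext fun z => by
    rw [mem_below]
    refine ⟨And.left, fun hz => ⟨hz, (mem_sUnion _ _).2
      ⟨succ z, ?_, (mem_succ _ _).2 (Or.inr rfl)⟩⟩⟩
    exact (mem_image _ _ _).2 ⟨z, hz, rfl⟩
  have := isCoding_coding hI _ hb (by rwa [heq])
  rwa [heq] at this

end Coding

/-! ### Well-ordered groups of permutations -/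

section Blocks
variable {M : Type*} [Membership M M] [ZF M]

theorem isPermutation_iff {f x : M} : IsPermutation f x ↔ IsFunction f x x ∧
    (∀ a ∈ x, ∀ b ∈ x, app f a = app f b → a = b) ∧ ∀ b ∈ x, ∃ a ∈ x, b = app f a := by
  rw [IsPermutation, isBijection_iff, isInjection_iff, and_assoc]

/-- The set of points of `x` that are moved by `h`. -/
noncomputable def moved (x h : M) : M := sep x fun z => app h z ≠ z

/-- The value at `z` of the `i`-th member of the family `a`. -/
noncomputable def act (a i z : M) : M := app (app a i) z

section
variable {Γ : Type*} [DefSpace M Γ] (t s r : Γ → M) [Dfn M t] [Dfn M s] [Dfn M r]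
instance dfn_moved : Dfn M (no_index fun γ => moved (t γ) (s γ)) := by unfold moved; infer_instance
instance dfn_act : Dfn M (no_index fun γ => act (t γ) (s γ) (r γ)) := by unfold act; infer_instance
end

/-- `a` lists, without repetition along the infinite set `B` of ordinals, the members of a group of
permutations of `x` each of which moves only power Dedekind finitely many points. Closure is stated
in the form `a i ∘ (a j)⁻¹ = a k`. -/
structure PermFamily (x B a : M) : Prop where
  ord : OrdSet B
  inf : ¬ OFin B
  perm : ∀ i ∈ B, IsPermutation (app a i) x
  inj : ∀ i ∈ B, ∀ j ∈ B, app a i = app a j → i = j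
  pdf : ∀ i ∈ B, PowerDedekindFinite (moved x (app a i))
  closed : ∀ i ∈ B, ∀ j ∈ B, ∃ k ∈ B, ∀ z ∈ x, act a k (act a j z) = act a i z

/-- A finite set of indices determining which members of the family move `z`. It consists of those
`i` with `a i` moving `z` for which some point is fixed by `a i` but moved by all earlier members
that move `z`. -/
noncomputable def code (x B a z : M) : M := sep B fun i => act a i z ≠ z ∧
  ∃ w ∈ x, act a i w = w ∧ ∀ k ∈ B, k ∈ i → act a k z ≠ z → act a k w ≠ w

/-- The label of the block of `z`, an element of `B`. The blocks are the classes of points moved by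
the same members of the family, see `PermFamily.lab_eq_iff`. -/
noncomputable def lab (x B a z : M) : M := enc B (code x B a z)

/-- The set of all points moved by some member of the family. -/
noncomputable def supp (x B a : M) : M := sep x fun z => ∃ i ∈ B, act a i z ≠ z

/-- The set of labels of all blocks. -/
noncomputable def labels (x B a : M) : M := image (supp x B a) (lab x B a)

/-- The labels `b` and `c` are linked if some member of the family carries block `b` to block
`c`. -/
def Linked (x B a b c : M) : Prop :=
  ∃ k ∈ B, ∃ z ∈ supp x B a, lab x B a z = b ∧ lab x B a (act a k z) = c

/-- The orbit of the label `b` under the action of the group on the blocks. -/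
noncomputable def orb (x B a b : M) : M := sep (labels x B a) fun c => Linked x B a b c

section
variable {Γ : Type*} [DefSpace M Γ] (t s r v w : Γ → M) [Dfn M t] [Dfn M s] [Dfn M r] [Dfn M v]
  [Dfn M w]
instance dfn_code : Dfn M (no_index fun γ => code (t γ) (s γ) (r γ) (v γ)) := by
  unfold code; infer_instance
instance dfn_lab : Dfn M (no_index fun γ => lab (t γ) (s γ) (r γ) (v γ)) := by
  unfold lab; infer_instance
instance dfn_supp : Dfn M (no_index fun γ => supp (t γ) (s γ) (r γ)) := by
  unfold supp; infer_instance
instance dfn_labels : Dfn M (no_index fun γ => labels (t γ) (s γ) (r γ)) := by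
  unfold labels; infer_instance
instance dfn_linked : Dfn M (no_index fun γ => Linked (t γ) (s γ) (r γ) (v γ) (w γ)) := by
  unfold Linked; infer_instance
instance dfn_orb : Dfn M (no_index fun γ => orb (t γ) (s γ) (r γ) (v γ)) := by
  unfold orb; infer_instance
end

theorem mem_moved {x h z : M} : z ∈ moved x h ↔ z ∈ x ∧ app h z ≠ z := mem_sep _ _ _

theorem mem_supp {x B a z : M} : z ∈ supp x B a ↔ z ∈ x ∧ ∃ i ∈ B, act a i z ≠ z := mem_sep _ _ _

theorem mem_labels {x B a b : M} : b ∈ labels x B a ↔ ∃ z ∈ supp x B a, b = lab x B a z :=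
  mem_image _ _ _

theorem mem_orb {x B a b c : M} : c ∈ orb x B a b ↔ c ∈ labels x B a ∧ Linked x B a b c :=
  mem_sep _ _ _

/-- Only finitely many members of the family move no point outside a power Dedekind finite set `m`.
Let `Y i` be the set of points of `m` at which the `i`-th of these members differs from all earlier
ones. By the pigeonhole principle `Y i` is nonempty only for `i` in a finite set `K`, since members
with the same `Y i` take different values at any point of it. Hence a member is determined by the
finitely many subsets of `m` on which it agrees with the `k`-th member, `k ∈ K`, and the pigeonhole
principle applies to these. -/
theorem PermFamily.oFin_of_moved_subset {x B a : M} (h : PermFamily x B a) {m : M}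
    (hm : PowerDedekindFinite m) (hmx : ∀ z ∈ m, z ∈ x) :
    OFin (sep B fun i => ∀ z ∈ x, act a i z ≠ z → z ∈ m) := by
  generalize hB' : sep B (fun i => ∀ z ∈ x, act a i z ≠ z → z ∈ m) = B'
  have hB'B : ∀ i ∈ B', i ∈ B := by rw [← hB']; exact fun i hi => ((mem_sep _ _ _).1 hi).1
  have hB'm : ∀ i ∈ B', ∀ z ∈ x, z ∉ m → act a i z = z := by
    rw [← hB']
    intro i hi z hz hzm
    by_contra hne
    exact hzm (((mem_sep _ _ _).1 hi).2 z hz hne)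
  have hO : OrdSet B' := h.ord.mono hB'B
  have hpow : DedekindFinite (pow m) := powerDedekindFinite_iff.1 hm
  -- a permutation that fixes everything outside `m` preserves `m`
  have hact : ∀ i ∈ B', ∀ z ∈ m, act a i z ∈ m := by
    intro i hi z hz
    by_contra hne
    obtain ⟨hf, hinj, -⟩ := isPermutation_iff.1 (h.perm i (hB'B i hi))
    have h1 : act a i z ∈ x := hf.app_mem (hmx z hz)
    have h2 := hinj _ h1 _ (hmx z hz) (hB'm i hi _ h1 hne)
    exact hne (by rw [h2]; exact hz)
  by_contra hinf
  let Y : M → M := fun i => sep m fun z => ∀ k ∈ B', k ∈ i → act a i z ≠ act a k z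
  have hY : Dfn M Y := by unfold Y; infer_instance
  have hK : OFin (sep B' fun i => ∃ z, z ∈ Y i) := by
    by_contra hK
    have hKO : OrdSet (sep B' fun i => ∃ z, z ∈ Y i) :=
      hO.mono fun z hz => ((mem_sep _ _ _).1 hz).1
    obtain ⟨C, -, hC⟩ := exists_fibre_not_oFin hKO hK Y
      (fun i _ => (mem_pow _ _).2 fun z hz => ((mem_sep _ _ _).1 hz).1) hpow
    refine hC ?_
    by_cases hne : ∃ i, i ∈ sep (sep B' fun i => ∃ z, z ∈ Y i) fun i => Y i = C
    · obtain ⟨i, hi⟩ := hne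
      simp only [mem_sep] at hi
      obtain ⟨⟨-, z, hz⟩, rfl⟩ := hi
      have hzm : z ∈ m := ((mem_sep _ _ _).1 hz).1
      have key : ∀ k ∈ B', Y k = Y i → ∀ l ∈ B', l ∈ k → act a k z ≠ act a l z := by
        intro k _ hk
        rw [← hk] at hz
        exact ((mem_sep _ _ _).1 hz).2
      refine oFin_of_injOn (hKO.mono fun z hz => ((mem_sep _ _ _).1 hz).1) (fun k => act a k z)
        (fun k hk => hact k ((mem_sep _ _ _).1 ((mem_sep _ _ _).1 hk).1).1 z hzm) ?_
        hm.dedekindFinite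
      intro k hk l hl e
      simp only [mem_sep] at hk hl
      exact (hO k hk.1.1).eq_of_notMem (hO l hl.1.1)
        (fun hkl => key l hl.1.1 hl.2 k hk.1.1 hkl e.symm)
        fun hlk => key k hk.1.1 hk.2 l hl.1.1 hlk e
    · exact oFin_of_subsingleton fun i hi => absurd ⟨i, hi⟩ hne
  have hcov : ∀ i ∈ B', ∀ z ∈ m, ∃ k ∈ sep B' (fun i => ∃ z, z ∈ Y i), act a i z = act a k z := by
    intro i hi z hz
    obtain ⟨k, hk, ⟨hkB, e⟩, hleast⟩ := (hO i hi).exists_least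
      (P := fun k => k ∈ B' ∧ act a i z = act a k z) ⟨hi, rfl⟩
    refine ⟨k, (mem_sep _ _ _).2 ⟨hkB, z, (mem_sep _ _ _).2 ⟨hz, fun l hl hlk e' => ?_⟩⟩, e⟩
    exact hleast l hlk ⟨hl, e.trans e'⟩
  -- thin out `B'` along `K`: any two members left agree with the `k`-th member at the same points
  obtain ⟨j, hj, T, hT, hTinf, hTj⟩ := OFin.induction
    (hO.mono fun z hz => ((mem_sep _ _ _).1 hz).1) hK
    (P := fun j => ∃ T, (∀ t ∈ T, t ∈ B') ∧ ¬ OFin T ∧ ∀ k ∈ sep B' (fun i => ∃ z, z ∈ Y i), k ∈ j →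
      ∀ t ∈ T, ∀ t' ∈ T, ∀ z ∈ m, act a t z = act a k z → act a t' z = act a k z)
    (fun j hj => ⟨B', fun _ h => h, hinf, fun k hk hkj => absurd hkj (hj k hk)⟩)
    (fun j n _ hmax ⟨T, hT, hTinf, hTn⟩ => by
      obtain ⟨C, -, hC⟩ := exists_fibre_not_oFin (hO.mono hT) hTinf
        (fun t => sep m fun z => act a t z = act a n z)
        (fun i _ => (mem_pow _ _).2 fun z hz => ((mem_sep _ _ _).1 hz).1) hpow
      refine ⟨_, fun t ht => hT t ((mem_sep _ _ _).1 ht).1, hC,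
        fun k hk hkj t ht t' ht' z hz e => ?_⟩
      obtain ⟨ht, htC⟩ := (mem_sep _ _ _).1 ht
      obtain ⟨ht', htC'⟩ := (mem_sep _ _ _).1 ht'
      rcases hmax k hk hkj with hkn | rfl
      · exact hTn k hk hkn t ht t' ht' z hz e
      · have : z ∈ C := by rw [← htC]; exact (mem_sep _ _ _).2 ⟨hz, e⟩
        rw [← htC'] at this
        exact ((mem_sep _ _ _).1 this).2)
  refine hTinf (oFin_of_subsingleton fun t ht t' ht' => h.inj t (hB'B t (hT t ht)) t'
    (hB'B t' (hT t' ht')) ?_)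
  refine (isPermutation_iff.1 (h.perm t (hB'B t (hT t ht)))).1.ext
    (isPermutation_iff.1 (h.perm t' (hB'B t' (hT t' ht')))).1 fun z hz => ?_
  by_cases hzm : z ∈ m
  · obtain ⟨k, hk, e⟩ := hcov t (hT t ht) z hzm
    exact e.trans (hTj k hk (hj k hk) t ht t' ht' z hzm e).symm
  · exact (hB'm t (hT t ht) z hz hzm).trans (hB'm t' (hT t' ht') z hz hzm).symm

theorem mem_code {x B a z i : M} : i ∈ code x B a z ↔ i ∈ B ∧ act a i z ≠ z ∧
    ∃ w ∈ x, act a i w = w ∧ ∀ k ∈ B, k ∈ i → act a k z ≠ z → act a k w ≠ w := mem_sep _ _ _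

namespace PermFamily
variable {x B a : M} (h : PermFamily x B a)
include h

/-- Let `i0` be the least element of the code. Successive indices in the code cut down the set of
points moved by `a i0` and by all earlier members moving `z`; an infinite code would give infinitely
many subsets of a power Dedekind finite set. -/
theorem oFin_code (z : M) : OFin (code x B a z) := by
  intro t ht ⟨i, hi⟩
  have hO : OrdSet t := h.ord.mono fun i hi => (mem_code.1 (ht i hi)).1
  by_contra hmax
  push Not at hmax
  obtain ⟨i0, ho, hi0, hleast⟩ := (hO i hi).exists_least (P := fun i => i ∈ t) hi
  have hm := h.pdf i0 (mem_code.1 (ht i0 hi0)).1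
  have hinf : ¬ OFin t := fun hfin => by
    obtain ⟨m, hm, hm'⟩ := hfin t (fun _ h => h) ⟨i, hi⟩
    obtain ⟨k, hk, hk1, hk2⟩ := hmax m hm
    exact (hm' k hk).elim hk1 hk2
  have hinf' : ¬ OFin (sep t fun i => i0 ∈ i) := fun hfin =>
    hinf (oFin_of_subset_union (t := upair i0 i0) hO hfin (oFin_of_subsingleton (by simp))
      fun k hk => by
        by_cases e : k = i0
        · exact Or.inr (by simp [e])
        · exact Or.inl ((mem_sep _ _ _).2 ⟨hk, (hO k hk).mem_of_notMem ho (hleast k · hk) e⟩))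
  refine hinf' (oFin_of_injOn (hO.mono fun z hz => ((mem_sep _ _ _).1 hz).1)
    (fun i => sep (moved x (app a i0)) fun w => ∀ k ∈ B, k ∈ i → act a k z ≠ z → act a k w ≠ w)
    (fun i _ => (mem_pow _ _).2 fun w hw => ((mem_sep _ _ _).1 hw).1) ?_
    (powerDedekindFinite_iff.1 hm))
  have key : ∀ i ∈ t, i0 ∈ i → ∀ l ∈ t, i ∈ l →
      (sep (moved x (app a i0)) fun w => ∀ k ∈ B, k ∈ i → act a k z ≠ z → act a k w ≠ w) ≠
      (sep (moved x (app a i0)) fun w => ∀ k ∈ B, k ∈ l → act a k z ≠ z → act a k w ≠ w) := by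
    intro i hi hi0i l hl hil e
    obtain ⟨hiB, hiz, w, hw, hiw, hk⟩ := mem_code.1 (ht i hi)
    have hi0' := mem_code.1 (ht i0 hi0)
    have hw1 : w ∈ sep (moved x (app a i0)) fun w =>
        ∀ k ∈ B, k ∈ i → act a k z ≠ z → act a k w ≠ w :=
      (mem_sep _ _ _).2 ⟨mem_moved.2 ⟨hw, hk i0 hi0'.1 hi0i hi0'.2.1⟩, hk⟩
    rw [e] at hw1
    exact ((mem_sep _ _ _).1 hw1).2 i hiB hil hiz hiw
  intro i hi l hl e
  simp only [mem_sep] at hi hl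
  exact (hO i hi.1).eq_of_notMem (hO l hl.1) (fun hil => key i hi.1 hi.2 l hl.1 hil e)
    fun hli => key l hl.1 hl.2 i hi.1 hli e.symm

theorem code_mem (z : M) : code x B a z ∈ finSub B :=
  mem_finSub.2 ⟨fun _ hi => (mem_code.1 hi).1, h.oFin_code z⟩

theorem lab_mem (z : M) : lab x B a z ∈ B :=
  (isCoding_enc h.ord h.inf).1 _ (h.code_mem z)

/-- If two points are moved by different members, then the least index at which they differ belongs
to exactly one of the codes. -/
theorem lab_eq_iff {z w : M} (hz : z ∈ x) (hw : w ∈ x) :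
    lab x B a z = lab x B a w ↔ ∀ i ∈ B, act a i z ≠ z ↔ act a i w ≠ w := by
  constructor
  · intro e
    have e := (isCoding_enc h.ord h.inf).2 _ (h.code_mem z) _ (h.code_mem w) e
    have key : ∀ z w, w ∈ x → code x B a z = code x B a w →
        ∀ i ∈ B, act a i z ≠ z → act a i w ≠ w := by
      intro z w hw e i hi hiz hiw
      obtain ⟨i, hio, ⟨hi, hiz, hiw⟩, hleast⟩ := (h.ord i hi).exists_least
        (P := fun i => i ∈ B ∧ act a i z ≠ z ∧ act a i w = w) ⟨hi, hiz, hiw⟩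
      have : i ∈ code x B a z := mem_code.2 ⟨hi, hiz, w, hw, hiw, fun k hk hki hkz hkw =>
        hleast k hki ⟨hk, hkz, hkw⟩⟩
      rw [e] at this
      exact (mem_code.1 this).2.1 hiw
    exact fun i hi => ⟨key z w hw e i hi, key w z hz e.symm i hi⟩
  · intro hi
    rw [lab, lab]
    congr 1
    refine ext fun i => ?_
    rw [mem_code, mem_code]
    refine and_congr_right fun hiB => and_congr (hi i hiB) (exists_congr fun v =>
      and_congr_right fun _ => and_congr_right fun _ => forall_congr' fun k =>
      forall_congr' fun hk => ?_)
    rw [hi k hk]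

theorem ordSet_labels : OrdSet (labels x B a) := fun b hb => by
  obtain ⟨z, hz, rfl⟩ := mem_labels.1 hb
  exact h.ord _ (h.lab_mem z)

/-- A power Dedekind finite set meets only finitely many blocks. -/
theorem oFin_image_lab {m : M} (hm : PowerDedekindFinite m) :
    OFin (image m (lab x B a)) := by
  refine oFin_of_injOn (fun b hb => ?_) (fun b => sep m fun z => lab x B a z = b) (Y := pow m)
    (fun b _ => (mem_pow _ _).2 fun z hz => ((mem_sep _ _ _).1 hz).1) ?_
    (powerDedekindFinite_iff.1 hm)
  · obtain ⟨z, hz, rfl⟩ := (mem_image _ _ _).1 hb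
    exact h.ord _ (h.lab_mem z)
  · intro b hb c _ e
    obtain ⟨z, hz, rfl⟩ := (mem_image _ _ _).1 hb
    have : z ∈ sep m fun w => lab x B a w = lab x B a z := (mem_sep _ _ _).2 ⟨hz, rfl⟩
    have e' : (sep m fun w => lab x B a w = lab x B a z) = sep m fun w => lab x B a w = c := e
    rw [e'] at this
    exact ((mem_sep _ _ _).1 this).2

/-! ### The action on blocks -/

theorem act_mem {i z : M} (hi : i ∈ B) (hz : z ∈ x) : act a i z ∈ x :=
  (isPermutation_iff.1 (h.perm i hi)).1.app_mem hz

theorem act_inj {i z w : M} (hi : i ∈ B) (hz : z ∈ x) (hw : w ∈ x) (e : act a i z = act a i w) :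
    z = w := (isPermutation_iff.1 (h.perm i hi)).2.1 z hz w hw e

theorem exists_one {i : M} (hi : i ∈ B) : ∃ k ∈ B, ∀ z ∈ x, act a k z = z := by
  obtain ⟨k, hk, hk'⟩ := h.closed i hi i hi
  refine ⟨k, hk, fun z hz => ?_⟩
  obtain ⟨w, hw, rfl⟩ := (isPermutation_iff.1 (h.perm i hi)).2.2 z hz
  exact hk' w hw

theorem exists_inv {i : M} (hi : i ∈ B) :
    ∃ k ∈ B, (∀ z ∈ x, act a k (act a i z) = z) ∧ ∀ z ∈ x, act a i (act a k z) = z := by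
  obtain ⟨e, he, he'⟩ := h.exists_one hi
  obtain ⟨k, hk, hk'⟩ := h.closed e he i hi
  have h1 : ∀ z ∈ x, act a k (act a i z) = z := fun z hz => (hk' z hz).trans (he' z hz)
  refine ⟨k, hk, h1, fun z hz => ?_⟩
  obtain ⟨w, hw, rfl⟩ := (isPermutation_iff.1 (h.perm i hi)).2.2 z hz
  exact congrArg (act a i) (h1 w hw)

theorem exists_mul {i j : M} (hi : i ∈ B) (hj : j ∈ B) :
    ∃ k ∈ B, ∀ z ∈ x, act a k z = act a i (act a j z) := by
  obtain ⟨j', hj', h1, -⟩ := h.exists_inv hj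
  obtain ⟨k, hk, hk'⟩ := h.closed i hi j' hj'
  refine ⟨k, hk, fun z hz => ?_⟩
  rw [← hk' _ (h.act_mem hj hz), h1 z hz]

/-- Members of the family permute the blocks. -/
theorem lab_act {k z w : M} (hk : k ∈ B) (hz : z ∈ x) (hw : w ∈ x)
    (e : lab x B a z = lab x B a w) : lab x B a (act a k z) = lab x B a (act a k w) := by
  rw [h.lab_eq_iff hz hw] at e
  rw [h.lab_eq_iff (h.act_mem hk hz) (h.act_mem hk hw)]
  intro i hi
  obtain ⟨n, hn, hn'⟩ := h.exists_mul hi hk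
  obtain ⟨k', hk', h1, h2⟩ := h.exists_inv hk
  obtain ⟨l, hl, hl'⟩ := h.exists_mul hk' hn
  have key : ∀ z ∈ x, act a i (act a k z) ≠ act a k z ↔ act a l z ≠ z := by
    intro z hz
    rw [hl' z hz, hn' z hz]
    refine not_congr ⟨fun e => by rw [e, h1 z hz], fun e => ?_⟩
    rw [← h2 _ (h.act_mem hi (h.act_mem hk hz)), e]
  rw [key z hz, key w hw, e l hl]

theorem act_mem_supp {k z : M} (hk : k ∈ B) (hz : z ∈ supp x B a) : act a k z ∈ supp x B a := by
  obtain ⟨hz, i, hi, hiz⟩ := mem_supp.1 hz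
  refine mem_supp.2 ⟨h.act_mem hk hz, ?_⟩
  by_contra hne
  push Not at hne
  obtain ⟨k', hk', h1, -⟩ := h.exists_inv hk
  have h4 := hne k' hk'
  rw [h1 z hz] at h4
  -- `k` fixes `z`, hence so does every member of the family
  obtain ⟨i, hi, hiz, hk⟩ : ∃ i ∈ B, act a i z ≠ z ∧ act a k z = z := ⟨i, hi, hiz, h4.symm⟩
  have := hne i hi
  rw [hk] at this
  exact hiz this

theorem linked_refl {b : M} (hb : b ∈ labels x B a) : Linked x B a b b := by
  obtain ⟨z, hz, rfl⟩ := mem_labels.1 hb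
  obtain ⟨hzx, i, hi, -⟩ := mem_supp.1 hz
  obtain ⟨k, hk, hk'⟩ := h.exists_one hi
  exact ⟨k, hk, z, hz, rfl, by rw [hk' z hzx]⟩

theorem linked_symm {b c : M} (hbc : Linked x B a b c) : Linked x B a c b := by
  obtain ⟨k, hk, z, hz, rfl, rfl⟩ := hbc
  obtain ⟨k', hk', h1, -⟩ := h.exists_inv hk
  exact ⟨k', hk', _, h.act_mem_supp hk hz, rfl, by rw [h1 z (mem_supp.1 hz).1]⟩

theorem linked_trans {b c d : M} (hbc : Linked x B a b c) (hcd : Linked x B a c d) :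
    Linked x B a b d := by
  obtain ⟨k, hk, z, hz, rfl, e⟩ := hbc
  obtain ⟨l, hl, w, hw, rfl, rfl⟩ := hcd
  obtain ⟨n, hn, hn'⟩ := h.exists_mul hl hk
  have hzx := (mem_supp.1 hz).1
  refine ⟨n, hn, z, hz, rfl, ?_⟩
  rw [hn' z hzx]
  exact h.lab_act hl (h.act_mem hk hzx) (mem_supp.1 hw).1 e

theorem ordSet_orb (b : M) : OrdSet (orb x B a b) :=
  h.ordSet_labels.mono fun _ hz => (mem_orb.1 hz).1

theorem mem_orb_self {b : M} (hb : b ∈ labels x B a) : b ∈ orb x B a b :=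
  mem_orb.2 ⟨hb, h.linked_refl hb⟩

theorem orb_eq {b c : M} (hc : c ∈ orb x B a b) : orb x B a c = orb x B a b := by
  have h1 := (mem_orb.1 hc).2
  refine ext fun d => ?_
  rw [mem_orb, mem_orb]
  exact and_congr_right fun _ => ⟨fun h2 => h.linked_trans h1 h2,
    fun h2 => h.linked_trans (h.linked_symm h1) h2⟩

end PermFamily
end Blocks

/-! ### Disjoint nontrivial permutations attached to the orbits -/

section Pieces
variable {M : Type*} [Membership M M] [ZF M]

theorem emp_mem_finSub (I : M) : emp M ∈ finSub I :=
  mem_finSub.2 ⟨fun z hz => absurd hz (notMem_emp z),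
    oFin_of_subsingleton fun z hz => absurd hz (notMem_emp z)⟩

theorem upair_mem_finSub {I b c : M} (hI : OrdSet I) (hb : b ∈ I) (hc : c ∈ I) :
    upair b c ∈ finSub I := by
  have hsub : ∀ z ∈ upair b c, z ∈ I := fun z hz => by
    rcases (mem_upair _ _ _).1 hz with rfl | rfl <;> assumption
  exact mem_finSub.2 ⟨hsub, oFin_of_subset_union (s := upair b b) (t := upair c c) (hI.mono hsub)
    (oFin_of_subsingleton (by simp)) (oFin_of_subsingleton (by simp)) (by simp)⟩

open Classical in
/-- The label of the first block attached to `b`. In a finite orbit `O` it is the least label; in an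
infinite one it is the code of `{c}`, where `c ∈ O` is the code of `{b}`. The second coding step
makes room for another block with a code depending on `b`, see `rgt`. -/
noncomputable def lft (x B a b : M) : M :=
  if OFin (orb x B a b) then leastOrd fun c => c ∈ orb x B a b
  else enc (orb x B a b) (upair (enc (orb x B a b) (upair b b)) (enc (orb x B a b) (upair b b)))

open Classical in
/-- The label of the second block attached to `b`. In a finite orbit it is the greatest label; in an
infinite orbit `O` it is the code of `{c, d}`, where `c` and `d` are the codes of `{b}` and `∅`. In
an infinite orbit, different `b` have disjoint pairs of attached blocks. -/
noncomputable def rgt (x B a b : M) : M :=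
  if OFin (orb x B a b) then
    leastOrd fun m => m ∈ orb x B a b ∧ ∀ k ∈ orb x B a b, k ∈ m ∨ k = m
  else enc (orb x B a b) (upair (enc (orb x B a b) (upair b b)) (enc (orb x B a b) (emp M)))

open Classical in
/-- The representative of the label `b`: the least label of its orbit if the orbit is finite, and
`b` itself if the orbit is infinite. -/
noncomputable def rep (x B a b : M) : M :=
  if OFin (orb x B a b) then leastOrd fun c => c ∈ orb x B a b else b

/-- The set of all representatives. -/
noncomputable def reps (x B a : M) : M := sep (labels x B a) fun b => rep x B a b = b

/-- The index of the first member of the family that carries the first block attached to `b` to the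
second one and moves the points of the first block. The last condition has content only if the two
blocks coincide. -/
noncomputable def mover (x B a b : M) : M := leastOrd fun k => k ∈ B ∧ ∃ z ∈ supp x B a,
  lab x B a z = lft x B a b ∧ lab x B a (act a k z) = rgt x B a b ∧ act a k z ≠ z

/-- `z` lies in one of the two blocks attached to `b`. -/
def Piece (x B a b z : M) : Prop :=
  z ∈ supp x B a ∧ (lab x B a z = lft x B a b ∨ lab x B a z = rgt x B a b)

open Classical in
/-- The permutation of the piece of `b` that acts on the first block by the member `mover` of the
family and, if the second block is a different one, on that by the inverse of this member. -/
noncomputable def piecePerm (x B a b z : M) : M :=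
  if lab x B a z = lft x B a b then act a (mover x B a b) z
  else the fun w => w ∈ x ∧ act a (mover x B a b) w = z

section
variable {Γ : Type*} [DefSpace M Γ] (t s r v w : Γ → M) [Dfn M t] [Dfn M s] [Dfn M r] [Dfn M v]
  [Dfn M w]
instance dfn_lft : Dfn M (no_index fun γ => lft (t γ) (s γ) (r γ) (v γ)) := by
  unfold lft; infer_instance
instance dfn_rgt : Dfn M (no_index fun γ => rgt (t γ) (s γ) (r γ) (v γ)) := by
  unfold rgt; infer_instance
instance dfn_rep : Dfn M (no_index fun γ => rep (t γ) (s γ) (r γ) (v γ)) := by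
  unfold rep; infer_instance
instance dfn_reps : Dfn M (no_index fun γ => reps (t γ) (s γ) (r γ)) := by
  unfold reps; infer_instance
instance dfn_mover : Dfn M (no_index fun γ => mover (t γ) (s γ) (r γ) (v γ)) := by
  unfold mover; infer_instance
instance dfn_piece : Dfn M (no_index fun γ => Piece (t γ) (s γ) (r γ) (v γ) (w γ)) := by
  unfold Piece; infer_instance
instance dfn_piecePerm : Dfn M (no_index fun γ => piecePerm (t γ) (s γ) (r γ) (v γ) (w γ)) := by
  unfold piecePerm; infer_instance
end

theorem mem_reps {x B a b : M} : b ∈ reps x B a ↔ b ∈ labels x B a ∧ rep x B a b = b :=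
  mem_sep _ _ _

/-- `q b`, for `b ∈ J`, is a nontrivial permutation of the set `{z | D b z} ⊆ x`, and these sets are
pairwise disjoint. -/
structure Pieces (x J : M) (D : M → M → Prop) (q : M → M → M) : Prop where
  sub : ∀ b ∈ J, ∀ z, D b z → z ∈ x
  maps : ∀ b ∈ J, ∀ z, D b z → D b (q b z)
  inj : ∀ b ∈ J, ∀ z w, D b z → D b w → q b z = q b w → z = w
  surj : ∀ b ∈ J, ∀ w, D b w → ∃ z, D b z ∧ q b z = w
  moves : ∀ b ∈ J, ∃ z, D b z ∧ q b z ≠ z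
  disj : ∀ b ∈ J, ∀ c ∈ J, ∀ z, D b z → D c z → b = c

namespace PermFamily
variable {x B a : M} (h : PermFamily x B a)
include h

theorem exists_max {b : M} (hb : b ∈ labels x B a) (hfin : OFin (orb x B a b)) :
    ∃ m, Ord m ∧ m ∈ orb x B a b ∧ ∀ k ∈ orb x B a b, k ∈ m ∨ k = m := by
  obtain ⟨m, hm, hm'⟩ := hfin _ (fun _ h => h) ⟨b, h.mem_orb_self hb⟩
  exact ⟨m, h.ordSet_orb b m hm, hm, hm'⟩

theorem lft_mem {b : M} (hb : b ∈ labels x B a) : lft x B a b ∈ orb x B a b := by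
  have hbo := h.mem_orb_self hb
  have hO := h.ordSet_orb b
  unfold lft
  split_ifs with hfin
  · exact leastOrd_prop (P := fun c => c ∈ orb x B a b) (hO b hbo) hbo
  · have henc := isCoding_enc hO hfin
    have h1 := henc.1 _ (upair_mem_finSub hO hbo hbo)
    exact henc.1 _ (upair_mem_finSub hO h1 h1)

theorem rgt_mem {b : M} (hb : b ∈ labels x B a) : rgt x B a b ∈ orb x B a b := by
  have hbo := h.mem_orb_self hb
  have hO := h.ordSet_orb b
  unfold rgt
  split_ifs with hfin
  · obtain ⟨m, hm, hm'⟩ := h.exists_max hb hfin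
    exact (leastOrd_prop (P := fun m => m ∈ orb x B a b ∧ ∀ k ∈ orb x B a b, k ∈ m ∨ k = m)
      hm hm').1
  · have henc := isCoding_enc hO hfin
    exact henc.1 _ (upair_mem_finSub hO (henc.1 _ (upair_mem_finSub hO hbo hbo))
      (henc.1 _ (emp_mem_finSub _)))

/-- If the two attached blocks coincide, the orbit consists of a single block, since in an infinite
orbit they have different codes; then any member moving a point of the block will do. -/
theorem mover_spec {b : M} (hb : b ∈ labels x B a) : mover x B a b ∈ B ∧
    (∃ z ∈ supp x B a, lab x B a z = lft x B a b) ∧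
    ∀ z ∈ supp x B a, lab x B a z = lft x B a b →
      lab x B a (act a (mover x B a b) z) = rgt x B a b ∧ act a (mover x B a b) z ≠ z := by
  have hl := h.lft_mem hb
  have hr := h.rgt_mem hb
  have hex : ∃ k ∈ B, ∃ z ∈ supp x B a, lab x B a z = lft x B a b ∧
      lab x B a (act a k z) = rgt x B a b ∧ act a k z ≠ z := by
    by_cases hlr : lft x B a b = rgt x B a b
    · -- the orbit is a single block
      have hone : ∀ c ∈ orb x B a b, c = lft x B a b := by
        have hO := h.ordSet_orb b
        have hbo := h.mem_orb_self hb
        by_cases hfin : OFin (orb x B a b)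
        · intro c hc
          obtain ⟨m, hm, hm'⟩ := h.exists_max hb hfin
          have h1 := leastOrd_spec (P := fun c => c ∈ orb x B a b) (hO b hbo) hbo
          have h2 := (leastOrd_prop (P := fun m => m ∈ orb x B a b ∧
            ∀ k ∈ orb x B a b, k ∈ m ∨ k = m) hm hm').2 c hc
          rw [lft, rgt, if_pos hfin, if_pos hfin] at hlr
          rw [lft, if_pos hfin]
          rw [← hlr] at h2
          exact h2.resolve_left fun h3 => h1.2.2 c h3 hc
        · exfalso
          have henc := isCoding_enc hO hfin
          have h1 := henc.1 _ (upair_mem_finSub hO hbo hbo)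
          have h0 := henc.1 _ (emp_mem_finSub (orb x B a b))
          rw [lft, rgt, if_neg hfin, if_neg hfin] at hlr
          have h2 := henc.2 _ (upair_mem_finSub hO h1 h1) _ (upair_mem_finSub hO h1 h0) hlr
          have h3 : enc (orb x B a b) (emp M) ∈ upair (enc (orb x B a b) (upair b b))
              (enc (orb x B a b) (upair b b)) := by rw [h2]; simp
          have h4 := henc.2 _ (emp_mem_finSub _) _ (upair_mem_finSub hO hbo hbo) (by simpa using h3)
          exact notMem_emp b (by rw [h4]; simp)
      obtain ⟨z, hz, hzl⟩ := mem_labels.1 (mem_orb.1 hl).1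
      obtain ⟨-, i, hi, hiz⟩ := mem_supp.1 hz
      refine ⟨i, hi, z, hz, hzl.symm, ?_, hiz⟩
      rw [← hlr]
      refine hone _ ?_
      rw [← h.orb_eq hl, hzl]
      exact mem_orb.2 ⟨mem_labels.2 ⟨_, h.act_mem_supp hi hz, rfl⟩, i, hi, z, hz, rfl, rfl⟩
    · obtain ⟨k, hk, z, hz, e1, e2⟩ :=
        h.linked_trans (h.linked_symm (mem_orb.1 hl).2) (mem_orb.1 hr).2
      exact ⟨k, hk, z, hz, e1, e2, fun e => hlr (by rw [← e1, ← e2, e])⟩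
  obtain ⟨k, hk, hk'⟩ := hex
  have hm : mover x B a b ∈ B ∧ ∃ z ∈ supp x B a, lab x B a z = lft x B a b ∧
      lab x B a (act a (mover x B a b) z) = rgt x B a b ∧ act a (mover x B a b) z ≠ z :=
    leastOrd_prop (P := fun k => k ∈ B ∧ ∃ z ∈ supp x B a, lab x B a z = lft x B a b ∧
      lab x B a (act a k z) = rgt x B a b ∧ act a k z ≠ z) (h.ord k hk) ⟨hk, hk'⟩
  obtain ⟨hm, z, hz, e1, e2, e3⟩ := hm
  refine ⟨hm, ⟨z, hz, e1⟩, fun w hw e => ?_⟩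
  have hzx := (mem_supp.1 hz).1
  have hwx := (mem_supp.1 hw).1
  have e4 := e.trans e1.symm
  exact ⟨by rw [h.lab_act hm hwx hzx e4, e2], ((h.lab_eq_iff hwx hzx).1 e4 _ hm).2 e3⟩

theorem exists_of_lab_eq_rgt {b w : M} (hb : b ∈ labels x B a) (hw : w ∈ supp x B a)
    (e : lab x B a w = rgt x B a b) :
    ∃ z ∈ supp x B a, lab x B a z = lft x B a b ∧ act a (mover x B a b) z = w := by
  obtain ⟨hm, ⟨z, hz, e1⟩, h1⟩ := h.mover_spec hb
  obtain ⟨k, hk, hk1, hk2⟩ := h.exists_inv hm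
  have hwx := (mem_supp.1 hw).1
  have hzx := (mem_supp.1 hz).1
  refine ⟨act a k w, h.act_mem_supp hk hw, ?_, hk2 w hwx⟩
  rw [← e1, ← hk1 z hzx]
  exact h.lab_act hk hwx (h.act_mem hm hzx) (e.trans (h1 z hz e1).1.symm)

theorem piecePerm_eq_left {b z : M} (e : lab x B a z = lft x B a b) :
    piecePerm x B a b z = act a (mover x B a b) z := if_pos e

theorem piecePerm_act {b z : M} (hb : b ∈ labels x B a) (hz : z ∈ supp x B a)
    (e : lab x B a z = lft x B a b) (hlr : lft x B a b ≠ rgt x B a b) :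
    piecePerm x B a b (act a (mover x B a b) z) = z := by
  obtain ⟨hm, -, h1⟩ := h.mover_spec hb
  rw [piecePerm, if_neg (by rw [(h1 z hz e).1]; exact hlr.symm)]
  have hzx := (mem_supp.1 hz).1
  exact the_eq (P := fun w => w ∈ x ∧ act a (mover x B a b) w = act a (mover x B a b) z) ⟨hzx, rfl⟩
    fun w hw => h.act_inj hm hw.1 hzx hw.2

theorem rep_mem {b : M} (hb : b ∈ labels x B a) : rep x B a b ∈ orb x B a b := by
  unfold rep
  split_ifs with hfin
  · exact leastOrd_prop (P := fun c => c ∈ orb x B a b) (h.ordSet_orb b b (h.mem_orb_self hb))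
      (h.mem_orb_self hb)
  · exact h.mem_orb_self hb

theorem rep_mem_reps {b : M} (hb : b ∈ labels x B a) : rep x B a b ∈ reps x B a := by
  have h1 := h.rep_mem hb
  refine mem_reps.2 ⟨(mem_orb.1 h1).1, ?_⟩
  have h2 := h.orb_eq h1
  conv_lhs => rw [rep]
  rw [h2]
  split_ifs with hfin
  · rw [rep, if_pos hfin]
  · rfl

/-- The representatives of the labels index pairwise disjoint nontrivial permutations. -/
theorem pieces : Pieces x (reps x B a) (Piece x B a) (piecePerm x B a) := by
  have hJ : ∀ b ∈ reps x B a, b ∈ labels x B a := fun b hb => (mem_reps.1 hb).1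
  refine ⟨fun b _ z hz => (mem_supp.1 hz.1).1, fun b hb z hz => ?_, fun b hb z w hz hw e => ?_,
    fun b hb w hw => ?_, fun b hb => ?_, fun b hb c hc z hz hz' => ?_⟩
  · obtain ⟨hm, -, h1⟩ := h.mover_spec (hJ b hb)
    by_cases e : lab x B a z = lft x B a b
    · rw [h.piecePerm_eq_left e]
      exact ⟨h.act_mem_supp hm hz.1, Or.inr (h1 z hz.1 e).1⟩
    · have e' := hz.2.resolve_left e
      obtain ⟨w, hw, hwl, rfl⟩ := h.exists_of_lab_eq_rgt (hJ b hb) hz.1 e'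
      rw [h.piecePerm_act (hJ b hb) hw hwl (fun e1 => e (e'.trans e1.symm))]
      exact ⟨hw, Or.inl hwl⟩
  · obtain ⟨hm, -, h1⟩ := h.mover_spec (hJ b hb)
    have hzx := (mem_supp.1 hz.1).1
    have hwx := (mem_supp.1 hw.1).1
    by_cases ez : lab x B a z = lft x B a b <;> by_cases ew : lab x B a w = lft x B a b
    · rw [h.piecePerm_eq_left ez, h.piecePerm_eq_left ew] at e
      exact h.act_inj hm hzx hwx e
    · have ew' := hw.2.resolve_left ew
      obtain ⟨v, hv, hvl, rfl⟩ := h.exists_of_lab_eq_rgt (hJ b hb) hw.1 ew'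
      have hlr : lft x B a b ≠ rgt x B a b := fun e1 => ew (ew'.trans e1.symm)
      rw [h.piecePerm_eq_left ez, h.piecePerm_act (hJ b hb) hv hvl hlr] at e
      exact absurd (by rw [← hvl, ← e, (h1 z hz.1 ez).1]) hlr
    · have ez' := hz.2.resolve_left ez
      obtain ⟨v, hv, hvl, rfl⟩ := h.exists_of_lab_eq_rgt (hJ b hb) hz.1 ez'
      have hlr : lft x B a b ≠ rgt x B a b := fun e1 => ez (ez'.trans e1.symm)
      rw [h.piecePerm_eq_left ew, h.piecePerm_act (hJ b hb) hv hvl hlr] at e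
      exact absurd (by rw [← hvl, e, (h1 w hw.1 ew).1]) hlr
    · have ew' := hw.2.resolve_left ew
      obtain ⟨v, hv, hvl, rfl⟩ := h.exists_of_lab_eq_rgt (hJ b hb) hw.1 ew'
      have hlr : lft x B a b ≠ rgt x B a b := fun e1 => ew (ew'.trans e1.symm)
      obtain ⟨v', hv', hvl', rfl⟩ := h.exists_of_lab_eq_rgt (hJ b hb) hz.1 (hz.2.resolve_left ez)
      rw [h.piecePerm_act (hJ b hb) hv hvl hlr, h.piecePerm_act (hJ b hb) hv' hvl' hlr] at e
      rw [e]
  · obtain ⟨hm, -, h1⟩ := h.mover_spec (hJ b hb)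
    by_cases e : lab x B a w = rgt x B a b
    · obtain ⟨z, hz, hzl, rfl⟩ := h.exists_of_lab_eq_rgt (hJ b hb) hw.1 e
      exact ⟨z, ⟨hz, Or.inl hzl⟩, h.piecePerm_eq_left hzl⟩
    · have e' := hw.2.resolve_right e
      refine ⟨act a (mover x B a b) w, ⟨h.act_mem_supp hm hw.1, Or.inr (h1 w hw.1 e').1⟩, ?_⟩
      exact h.piecePerm_act (hJ b hb) hw.1 e' fun e1 => e (e'.trans e1)
  · obtain ⟨hm, ⟨z, hz, hzl⟩, h1⟩ := h.mover_spec (hJ b hb)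
    refine ⟨z, ⟨hz, Or.inl hzl⟩, ?_⟩
    rw [h.piecePerm_eq_left hzl]
    exact (h1 z hz hzl).2
  · -- the pieces lie in the orbits of their indices, so only indices in one orbit can interfere
    have horb : ∀ b ∈ reps x B a, Piece x B a b z → lab x B a z ∈ orb x B a b := by
      rintro b hb ⟨-, e | e⟩ <;> rw [e]
      · exact h.lft_mem (hJ b hb)
      · exact h.rgt_mem (hJ b hb)
    have e : orb x B a b = orb x B a c :=
      (h.orb_eq (horb b hb hz)).symm.trans (h.orb_eq (horb c hc hz'))
    have hb' := (mem_reps.1 hb).2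
    have hc' := (mem_reps.1 hc).2
    by_cases hfin : OFin (orb x B a b)
    · rw [rep, if_pos hfin] at hb'
      rw [rep, if_pos (by rwa [← e]), ← e] at hc'
      exact hb'.symm.trans hc'
    · -- in an infinite orbit, the codes of the attached blocks determine the index
      have hfin' : ¬ OFin (orb x B a c) := by rwa [← e]
      have hO := h.ordSet_orb b
      have henc := isCoding_enc hO hfin
      have hbo := h.mem_orb_self (hJ b hb)
      have hco : c ∈ orb x B a b := by rw [e]; exact h.mem_orb_self (hJ c hc)
      have hbm := henc.1 _ (upair_mem_finSub hO hbo hbo)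
      have hcm := henc.1 _ (upair_mem_finSub hO hco hco)
      have h0m := henc.1 _ (emp_mem_finSub (orb x B a b))
      have hne : ∀ d ∈ orb x B a b, enc (orb x B a b) (upair d d) ≠ enc (orb x B a b) (emp M) := by
        intro d hd e1
        have := henc.2 _ (upair_mem_finSub hO hd hd) _ (emp_mem_finSub _) e1
        exact notMem_emp d (by rw [← this]; simp)
      have hfinal : enc (orb x B a b) (upair b b) = enc (orb x B a b) (upair c c) → b = c :=
        fun e1 => upair_self_inj (henc.2 _ (upair_mem_finSub hO hbo hbo) _
          (upair_mem_finSub hO hco hco) e1)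
      obtain ⟨-, hz⟩ := hz
      obtain ⟨-, hz'⟩ := hz'
      rw [lft, rgt, if_neg hfin, if_neg hfin] at hz
      rw [lft, rgt, if_neg hfin', if_neg hfin', ← e] at hz'
      have h2 : ∀ {s t : M}, s ∈ finSub (orb x B a b) → t ∈ finSub (orb x B a b) →
          lab x B a z = enc (orb x B a b) s → lab x B a z = enc (orb x B a b) t → s = t :=
        fun hs ht e1 e2 => henc.2 _ hs _ ht (e1.symm.trans e2)
      rcases hz with hz | hz <;> rcases hz' with hz' | hz'
      · exact hfinal (upair_self_inj
          (h2 (upair_mem_finSub hO hbm hbm) (upair_mem_finSub hO hcm hcm) hz hz'))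
      · have h3 := h2 (upair_mem_finSub hO hbm hbm) (upair_mem_finSub hO hcm h0m) hz hz'
        have h4 : enc (orb x B a b) (emp M) ∈ upair (enc (orb x B a b) (upair b b))
          (enc (orb x B a b) (upair b b)) := by rw [h3]; simp
        exact (hne b hbo).symm (by simpa using h4) |>.elim
      · have h3 := h2 (upair_mem_finSub hO hbm h0m) (upair_mem_finSub hO hcm hcm) hz hz'
        have h4 : enc (orb x B a b) (emp M) ∈ upair (enc (orb x B a b) (upair c c))
          (enc (orb x B a b) (upair c c)) := by rw [← h3]; simp
        exact (hne c hco).symm (by simpa using h4) |>.elim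
      · have h3 := h2 (upair_mem_finSub hO hbm h0m) (upair_mem_finSub hO hcm h0m) hz hz'
        have h4 : enc (orb x B a b) (upair b b) ∈ upair (enc (orb x B a b) (upair c c))
          (enc (orb x B a b) (emp M)) := by rw [← h3]; simp
        rcases (mem_upair _ _ _).1 h4 with h5 | h5
        · exact hfinal h5
        · exact absurd h5 (hne b hbo)

end PermFamily

/-! ### Gluing and the diagonal permutation -/

/-- The permutation of `x` that acts as `q b` on `{z | D b z}` for `b ∈ T` and fixes all other
points. -/
noncomputable def glue (x T : M) (D : M → M → Prop) (q : M → M → M) : M :=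
  lam x fun z => the fun v => (∃ b ∈ T, D b z ∧ v = q b z) ∨ ((¬ ∃ b ∈ T, D b z) ∧ v = z)

instance dfn_glue {Γ : Type*} [DefSpace M Γ] (t s : Γ → M) (D : Γ → M → M → Prop)
    (q : Γ → M → M → M) [Dfn M t] [Dfn M s] [Dfn M fun p : (Γ × M) × M => D p.1.1 p.1.2 p.2]
    [Dfn M fun p : (Γ × M) × M => q p.1.1 p.1.2 p.2] :
    Dfn M (no_index fun γ => glue (t γ) (s γ) (D γ) (q γ)) := by unfold glue; infer_instance

section Glue
variable {x J : M} {D : M → M → Prop} {q : M → M → M} [Dfn M fun p : M × M => D p.1 p.2]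
  [Dfn M fun p : M × M => q p.1 p.2] (h : Pieces x J D q) {T : M} (hT : ∀ b ∈ T, b ∈ J)
include h hT

theorem Pieces.glue_apply {b z : M} (hb : b ∈ T) (hz : D b z) : app (glue x T D q) z = q b z := by
  rw [glue, app_lam _ (h.sub b (hT b hb) z hz)]
  refine the_eq (P := fun v => (∃ b ∈ T, D b z ∧ v = q b z) ∨ ((¬ ∃ b ∈ T, D b z) ∧ v = z))
    (Or.inl ⟨b, hb, hz, rfl⟩) ?_
  rintro v (⟨c, hc, hcz, rfl⟩ | ⟨hn, -⟩)
  · rw [h.disj c (hT c hc) b (hT b hb) z hcz hz]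
  · exact absurd ⟨b, hb, hz⟩ hn

theorem Pieces.glue_apply_of_not {z : M} (hzx : z ∈ x) (hz : ¬ ∃ b ∈ T, D b z) :
    app (glue x T D q) z = z := by
  rw [glue, app_lam _ hzx]
  refine the_eq (P := fun v => (∃ b ∈ T, D b z ∧ v = q b z) ∨ ((¬ ∃ b ∈ T, D b z) ∧ v = z))
    (Or.inr ⟨hz, rfl⟩) ?_
  rintro v (⟨c, hc, hcz, rfl⟩ | ⟨-, rfl⟩)
  · exact absurd ⟨c, hc, hcz⟩ hz
  · rfl

theorem Pieces.isPermutation_glue : IsPermutation (glue x T D q) x := by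
  have hmem : ∀ z ∈ x, app (glue x T D q) z ∈ x := by
    intro z hz
    by_cases hex : ∃ b ∈ T, D b z
    · obtain ⟨b, hb, hbz⟩ := hex
      rw [h.glue_apply hT hb hbz]
      exact h.sub b (hT b hb) _ (h.maps b (hT b hb) z hbz)
    · rwa [h.glue_apply_of_not hT hz hex]
  rw [isPermutation_iff, isFunction_iff]
  refine ⟨⟨lam_congr fun z hz => ?_, hmem⟩, ?_, ?_⟩
  · exact (app_lam (x := x) (fun z => the fun v =>
      (∃ b ∈ T, D b z ∧ v = q b z) ∨ ((¬ ∃ b ∈ T, D b z) ∧ v = z)) hz).symm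
  · intro z hz w hw e
    by_cases hexz : ∃ b ∈ T, D b z <;> by_cases hexw : ∃ b ∈ T, D b w
    · obtain ⟨b, hb, hbz⟩ := hexz
      obtain ⟨c, hc, hcw⟩ := hexw
      rw [h.glue_apply hT hb hbz, h.glue_apply hT hc hcw] at e
      have hbc := h.disj b (hT b hb) c (hT c hc) _ (h.maps b (hT b hb) z hbz)
        (by rw [e]; exact h.maps c (hT c hc) w hcw)
      subst hbc
      exact h.inj b (hT b hb) z w hbz hcw e
    · obtain ⟨b, hb, hbz⟩ := hexz
      rw [h.glue_apply hT hb hbz, h.glue_apply_of_not hT hw hexw] at e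
      exact absurd ⟨b, hb, e ▸ h.maps b (hT b hb) z hbz⟩ hexw
    · obtain ⟨b, hb, hbw⟩ := hexw
      rw [h.glue_apply hT hb hbw, h.glue_apply_of_not hT hz hexz] at e
      exact absurd ⟨b, hb, e ▸ h.maps b (hT b hb) w hbw⟩ hexz
    · rwa [h.glue_apply_of_not hT hz hexz, h.glue_apply_of_not hT hw hexw] at e
  · intro w hw
    by_cases hexw : ∃ b ∈ T, D b w
    · obtain ⟨b, hb, hbw⟩ := hexw
      obtain ⟨z, hz, e⟩ := h.surj b (hT b hb) w hbw
      exact ⟨z, h.sub b (hT b hb) z hz, by rw [h.glue_apply hT hb hz, e]⟩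
    · exact ⟨w, hw, (h.glue_apply_of_not hT hw hexw).symm⟩

end Glue

/-- The code in `J` of the ordered pair of `u` and `v`, modelled on Kuratowski pairs. -/
noncomputable def pairCode (J u v : M) : M := enc J (upair (enc J (upair u u)) (enc J (upair u v)))

/-- `h` agrees with `q b` on `{z | D b z}`. -/
def Agrees (x : M) (D : M → M → Prop) (q : M → M → M) (h b : M) : Prop :=
  ∀ z ∈ x, D b z → app h z = q b z

/-- The least `i ∈ J` such that no `a j` with `phi j = u` singles out `i`, in the sense that `i` is
the only `v ∈ J` for which `a j` agrees with the permutation indexed by the pair `(u, v)`. -/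
noncomputable def diagVal (x J a : M) (phi : M → M) (D : M → M → Prop) (q : M → M → M)
    (u : M) : M :=
  leastOrd fun i => i ∈ J ∧ ∀ j ∈ dom a, phi j = u →
    ¬ ∀ v ∈ J, Agrees x D q (app a j) (pairCode J u v) ↔ v = i

/-- The permutation glued from the pieces indexed by the pairs `(u, diagVal u)` with `u ∈ J`. -/
noncomputable def diagPerm (x J a : M) (phi : M → M) (D : M → M → Prop) (q : M → M → M) : M :=
  glue x (image J fun u => pairCode J u (diagVal x J a phi D q u)) D q

section
variable {Γ : Type*} [DefSpace M Γ] (t s r w : Γ → M) [Dfn M t] [Dfn M s] [Dfn M r] [Dfn M w]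
  (D : Γ → M → M → Prop) (q : Γ → M → M → M) [Dfn M fun p : (Γ × M) × M => D p.1.1 p.1.2 p.2]
    [Dfn M fun p : (Γ × M) × M => q p.1.1 p.1.2 p.2] (phi : Γ → M → M)
    [Dfn M fun p : Γ × M => phi p.1 p.2]
instance dfn_pairCode : Dfn M (no_index fun γ => pairCode (t γ) (s γ) (r γ)) := by
  unfold pairCode; infer_instance
instance dfn_agrees : Dfn M (no_index fun γ => Agrees (t γ) (D γ) (q γ) (s γ) (r γ)) := by
  unfold Agrees; infer_instance
instance dfn_diagVal :
    Dfn M (no_index fun γ => diagVal (t γ) (s γ) (r γ) (phi γ) (D γ) (q γ) (w γ)) := by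
  unfold diagVal; infer_instance
instance dfn_diagPerm :
    Dfn M (no_index fun γ => diagPerm (t γ) (s γ) (r γ) (phi γ) (D γ) (q γ)) := by
  unfold diagPerm; infer_instance
end

theorem pairCode_mem {J u v : M} (hJ : OrdSet J) (hinf : ¬ OFin J) (hu : u ∈ J) (hv : v ∈ J) :
    pairCode J u v ∈ J :=
  have h := isCoding_enc hJ hinf
  h.1 _ (upair_mem_finSub hJ (h.1 _ (upair_mem_finSub hJ hu hu))
    (h.1 _ (upair_mem_finSub hJ hu hv)))

theorem pairCode_inj {J u v u' v' : M} (hJ : OrdSet J) (hinf : ¬ OFin J) (hu : u ∈ J) (hv : v ∈ J)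
    (hu' : u' ∈ J) (hv' : v' ∈ J) (e : pairCode J u v = pairCode J u' v') : u = u' ∧ v = v' := by
  have h := isCoding_enc hJ hinf
  have m1 := upair_mem_finSub hJ hu hu
  have m2 := upair_mem_finSub hJ hu hv
  have m1' := upair_mem_finSub hJ hu' hu'
  have m2' := upair_mem_finSub hJ hu' hv'
  have e1 := h.2 _ (upair_mem_finSub hJ (h.1 _ m1) (h.1 _ m2)) _
    (upair_mem_finSub hJ (h.1 _ m1') (h.1 _ m2')) e
  refine opair_inj.1 (ext fun z => ?_)
  have key : ∀ {u v u' v' : M}, upair u u ∈ finSub J → upair u v ∈ finSub J →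
      upair u' u' ∈ finSub J → upair u' v' ∈ finSub J →
      upair (enc J (upair u u)) (enc J (upair u v)) =
        upair (enc J (upair u' u')) (enc J (upair u' v')) → z ∈ opair u v → z ∈ opair u' v' := by
    intro u v u' v' m1 m2 m1' m2' e1 hz
    have hzf : z ∈ finSub J := by
      rcases (mem_upair _ _ _).1 hz with rfl | rfl <;> assumption
    have : enc J z ∈ upair (enc J (upair u' u')) (enc J (upair u' v')) := by
      rw [← e1]
      rcases (mem_upair _ _ _).1 hz with rfl | rfl <;> simp
    refine (mem_upair _ _ _).2 (((mem_upair _ _ _).1 this).imp (fun e => h.2 _ hzf _ m1' e)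
      fun e => h.2 _ hzf _ m2' e)
  exact ⟨key m1 m2 m1' m2' e1, key m1' m2' m1 m2 e1.symm⟩

/-- Diagonalization. If `phi` maps the indices of the family `a` to `J` with finite fibres, then the
diagonal permutation is not in the family: it singles out `diagVal u` for every `u ∈ J`, whereas
`a j` does not single out `diagVal (phi j)`. The value `diagVal u` exists because every permutation
singles out at most one element of the infinite set `J`, and only finitely many `a j` have
`phi j = u`. -/
theorem Pieces.diagPerm_spec {x J a : M} {D : M → M → Prop} {q : M → M → M}
    [Dfn M fun p : M × M => D p.1 p.2] [Dfn M fun p : M × M => q p.1 p.2] (h : Pieces x J D q)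
    (hJ : OrdSet J) (hinf : ¬ OFin J) (ha : OrdSet (dom a)) (phi : M → M) [Dfn M phi]
    (hphi : ∀ j ∈ dom a, phi j ∈ J) (hfib : ∀ u ∈ J, OFin (sep (dom a) fun j => phi j = u)) :
    IsPermutation (diagPerm x J a phi D q) x ∧ ∀ j ∈ dom a, app a j ≠ diagPerm x J a phi D q := by
  have hval : ∀ u ∈ J, diagVal x J a phi D q u ∈ J ∧ ∀ j ∈ dom a, phi j = u →
      ¬ ∀ v ∈ J, Agrees x D q (app a j) (pairCode J u v) ↔ v = diagVal x J a phi D q u := by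
    intro u hu
    have hex : ∃ i ∈ J, ∀ j ∈ dom a, phi j = u →
        ¬ ∀ v ∈ J, Agrees x D q (app a j) (pairCode J u v) ↔ v = i := by
      by_contra hn
      push Not at hn
      let g : M → M := fun i => leastOrd fun j => j ∈ dom a ∧ phi j = u ∧
        ∀ v ∈ J, Agrees x D q (app a j) (pairCode J u v) ↔ v = i
      have hg : Dfn M g := by unfold g; infer_instance
      have hgs : ∀ i ∈ J, g i ∈ dom a ∧ phi (g i) = u ∧
          ∀ v ∈ J, Agrees x D q (app a (g i)) (pairCode J u v) ↔ v = i := by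
        intro i hi
        obtain ⟨j, hj, hj'⟩ := hn i hi
        exact leastOrd_prop (P := fun j => j ∈ dom a ∧ phi j = u ∧
          ∀ v ∈ J, Agrees x D q (app a j) (pairCode J u v) ↔ v = i) (ha j hj) ⟨hj, hj'⟩
      refine hinf (oFin_of_injOn hJ g (Y := sep (dom a) fun j => phi j = u)
        (fun i hi => (mem_sep _ _ _).2 ⟨(hgs i hi).1, (hgs i hi).2.1⟩) (fun i hi i' hi' e => ?_)
        ((hfib u hu).dedekindFinite (ha.mono fun j hj => ((mem_sep _ _ _).1 hj).1)))
      have h1 := ((hgs i hi).2.2 i hi).2 rfl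
      rw [e] at h1
      exact ((hgs i' hi').2.2 i hi).1 h1
    obtain ⟨i, hi, hi'⟩ := hex
    exact leastOrd_prop (P := fun i => i ∈ J ∧ ∀ j ∈ dom a, phi j = u →
      ¬ ∀ v ∈ J, Agrees x D q (app a j) (pairCode J u v) ↔ v = i) (hJ i hi) ⟨hi, hi'⟩
  have hT : ∀ b ∈ image J (fun u => pairCode J u (diagVal x J a phi D q u)), b ∈ J :=
    image_subset _ fun u hu => pairCode_mem hJ hinf hu (hval u hu).1
  refine ⟨h.isPermutation_glue hT, fun j hj e => ?_⟩
  have hu := hphi j hj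
  refine (hval _ hu).2 j hj rfl fun v hv => ?_
  rw [e]
  have hpv := pairCode_mem hJ hinf hu hv
  constructor
  · intro hagr
    obtain ⟨z, hz, hne⟩ := h.moves _ hpv
    have h1 := hagr z (h.sub _ hpv z hz) hz
    by_contra hvne
    rw [diagPerm, h.glue_apply_of_not hT (h.sub _ hpv z hz)] at h1
    · exact hne h1.symm
    · rintro ⟨b, hb, hbz⟩
      have hbJ := hT b hb
      obtain ⟨u, huJ, rfl⟩ := (mem_image _ _ _).1 hb
      obtain ⟨rfl, e2⟩ := pairCode_inj hJ hinf hu hv huJ (hval u huJ).1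
        (h.disj _ hpv _ hbJ z hz hbz)
      exact hvne e2
  · rintro rfl z _ hDz
    exact h.glue_apply hT ((mem_image _ _ _).2 ⟨_, hu, rfl⟩) hDz

end Pieces

/-! ### Prolonging a sequence of permutations -/

section Recursion
variable {M : Type*} [Membership M M] [ZF M]

/-- The indices of those members of the family `a` that belong to `P`. -/
noncomputable def idxOf (P a : M) : M := sep (dom a) fun i => app a i ∈ P

/-- The set of representatives of the labels of the blocks that meet the set of points moved by
`h`. -/
noncomputable def repSet (x B a h : M) : M := image (image (moved x h) (lab x B a)) (rep x B a)

/-- The diagonal permutation for the family `a`, formed with the group of those members of `a` that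
lie in `P`. The `j`-th member is assigned the code of the set of representatives met by its image
under `u`. -/
noncomputable def diagNew (x P : M) (u : M → M) (a : M) : M :=
  diagPerm x (reps x (idxOf P a) a) a
    (fun j => enc (reps x (idxOf P a) a) (repSet x (idxOf P a) a (u (app a j))))
    (Piece x (idxOf P a) a) (piecePerm x (idxOf P a) a)

/-- `h ∘ k⁻¹` -/
noncomputable def quotPerm (x h k : M) : M :=
  lam x fun z => app h (the fun w => w ∈ x ∧ app k w = z)

/-- The quotient of the `i`-th by the `j`-th member is not in the family. -/
def QuotMissing (x a i j : M) : Prop :=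
  i ∈ dom a ∧ j ∈ dom a ∧ ∀ k ∈ dom a, quotPerm x (app a i) (app a j) ≠ app a k

/-- The image under `u` of the `i`-th member is not in the family. -/
def ImageMissing (u : M → M) (a i : M) : Prop :=
  i ∈ dom a ∧ ∀ k ∈ dom a, u (app a i) ≠ app a k

open Classical in
/-- A permutation outside the family `a`: the first missing quotient of two members, if there is
one, else the first missing image of a member under `u`, else the diagonal permutation. -/
noncomputable def newPerm (x P : M) (u : M → M) (a : M) : M :=
  if ∃ i, ∃ j, QuotMissing x a i j then
    quotPerm x (app a (leastOrd fun i => ∃ j, QuotMissing x a i j))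
      (app a (leastOrd fun j => QuotMissing x a (leastOrd fun i => ∃ j, QuotMissing x a i j) j))
  else if ∃ i, ImageMissing u a i then u (app a (leastOrd (ImageMissing u a)))
  else diagNew x P u a

section
variable {Γ : Type*} [DefSpace M Γ] (t s r w : Γ → M) [Dfn M t] [Dfn M s] [Dfn M r] [Dfn M w]
  (u : M → M) [Dfn M u]
instance dfn_idxOf : Dfn M (no_index fun γ => idxOf (t γ) (s γ)) := by unfold idxOf; infer_instance
instance dfn_repSet : Dfn M (no_index fun γ => repSet (t γ) (s γ) (r γ) (w γ)) := by
  unfold repSet; infer_instance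
instance dfn_diagNew : Dfn M (no_index fun γ => diagNew (t γ) (s γ) u (r γ)) := by
  unfold diagNew; infer_instance
instance dfn_quotPerm : Dfn M (no_index fun γ => quotPerm (t γ) (s γ) (r γ)) := by
  unfold quotPerm; infer_instance
instance dfn_quotMissing : Dfn M (no_index fun γ => QuotMissing (t γ) (s γ) (r γ) (w γ)) := by
  unfold QuotMissing; infer_instance
instance dfn_imageMissing : Dfn M (no_index fun γ => ImageMissing u (t γ) (s γ)) := by
  unfold ImageMissing; infer_instance
instance dfn_newPerm : Dfn M (no_index fun γ => newPerm (t γ) (s γ) u (r γ)) := by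
  unfold newPerm; infer_instance
end

theorem quotPerm_spec {x h k : M} (hh : IsPermutation h x) (hk : IsPermutation k x) :
    IsPermutation (quotPerm x h k) x ∧ ∀ z ∈ x, app (quotPerm x h k) (app k z) = app h z := by
  obtain ⟨hf, hinj, hsurj⟩ := isPermutation_iff.1 hh
  obtain ⟨kf, kinj, ksurj⟩ := isPermutation_iff.1 hk
  have h1 : ∀ z ∈ x, app (quotPerm x h k) (app k z) = app h z := by
    intro z hz
    rw [quotPerm, app_lam _ (kf.app_mem hz)]
    congr 1
    exact the_eq (P := fun w => w ∈ x ∧ app k w = app k z) ⟨hz, rfl⟩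
      fun w hw => kinj w hw.1 z hz hw.2
  refine ⟨isPermutation_iff.2 ⟨?_, ?_, ?_⟩, h1⟩
  · refine isFunction_lam fun z hz => hf.app_mem ?_
    obtain ⟨w, hw, e⟩ := ksurj z hz
    exact (the_spec (P := fun w => w ∈ x ∧ app k w = z) ⟨hw, e.symm⟩
      fun v hv => kinj v hv.1 w hw (hv.2.trans e)).1
  · intro z hz w hw e
    obtain ⟨v, hv, rfl⟩ := ksurj z hz
    obtain ⟨v', hv', rfl⟩ := ksurj w hw
    rw [h1 v hv, h1 v' hv'] at e
    rw [hinj v hv v' hv' e]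
  · intro w hw
    obtain ⟨z, hz, rfl⟩ := hsurj w hw
    exact ⟨_, kf.app_mem hz, (h1 z hz).symm⟩

section
variable {x S P : M} (hS : ∀ h, h ∈ S ↔ IsPermutation h x)
  (hP : ∀ h, h ∈ P ↔ IsPermutation h x ∧ PowerDedekindFinite (moved x h))
  (u : M → M) [Dfn M u] (hu : ∀ h ∈ S, u h ∈ P)
  (hfib : ∀ y ∈ P, DedekindFinite (sep S fun h => u h = y))

/-- `a` is an injective sequence in `S` whose length is an infinite ordinal. -/
structure PermSeq (S a : M) : Prop where
  ord : Ord (dom a)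
  inf : ¬ OFin (dom a)
  mem : ∀ i ∈ dom a, app a i ∈ S
  inj : ∀ i ∈ dom a, ∀ j ∈ dom a, app a i = app a j → i = j

include hu hfib in
/-- If `u` maps the members with index in `T` to members with index in a finite set, then `T` is
finite, since the fibres of `u` are Dedekind finite. -/
theorem PermSeq.oFin_of_index {a K T : M} (ha : PermSeq S a) (hK : OrdSet K) (hfin : OFin K)
    (hT : ∀ i ∈ T, i ∈ dom a) (h : ∀ i ∈ T, ∃ k ∈ K, u (app a i) = app a k) : OFin T := by
  by_contra hinf
  have hTO : OrdSet T := ha.ord.ordSet.mono hT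
  have hk : ∀ i ∈ T, leastOrd (fun k => k ∈ K ∧ u (app a i) = app a k) ∈ K ∧
      u (app a i) = app a (leastOrd fun k => k ∈ K ∧ u (app a i) = app a k) := fun i hi => by
    obtain ⟨k, hkK, e⟩ := h i hi
    exact leastOrd_prop (P := fun k => k ∈ K ∧ u (app a i) = app a k) (hK k hkK) ⟨hkK, e⟩
  obtain ⟨k, -, hk'⟩ := exists_fibre_not_oFin hTO hinf
    (fun i => leastOrd fun k => k ∈ K ∧ u (app a i) = app a k) (fun i hi => (hk i hi).1)
    (hfin.dedekindFinite hK)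
  refine hk' ?_
  have key : ∀ i ∈ sep T (fun i => leastOrd (fun k => k ∈ K ∧ u (app a i) = app a k) = k),
      i ∈ dom a ∧ u (app a i) = app a k := by
    intro i hi
    obtain ⟨hi, e⟩ := (mem_sep _ _ _).1 hi
    refine ⟨hT i hi, ?_⟩
    rw [← e]; exact (hk i hi).2
  by_cases hex : ∃ i, i ∈ sep T (fun i => leastOrd (fun k => k ∈ K ∧ u (app a i) = app a k) = k)
  · obtain ⟨i, hi⟩ := hex
    refine oFin_of_injOn (hTO.mono fun z hz => ((mem_sep _ _ _).1 hz).1) (app a)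
      (Y := sep S fun h => u h = app a k)
      (fun j hj => (mem_sep _ _ _).2 ⟨ha.mem j (key j hj).1, (key j hj).2⟩)
      (fun j hj l hl e => ha.inj j (key j hj).1 l (key l hl).1 e) (hfib _ ?_)
    rw [← (key i hi).2]
    exact hu _ (ha.mem i (key i hi).1)
  · exact oFin_of_subsingleton fun i hi => absurd ⟨i, hi⟩ hex

theorem mem_idxOf {P a i : M} : i ∈ idxOf P a ↔ i ∈ dom a ∧ app a i ∈ P := mem_sep _ _ _

include hS hP hu hfib in
/-- If a sequence is closed under quotients and under `u`, its members in `P` form an infinite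
group. -/
theorem PermSeq.permFamily {a : M} (ha : PermSeq S a)
    (hquot : ∀ i ∈ dom a, ∀ j ∈ dom a, ∃ k ∈ dom a, quotPerm x (app a i) (app a j) = app a k)
    (himg : ∀ i ∈ dom a, ∃ k ∈ dom a, u (app a i) = app a k) :
    PermFamily x (idxOf P a) a where
  ord := ha.ord.ordSet.mono fun _ hi => (mem_idxOf.1 hi).1
  inf := fun hfin => ha.inf <| ha.oFin_of_index u hu hfib
    (ha.ord.ordSet.mono fun _ hi => (mem_idxOf.1 hi).1) hfin (fun _ h => h) fun i hi => by
      obtain ⟨k, hk, e⟩ := himg i hi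
      exact ⟨k, mem_idxOf.2 ⟨hk, e ▸ hu _ (ha.mem i hi)⟩, e⟩
  perm := fun i hi => (hS _).1 (ha.mem i (mem_idxOf.1 hi).1)
  inj := fun i hi j hj => ha.inj i (mem_idxOf.1 hi).1 j (mem_idxOf.1 hj).1
  pdf := fun i hi => ((hP _).1 (mem_idxOf.1 hi).2).2
  closed := fun i hi j hj => by
    obtain ⟨hi, hiP⟩ := mem_idxOf.1 hi
    obtain ⟨hj, hjP⟩ := mem_idxOf.1 hj
    obtain ⟨k, hk, e⟩ := hquot i hi j hj
    obtain ⟨h1, h2⟩ := quotPerm_spec ((hS _).1 (ha.mem i hi)) ((hS _).1 (ha.mem j hj))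
    rw [e] at h1 h2
    refine ⟨k, mem_idxOf.2 ⟨hk, (hP _).2 ⟨h1, ?_⟩⟩, h2⟩
    refine ((hP _).1 hiP).2.union ((hP _).1 hjP).2 fun z hz => ?_
    obtain ⟨hzx, hz⟩ := mem_moved.1 hz
    by_cases hjz : app (app a j) z = z
    · refine Or.inl (mem_moved.2 ⟨hzx, ?_⟩)
      rwa [← h2 z hzx, hjz]
    · exact Or.inr (mem_moved.2 ⟨hzx, hjz⟩)

/-- The set `repSet` is finite because a power Dedekind finite set meets finitely many blocks. -/
theorem PermFamily.repSet_mem {B a h : M} (hB : PermFamily x B a)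
    (hm : PowerDedekindFinite (moved x h)) (hsub : ∀ z ∈ moved x h, z ∈ supp x B a) :
    repSet x B a h ∈ finSub (reps x B a) := by
  have hlab : ∀ b ∈ image (moved x h) (lab x B a), b ∈ labels x B a := by
    intro b hb
    obtain ⟨z, hz, rfl⟩ := (mem_image _ _ _).1 hb
    exact mem_labels.2 ⟨z, hsub z hz, rfl⟩
  refine mem_finSub.2 ⟨image_subset _ fun b hb => hB.rep_mem_reps (hlab b hb), ?_⟩
  refine oFin_image (hB.ordSet_labels.mono hlab) (hB.oFin_image_lab hm) _ fun b hb => ?_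
  exact hB.ordSet_labels _ (mem_reps.1 (hB.rep_mem_reps (hlab b hb))).1

/-- Only finitely many members of the group meet no representatives outside a finite set `s`. Indeed
each representative stands for finitely many labels, so the points moved by these members lie in
finitely many blocks. Every block is contained in the set of points moved by some member, so the
union of these blocks is power Dedekind finite, and `oFin_of_moved_subset` applies. -/
theorem PermFamily.oFin_of_repSet_subset {B a s : M} (hB : PermFamily x B a)
    (hs : s ∈ finSub (reps x B a)) :
    OFin (sep B fun k => ∀ b ∈ repSet x B a (app a k), b ∈ s) := by
  obtain ⟨hsJ, hsfin⟩ := mem_finSub.1 hs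
  have hJ : ∀ b ∈ s, b ∈ labels x B a := fun b hb => (mem_reps.1 (hsJ b hb)).1
  have hL := hB.ordSet_labels
  have hfibre : ∀ c ∈ s, OFin (sep (labels x B a) fun b => rep x B a b = c) := by
    intro c hc
    by_cases hfin : OFin (orb x B a c)
    · refine hfin.mono fun b hb => ?_
      obtain ⟨hb', rfl⟩ := (mem_sep _ _ _).1 hb
      rw [hB.orb_eq (hB.rep_mem hb')]
      exact hB.mem_orb_self hb'
    · refine oFin_of_subsingleton ?_
      have key : ∀ b ∈ sep (labels x B a) (fun b => rep x B a b = c), b = c := by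
        intro b hb
        obtain ⟨hb', rfl⟩ := (mem_sep _ _ _).1 hb
        rw [hB.orb_eq (hB.rep_mem hb')] at hfin
        rw [rep, if_neg hfin]
      exact fun b hb b' hb' => (key b hb).trans (key b' hb').symm
  -- the labels represented in `s`, and the union of their blocks
  have hW : OFin (sep (labels x B a) fun b => rep x B a b ∈ s) :=
    oFin_biUnion (hL.mono hJ) hsfin (hL.mono fun b hb => ((mem_sep _ _ _).1 hb).1)
      (fun c => sep (labels x B a) fun b => rep x B a b = c) hfibre fun b hb => by
        obtain ⟨hb, hbs⟩ := (mem_sep _ _ _).1 hb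
        exact ⟨_, hbs, (mem_sep _ _ _).2 ⟨hb, rfl⟩⟩
  have hpdf : PowerDedekindFinite (sep (supp x B a) fun z => rep x B a (lab x B a z) ∈ s) := by
    refine powerDedekindFinite_biUnion (hL.mono fun b hb => ((mem_sep _ _ _).1 hb).1) hW
      (fun b => sep (supp x B a) fun z => lab x B a z = b) (fun b hb => ?_) fun z hz => ?_
    · obtain ⟨z, hz, rfl⟩ := mem_labels.1 ((mem_sep _ _ _).1 hb).1
      obtain ⟨hzx, i, hi, hiz⟩ := mem_supp.1 hz
      refine (hB.pdf i hi).mono fun w hw => ?_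
      obtain ⟨hw, e⟩ := (mem_sep _ _ _).1 hw
      have hwx := (mem_supp.1 hw).1
      exact mem_moved.2 ⟨hwx, ((hB.lab_eq_iff hwx hzx).1 e i hi).2 hiz⟩
    · obtain ⟨hz, hzs⟩ := (mem_sep _ _ _).1 hz
      exact ⟨_, (mem_sep _ _ _).2 ⟨mem_labels.2 ⟨z, hz, rfl⟩, hzs⟩, (mem_sep _ _ _).2 ⟨hz, rfl⟩⟩
  refine (hB.oFin_of_moved_subset hpdf fun z hz => (mem_supp.1 ((mem_sep _ _ _).1 hz).1).1).mono ?_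
  intro k hk
  obtain ⟨hkB, hk⟩ := (mem_sep _ _ _).1 hk
  refine (mem_sep _ _ _).2 ⟨hkB, fun z hz hkz => (mem_sep _ _ _).2
    ⟨mem_supp.2 ⟨hz, k, hkB, hkz⟩, hk _ ?_⟩⟩
  exact (mem_image _ _ _).2 ⟨_, (mem_image _ _ _).2 ⟨z, mem_moved.2 ⟨hz, hkz⟩, rfl⟩, rfl⟩

include hS hP hu hfib in
/-- In a sequence closed under quotients and under `u`, only finitely many members are assigned the
same set of representatives; so there are infinitely many representatives, and the diagonal
construction applies. -/
theorem PermSeq.diagNew_spec {a : M} (ha : PermSeq S a)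
    (hquot : ∀ i ∈ dom a, ∀ j ∈ dom a, ∃ k ∈ dom a, quotPerm x (app a i) (app a j) = app a k)
    (himg : ∀ i ∈ dom a, ∃ k ∈ dom a, u (app a i) = app a k) :
    IsPermutation (diagNew x P u a) x ∧ ∀ i ∈ dom a, app a i ≠ diagNew x P u a := by
  have hB := ha.permFamily hS hP u hu hfib hquot himg
  rw [diagNew]
  generalize hBdef : idxOf P a = B at hB
  have hidx : ∀ i ∈ dom a, ∃ k ∈ B, u (app a i) = app a k := fun i hi => by
    obtain ⟨k, hk, e⟩ := himg i hi
    exact ⟨k, hBdef ▸ mem_idxOf.2 ⟨hk, e ▸ hu _ (ha.mem i hi)⟩, e⟩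
  have hJ : OrdSet (reps x B a) := hB.ordSet_labels.mono fun b hb => (mem_reps.1 hb).1
  have hrep : ∀ i ∈ dom a, repSet x B a (u (app a i)) ∈ finSub (reps x B a) := by
    intro i hi
    obtain ⟨k, hk, e⟩ := hidx i hi
    refine hB.repSet_mem ((hP _).1 (hu _ (ha.mem i hi))).2 fun z hz => ?_
    obtain ⟨hz, hz'⟩ := mem_moved.1 hz
    rw [e] at hz'
    exact mem_supp.2 ⟨hz, k, hk, hz'⟩
  have hfibre : ∀ s, OFin (sep (dom a) fun i => repSet x B a (u (app a i)) = s) := by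
    intro s
    by_cases hex : ∃ i, i ∈ sep (dom a) fun i => repSet x B a (u (app a i)) = s
    · obtain ⟨i, hi⟩ := hex
      obtain ⟨hi', rfl⟩ := (mem_sep _ _ _).1 hi
      refine ha.oFin_of_index u hu hfib (hB.ord.mono fun k hk => ((mem_sep _ _ _).1 hk).1)
        (hB.oFin_of_repSet_subset (hrep i hi')) (fun j hj => ((mem_sep _ _ _).1 hj).1)
        fun j hj => ?_
      obtain ⟨hj, e⟩ := (mem_sep _ _ _).1 hj
      obtain ⟨k, hk, e'⟩ := hidx j hj
      refine ⟨k, (mem_sep _ _ _).2 ⟨hk, ?_⟩, e'⟩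
      rw [← e', e]
      exact fun b hb => hb
    · exact oFin_of_subsingleton fun i hi => absurd ⟨i, hi⟩ hex
  have hinf : ¬ OFin (reps x B a) := by
    intro hfin
    obtain ⟨s, -, hs⟩ := exists_fibre_not_oFin ha.ord.ordSet ha.inf
      (fun i => repSet x B a (u (app a i)))
      (fun i hi => (mem_pow _ _).2 (mem_finSub.1 (hrep i hi)).1)
      (powerDedekindFinite_iff.1 (hfin.powerDedekindFinite hJ))
    exact hs (hfibre s)
  have henc := isCoding_enc hJ hinf
  refine hB.pieces.diagPerm_spec hJ hinf ha.ord.ordSet _ (fun j hj => henc.1 _ (hrep j hj))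
    fun v hv => ?_
  by_cases hex : ∃ i ∈ dom a, enc (reps x B a) (repSet x B a (u (app a i))) = v
  · obtain ⟨i, hi, rfl⟩ := hex
    refine (hfibre (repSet x B a (u (app a i)))).mono fun j hj => ?_
    obtain ⟨hj, e⟩ := (mem_sep _ _ _).1 hj
    exact (mem_sep _ _ _).2 ⟨hj, henc.2 _ (hrep j hj) _ (hrep i hi) e⟩
  · refine oFin_of_subsingleton fun i hi => ?_
    exact absurd ⟨i, (mem_sep _ _ _).1 hi⟩ hex

include hS hP hu hfib in
theorem PermSeq.newPerm_spec {a : M} (ha : PermSeq S a) :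
    newPerm x P u a ∈ S ∧ ∀ i ∈ dom a, app a i ≠ newPerm x P u a := by
  rw [newPerm]
  split_ifs with h1 h2
  · obtain ⟨i, j, hij⟩ := h1
    have h3 := leastOrd_prop (P := fun i => ∃ j, QuotMissing x a i j) (ha.ord.mem hij.1) ⟨j, hij⟩
    generalize leastOrd (fun i => ∃ j, QuotMissing x a i j) = i at h3
    obtain ⟨j, hj⟩ := h3
    have h4 := leastOrd_prop (P := fun j => QuotMissing x a i j) (ha.ord.mem hj.2.1) hj
    generalize leastOrd (fun j => QuotMissing x a i j) = j at h4
    obtain ⟨hi, hj, hk⟩ := h4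
    exact ⟨(hS _).2 (quotPerm_spec ((hS _).1 (ha.mem i hi)) ((hS _).1 (ha.mem j hj))).1,
      fun k hk' e => hk k hk' e.symm⟩
  · obtain ⟨i, hi⟩ := h2
    have h3 := leastOrd_prop (P := fun i => ImageMissing u a i) (ha.ord.mem hi.1) hi
    change ImageMissing u a (leastOrd (ImageMissing u a)) at h3
    exact ⟨(hS _).2 ((hP _).1 (hu _ (ha.mem _ h3.1))).1, fun k hk e => h3.2 k hk e.symm⟩
  · simp only [QuotMissing, ImageMissing] at h1 h2
    push Not at h1 h2
    obtain ⟨h3, h4⟩ := ha.diagNew_spec hS hP u hu hfib (fun i hi j hj => h1 i j hi hj) h2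
    exact ⟨(hS _).2 h3, h4⟩

include hS hP hu hfib in
/-- If a definable map from `𝒮(x)` to `𝒮_pdf(x)` has Dedekind finite fibres, then `𝒮(x)` is Dedekind
finite: an `ω`-sequence of permutations could be prolonged to an injection of all ordinals into
`𝒮(x)`. -/
theorem not_dedekindInfinite_sym : ¬ DedekindInfinite S := by
  classical
  intro hinf
  rw [dedekindInfinite_iff] at hinf
  obtain ⟨g, hg⟩ := hinf
  obtain ⟨hg, hg'⟩ := isInjection_iff.1 hg
  let G : M → M → M := fun b f => if b ∈ om M then app g b else newPerm x P u f
  have hG : Dfn M fun p : M × M => G p.1 p.2 := by unfold G; infer_instance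
  have hF : ∀ b, Ord b → recF G b = if b ∈ om M then app g b else newPerm x P u (lam b (recF G)) :=
    fun b hb => recF_eq G hb
  have key : ∀ b, Ord b → recF G b ∈ S ∧ ∀ c ∈ b, recF G c ≠ recF G b := by
    refine Ord.induction fun b hb ih => ?_
    by_cases hbom : b ∈ om M
    · rw [hF b hb, if_pos hbom]
      refine ⟨hg.app_mem hbom, fun c hc => ?_⟩
      have hcom := ord_om.trans hbom hc
      rw [hF c (hb.mem hc), if_pos hcom]
      intro e
      rw [hg' c hcom b hbom e] at hc
      exact mem_irrefl _ hc
    · have hseq : PermSeq S (lam b (recF G)) := by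
        constructor
        · rwa [dom_lam]
        · rw [dom_lam]
          refine fun hfin => not_oFin_om (hfin.mono fun z hz => ?_)
          rcases ord_om.trichotomy hb with h | rfl | h
          · exact hb.trans h hz
          · exact hz
          · exact absurd h hbom
        · rw [dom_lam]
          intro i hi
          rw [app_lam _ hi]
          exact (ih i hi).1
        · rw [dom_lam]
          intro i hi j hj e
          rw [app_lam _ hi, app_lam _ hj] at e
          exact (hb.mem hi).eq_of_notMem (hb.mem hj) (fun h => (ih j hj).2 i h e)
            fun h => (ih i hi).2 j h e.symm
      rw [hF b hb, if_neg hbom]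
      obtain ⟨h1, h2⟩ := hseq.newPerm_spec hS hP u hu hfib
      refine ⟨h1, fun c hc => ?_⟩
      have := h2 c (by rwa [dom_lam])
      rwa [app_lam _ hc] at this
  -- by replacement, the ordinals would be the image of a subset of `S`
  obtain ⟨b, hb, hbn⟩ := exists_ord_notMem (image S fun s => leastOrd fun c => recF G c = s)
  refine hbn ((mem_image _ _ _).2 ⟨recF G b, (key b hb).1, ?_⟩)
  obtain ⟨h1, h2, -⟩ := leastOrd_spec (P := fun c => recF G c = recF G b) hb rfl
  exact hb.eq_of_notMem h1 (fun h => (key _ h1).2 b h h2.symm) fun h => (key b hb).2 _ h h2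

end
end Recursion

/-! ### Comparing cardinals -/
section Cardinals
variable {M : Type*} [Membership M M] [ZF M]

theorem equinumerous_refl (x : M) : Equinumerous x x :=
  ⟨lam x fun z => z, isPermutation_iff.2 ⟨isFunction_lam fun _ h => h,
    fun a ha b hb e => by rwa [app_lam _ ha, app_lam _ hb] at e,
    fun b hb => ⟨b, hb, (app_lam (fun z => z) hb).symm⟩⟩⟩

theorem cardLE_of_subset {x y : M} (h : ∀ z ∈ x, z ∈ y) : CardLE x y :=
  ⟨x, y, equinumerous_refl x, equinumerous_refl y,
    injects_of (fun z => z) h fun _ _ _ _ e => e⟩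

theorem DftoMaps.cardLEDfto {x y : M} (h : DftoMaps x y) : CardLEDfto x y :=
  ⟨x, y, equinumerous_refl x, equinumerous_refl y, h⟩

theorem FtoMaps.dftoMaps {x y : M} (h : FtoMaps x y) : DftoMaps x y := by
  obtain ⟨f, hf, hf'⟩ := h
  refine ⟨f, hf, fun z hz => ?_⟩
  obtain ⟨t, ht, hfin⟩ := hf' z hz
  exact ⟨t, ht, hfin.powerDedekindFinite.dedekindFinite⟩

theorem Injects.dftoMaps {x y : M} (h : Injects x y) : DftoMaps x y := by
  obtain ⟨f, hf⟩ := h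
  refine ⟨f, hf.1, fun z ⟨a, ha⟩ => ⟨upair a a, fun b => ?_,
    (powerDedekindFinite_singleton a).dedekindFinite⟩⟩
  rw [mem_upair, or_self]
  exact ⟨fun e => e ▸ ha, fun hb => hf.2 b a z hb ha⟩

theorem CardLE.cardLEDfto {x y : M} (h : CardLE x y) : CardLEDfto x y := by
  obtain ⟨x', y', hx, hy, h⟩ := h
  exact ⟨x', y', hx, hy, h.dftoMaps⟩

/-- Maps between equinumerous copies can be transported to the sets themselves. Here `b` need not be
in the range of `u`: a Dedekind infinite fibre is nonempty. -/
theorem CardLEDfto.exists_map {x y : M} (h : CardLEDfto x y) :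
    ∃ u : M → M, Dfn M u ∧ (∀ a ∈ x, u a ∈ y) ∧
      ∀ b, DedekindFinite (sep x fun a => u a = b) := by
  obtain ⟨x', y', ⟨e, he⟩, ⟨k, hk⟩, f, hf, hfib⟩ := h
  obtain ⟨e', he', -, -⟩ := he.inverse
  obtain ⟨he1, he2⟩ := isInjection_iff.1 he'.1
  obtain ⟨hk1, hk2⟩ := isInjection_iff.1 hk.1
  have hmem : ∀ a ∈ x, app f (app e' a) ∈ y' := fun a ha => hf.app_mem (he1.app_mem ha)
  refine ⟨fun a => app k (app f (app e' a)), inferInstance, fun a ha => hk1.app_mem (hmem a ha),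
    fun b hinf => ?_⟩
  obtain ⟨g, hg⟩ := dedekindInfinite_iff.1 hinf
  obtain ⟨ha, hab⟩ := (mem_sep _ _ _).1 (hg.1.app_mem emp_mem_om)
  generalize app g (emp M) = a at ha hab
  obtain ⟨t, ht, hfin⟩ := hfib (app f (app e' a)) ⟨_, hf.pairMem.2 ⟨he1.app_mem ha, rfl⟩⟩
  refine hfin (hinf.map (app e') (fun c hc => (ht _).2 (hf.pairMem.2 ?_)) fun c hc d hd => ?_)
  · obtain ⟨hc, hcb⟩ := (mem_sep _ _ _).1 hc
    exact ⟨he1.app_mem hc, hk2 _ (hmem a ha) _ (hmem c hc) (hab.trans hcb.symm)⟩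
  · exact he2 c ((mem_sep _ _ _).1 hc).1 d ((mem_sep _ _ _).1 hd).1

theorem isMoved_iff {f x m : M} (hf : IsPermutation f x) : IsMoved m f ↔ m = moved x f := by
  have h : ∀ z, (∃ v, PairMem f z v ∧ v ≠ z) ↔ z ∈ moved x f := fun z => by
    simp only [hf.1.1.pairMem, mem_moved]
    exact ⟨fun ⟨v, ⟨hz, e⟩, hv⟩ => ⟨hz, e ▸ hv⟩, fun ⟨hz, hv⟩ => ⟨_, ⟨hz, rfl⟩, hv⟩⟩
  simp only [IsMoved, h]
  exact ⟨ext, fun e z => by rw [e]⟩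

-- A permutation of `x` is a set of pairs, hence an element of `℘(℘(℘(x)))`.
theorem exists_isSym (x : M) : ∃ S : M, IsSym S x := by
  have hdfn : Dfn M fun f : M => IsPermutation f x := by
    unfold IsPermutation IsBijection IsInjection IsFunction PairMem IsOrderedPair IsPair
    infer_instance
  refine ⟨sep (pow (pow (pow x))) fun f => IsPermutation f x, fun f => ?_⟩
  rw [mem_sep]
  refine ⟨And.right, fun hf => ⟨?_, hf⟩⟩
  have hf' := isPermutation_iff.1 hf
  rw [mem_pow]
  intro p hp
  rw [(isFunction_iff.1 hf'.1).1] at hp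
  obtain ⟨a, ha, rfl⟩ := (mem_image _ _ _).1 hp
  rw [mem_pow]
  intro q hq
  rw [mem_pow]
  intro r hr
  have hfa := hf'.1.app_mem ha
  rcases (mem_upair _ _ _).1 hq with rfl | rfl <;>
    rcases (mem_upair _ _ _).1 hr with rfl | rfl <;> assumption

theorem not_cardLEDfto_of_subset {x S P Q : M} (hS : IsSym S x) (hP : IsSymPdf P x)
    (hQ : ∀ f ∈ Q, f ∈ P) (hinf : DedekindInfinite S) : ¬ CardLEDfto S Q := by
  intro h
  obtain ⟨u, hu, hmem, hfib⟩ := h.exists_map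
  refine not_dedekindInfinite_sym (P := P) hS (fun f => (hP f).trans ?_) u
    (fun f hf => hQ _ (hmem f hf)) (fun y _ => hfib y) hinf
  refine and_congr_right fun hf => ?_
  simp [isMoved_iff hf]

theorem cardLT_of_not_cardLEDfto {x y : M} (h : ∀ z ∈ y, z ∈ x) (h' : ¬ CardLEDfto x y) :
    CardLT y x :=
  ⟨cardLE_of_subset h, fun h1 => h' h1.cardLEDfto⟩

end Cardinals

end InZF

/-- In every model `(M, ∈)` of ZF: for every set `x`, the sets `𝒮(x)`, `𝒮_pdf(x)`, `𝒮_fin(x)` exist,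
and if `𝒮(x)` is Dedekind infinite then the asserted non-existence of maps and strict inequalities
of cardinals hold. Here `x` represents an arbitrary cardinal `𝔞 = |x|`, with `𝔞! = |𝒮(x)|`,
`𝒮_pdf(𝔞) = |𝒮_pdf(x)|` and `𝒮_fin(𝔞) = |𝒮_fin(x)|`. -/
theorem theorem3p4 {M : Type*} [Membership M M] (hM : InZF.IsModelOfZF M) (x : M) :
    ∃ S Spdf Sfin : M,
      InZF.IsSym S x ∧ InZF.IsSymPdf Spdf x ∧ InZF.IsSymFin Sfin x ∧
      (InZF.DedekindInfinite S →
        (¬ InZF.DftoMaps S Spdf ∧ ¬ InZF.CardLEDfto S Spdf ∧ InZF.CardLT Spdf S) ∧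
        (¬ InZF.DftoMaps S Sfin ∧ ¬ InZF.FtoMaps S Sfin ∧
          ¬ InZF.CardLEDfto S Sfin ∧ InZF.CardLT Sfin S)) := by
  have : InZF.ZF M := ⟨hM⟩
  have hdfn : InZF.Dfn M fun m : M => InZF.IsFinite m := by
    unfold InZF.IsFinite InZF.IsOmega InZF.IsInductive InZF.Equinumerous InZF.IsBijection
      InZF.IsInjection InZF.IsFunction InZF.PairMem InZF.IsOrderedPair InZF.IsPair
    infer_instance
  obtain ⟨S, hS⟩ := InZF.exists_isSym x
  have hP : InZF.IsSymPdf (InZF.sep S fun f => InZF.PowerDedekindFinite (InZF.moved x f)) x :=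
    fun f => by
      rw [InZF.mem_sep, hS f]
      exact and_congr_right fun hf => by simp [InZF.isMoved_iff hf]
  have hF : InZF.IsSymFin (InZF.sep S fun f => InZF.IsFinite (InZF.moved x f)) x :=
    fun f => by
      rw [InZF.mem_sep, hS f]
      exact and_congr_right fun hf => by simp [InZF.isMoved_iff hf]
  refine ⟨S, _, _, hS, hP, hF, fun hinf => ?_⟩
  have hFP : ∀ f ∈ InZF.sep S fun f => InZF.IsFinite (InZF.moved x f),
      f ∈ InZF.sep S fun f => InZF.PowerDedekindFinite (InZF.moved x f) := fun f hf => by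
    obtain ⟨hfS, hfin⟩ := (InZF.mem_sep _ _ _).1 hf
    exact (InZF.mem_sep _ _ _).2 ⟨hfS, hfin.powerDedekindFinite⟩
  have h1 := InZF.not_cardLEDfto_of_subset hS hP (fun _ h => h) hinf
  have h2 := InZF.not_cardLEDfto_of_subset hS hP hFP hinf
  exact ⟨⟨fun h => h1 h.cardLEDfto, h1,
      InZF.cardLT_of_not_cardLEDfto (fun f hf => ((InZF.mem_sep _ _ _).1 hf).1) h1⟩,
    fun h => h2 h.cardLEDfto, fun h => h2 h.dftoMaps.cardLEDfto, h2,
    InZF.cardLT_of_not_cardLEDfto (fun f hf => ((InZF.mem_sep _ _ _).1 hf).1) h2⟩
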